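/- **Setting.** Fix $d\ge 1$. For finite $\Lambda\subset\mathbb Z$ let $\mathfrak A_\Lambda=\mathcal B(\bigotimes_{x\in\Lambda}\mathbb C^d)$ with the operator norm $\|\cdot\|$; for $\Lambda'\subset\Lambda$ identify $Q\in\mathfrak A_{\Lambda'}$ with $Q\otimes\mathbb 1_{\Lambda\setminus\Lambda'}\in\mathfrak A_\Lambda$. A local interaction $\Phi=(\Phi_X)_X$ assigns to every finite $X\subset\mathbb Z$ a self-adjoint $\Phi_X\in\mathfrak A_X$. It has range $r>0$ and strength $J>0$ if $\Phi_X=0$ whenever $\operatorname{diam}(X)>r$ and $\|\Phi_X\|\le J$ for all $X$. Put $H_\Lambda=\sum_{X\subset\Lambda}\Phi_X$ and $\rho^\Lambda=e^{-H_\Lambda}/\operatorname{Tr}(e^{-H_\Lambda})$. For a state $\rho$ on $I$ and $X\subset I$, let $\rho_X=\operatorname{tr}_{I\setminus X}(\rho)$ be the (unnormalized) partial trace, and for disjoint $A,C\subset I$ let $$\operatorname{Corr}_\rho(A:C)=\sup_{\|O_A\|=\|O_C\|=1}\big|\operatorname{Tr}\big[O_A\otimes O_C\,(\rho_{AC}-\rho_A\otimes\rho_C)\big]\big|,\qquad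 O_A\in\mathfrak A_A,\ O_C\in\mathfrak A_C.$$ For $\widetilde{\mathcal K},\widetilde\alpha>0$, $\Phi$ satisfies exponential uniform clustering with constants $\widetilde{\mathcal K},\widetilde\alpha$ if for every finite interval $I\subset\mathbb Z$ split into three consecutive (possibly empty) subintervals $I=ABC$ and every $\ell\ge 0$ with $|B|\ge\ell$ one has $\operatorname{Corr}_{\rho^I}(A:C)\le\widetilde{\mathcal K}e^{-\widetilde\alpha\ell}$. **Proposition 8.1.** For all $d\ge 1$ and $r,J,\widetilde{\mathcal K},\widetilde\alpha>0$ there are constants $\widehat{\mathcal K},\widehat\alpha>0$, depending only on $d,r,J,\widetilde{\mathcal K},\widetilde\alpha$, such that the following holds for every local interaction $\Phi$ of range $r$ and strength $J$ with local dimension $d$ that satisfies exponential uniform clustering with constants $\widetilde{\mathcal K},\widetilde\alpha$. For each finite interval $I\subset\mathbb Z$ split into three consecutive (possibly empty) subintervals $I=ABC$ with $|B|\ge 3\ell\ge 0$, and for $\rho=\rho^I$ the Gibbs state on $I$, $$\big\|\rho_A^{-1}\rho_C^{-1}\rho_{AC}-\mathbb 1\big\|\le\widehat{\mathcal K}\,e^{-\widehat\alpha\ell}.$$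 -/

import Mathlib

open scoped Matrix.Norms.L2Operator

noncomputable section

namespace SpinChain

/-- The algebra `𝔄_X = B(⨂_{x ∈ X} ℂ^d)` of observables on a finite set `X ⊂ ℤ` of sites, written as
matrices in the product basis (the basis vectors are the configurations `X → Fin d`).
The norm is the operator norm for the Euclidean norm. -/
abbrev Observable (d : ℕ) (X : Finset ℤ) : Type :=
  Matrix (X → Fin d) (X → Fin d) ℂ

/-- The canonical embedding `𝔄_X → 𝔄_Λ`, `Q ↦ Q ⊗ 𝟙_{Λ \ X}`, for `X ⊆ Λ`. -/
def embed {d : ℕ} {X Λ : Finset ℤ} (h : X ⊆ Λ) (Q : Observable d X) : Observable d Λ :=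
  Matrix.of fun σ τ =>
    if ∀ x : Λ, x.1 ∉ X → σ x = τ x then
      Q (Finset.restrict₂ (π := fun _ => Fin d) h σ) (Finset.restrict₂ (π := fun _ => Fin d) h τ)
    else 0

/-- The configuration on `Λ` that is `σ` on `X` and `η` on `Λ \ X`. -/
def glue {d : ℕ} {X Λ : Finset ℤ} (σ : X → Fin d) (η : (Λ \ X : Finset ℤ) → Fin d) : Λ → Fin d :=
  fun x => if hx : x.1 ∈ X then σ ⟨x.1, hx⟩ else η ⟨x.1, Finset.mem_sdiff.2 ⟨x.2, hx⟩⟩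

/-- The reduction of `Q ∈ 𝔄_Λ` to `X ⊆ Λ`: the unnormalized partial trace over `Λ \ X`,
`R ⊗ S ↦ Tr(S) R` for `R ∈ 𝔄_X`, `S ∈ 𝔄_{Λ \ X}`. -/
def reduce {d : ℕ} {Λ : Finset ℤ} (X : Finset ℤ) (Q : Observable d Λ) : Observable d X :=
  Matrix.of fun σ τ => ∑ η : (Λ \ X : Finset ℤ) → Fin d, Q (glue σ η) (glue τ η)

/-- A local interaction on `ℤ`: a self-adjoint `Φ_X ∈ 𝔄_X` for every finite `X ⊂ ℤ`. -/
structure LocalInteraction (d : ℕ) where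
  /-- The interaction terms. -/
  term : (X : Finset ℤ) → Observable d X
  isHermitian : ∀ X, (term X).IsHermitian

/-- `Φ_X = 0` whenever the diameter of `X` is larger than `r`. -/
def LocalInteraction.HasRange {d : ℕ} (Φ : LocalInteraction d) (r : ℝ) : Prop :=
  ∀ X : Finset ℤ, r < Metric.diam (X : Set ℤ) → Φ.term X = 0

/-- `‖Φ_X‖ ≤ J` for all `X`. -/
def LocalInteraction.HasStrength {d : ℕ} (Φ : LocalInteraction d) (J : ℝ) : Prop :=
  ∀ X : Finset ℤ, ‖Φ.term X‖ ≤ J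

/-- The Hamiltonian `H_Λ = ∑_{X ⊆ Λ} Φ_X`. -/
def LocalInteraction.hamiltonian {d : ℕ} (Φ : LocalInteraction d) (Λ : Finset ℤ) :
    Observable d Λ :=
  ∑ X ∈ Λ.powerset.attach, embed (Finset.mem_powerset.1 X.2) (Φ.term X.1)

/-- The Gibbs state `ρ^Λ = e^{-H_Λ} / Tr(e^{-H_Λ})`. -/
def LocalInteraction.gibbs {d : ℕ} (Φ : LocalInteraction d) (Λ : Finset ℤ) : Observable d Λ :=
  (NormedSpace.exp (-Φ.hamiltonian Λ)).trace⁻¹ • NormedSpace.exp (-Φ.hamiltonian Λ)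

/-- The covariance correlation
`Corr_ρ(A : C) = sup |Tr[(O_A ⊗ O_C) (ρ_{AC} - ρ_A ⊗ ρ_C)]|`, the supremum over all `O_A ∈ 𝔄_A` and
`O_C ∈ 𝔄_C` of operator norm one, for disjoint `A, C ⊆ Λ`. -/
def corr {d : ℕ} {Λ : Finset ℤ} (ρ : Observable d Λ) (A C : Finset ℤ) : ℝ :=
  sSup {t : ℝ | ∃ (QA : Observable d A) (QC : Observable d C), ‖QA‖ = 1 ∧ ‖QC‖ = 1 ∧
    t = ‖Matrix.trace
      (embed (Finset.subset_union_left (s₁ := A) (s₂ := C)) QA *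
        embed (Finset.subset_union_right (s₁ := A) (s₂ := C)) QC *
        (reduce (A ∪ C) ρ -
          embed (Finset.subset_union_left (s₁ := A) (s₂ := C)) (reduce A ρ) *
            embed (Finset.subset_union_right (s₁ := A) (s₂ := C)) (reduce C ρ)))‖}

/-- The embedding is linear. -/
def embedLin {d : ℕ} {X Λ : Finset ℤ} (h : X ⊆ Λ) : Observable d X →ₗ[ℂ] Observable d Λ where
  toFun := embed h
  map_add' P Q := by
    ext σ τ
    simp only [embed, Matrix.of_apply, Matrix.add_apply]
    split_ifs <;> simp
  map_smul' c Q := by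
    ext σ τ
    simp [embed]

/-- The set in the definition of `corr` is bounded, so that its `sSup` is a genuine supremum. -/
theorem le_corr {d : ℕ} {Λ : Finset ℤ} (ρ : Observable d Λ) (A C : Finset ℤ)
    (QA : Observable d A) (QC : Observable d C) (hA : ‖QA‖ = 1) (hC : ‖QC‖ = 1) :
    ‖Matrix.trace
      (embed (Finset.subset_union_left (s₁ := A) (s₂ := C)) QA *
        embed (Finset.subset_union_right (s₁ := A) (s₂ := C)) QC *
        (reduce (A ∪ C) ρ -
          embed (Finset.subset_union_left (s₁ := A) (s₂ := C)) (reduce A ρ) *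
            embed (Finset.subset_union_right (s₁ := A) (s₂ := C)) (reduce C ρ)))‖
      ≤ corr ρ A C := by
  refine le_csSup ?_ ⟨QA, QC, hA, hC, rfl⟩
  set D := (reduce (A ∪ C) ρ -
          embed (Finset.subset_union_left (s₁ := A) (s₂ := C)) (reduce A ρ) *
            embed (Finset.subset_union_right (s₁ := A) (s₂ := C)) (reduce C ρ)) with hD
  let tr : Observable d (A ∪ C) →L[ℂ] ℂ :=
    LinearMap.toContinuousLinearMap (Matrix.traceLinearMap (↥(A ∪ C) → Fin d) ℂ ℂ)
  let eA : Observable d A →L[ℂ] Observable d (A ∪ C) :=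
    LinearMap.toContinuousLinearMap (embedLin Finset.subset_union_left)
  let eC : Observable d C →L[ℂ] Observable d (A ∪ C) :=
    LinearMap.toContinuousLinearMap (embedLin Finset.subset_union_right)
  refine ⟨‖tr‖ * (‖eA‖ * ‖eC‖ * ‖D‖), ?_⟩
  rintro t ⟨PA, PC, hPA, hPC, rfl⟩
  have h1 : ‖eA PA‖ ≤ ‖eA‖ := by simpa [hPA] using eA.le_opNorm PA
  have h2 : ‖eC PC‖ ≤ ‖eC‖ := by simpa [hPC] using eC.le_opNorm PC
  calc ‖tr (eA PA * eC PC * D)‖ ≤ ‖tr‖ * ‖eA PA * eC PC * D‖ := tr.le_opNorm _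
    _ ≤ ‖tr‖ * (‖eA PA‖ * ‖eC PC‖ * ‖D‖) := by
        gcongr
        exact (norm_mul_le _ _).trans (by gcongr; exact norm_mul_le _ _)
    _ ≤ _ := by gcongr

/-- `Φ` is uniform clustering with the positive and decreasing function `ε`: for every finite
interval `I = ABC` split into subintervals `A = [a, b)`, `B = [b, c)`, `C = [c, e)` with `|B| ≥ ℓ`,
the Gibbs state on `I` has `Corr(A : C) ≤ ε(ℓ)`. -/
structure LocalInteraction.UniformClustering {d : ℕ} (Φ : LocalInteraction d) (ε : ℝ → ℝ) :
    Prop where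
  pos : ∀ ℓ, 0 ≤ ℓ → 0 < ε ℓ
  anti : AntitoneOn ε (Set.Ici 0)
  corr_le : ∀ a b c e : ℤ, a ≤ b → b ≤ c → c ≤ e →
    ∀ ℓ : ℝ, 0 ≤ ℓ → ℓ ≤ (Finset.Ico b c).card →
      corr (Φ.gibbs (Finset.Ico a e)) (Finset.Ico a b) (Finset.Ico c e) ≤ ε ℓ

/-- The reduced operator `ρ_X = tr_{Λ \ X}(ρ)`, regarded as an element of `𝔄_Λ`. -/
def reduced {d : ℕ} {Λ X : Finset ℤ} (h : X ⊆ Λ) (ρ : Observable d Λ) : Observable d Λ :=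
  embed h (reduce X ρ)

end SpinChain

end

/-!
Write `E = e^{H_A + H_B + H_C} e^{-H_I}` for the expansional of the interaction across the two cuts.
Araki's commutator expansion shows that the imaginary-time evolution of this interaction is bounded
and depends on sites at distance `n R` only up to an error smaller than any exponential in `n`, so
`‖E‖` and `‖E⁻¹‖` are bounded independently of `I`, and `E` is nearly supported near the cuts.

Let `F` be the average of `E` over the Gibbs state of `B`, and let `F_A` and `F_C` be the further
averages of `F` over the Gibbs states of `C` and of `A`. The marginals of the Gibbs state `ρ` are,
up to scalars, `ρ_A = e^{-H_A} F_A`, `ρ_C = e^{-H_C} F_C` and `ρ_{AC} = e^{-H_A} e^{-H_C} F`. Hence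
`ρ_A⁻¹ ρ_C⁻¹ ρ_{AC} - 1` is small as soon as `F` is close to a multiple of `F_A F_C` and these have
uniformly bounded inverses. Truncating to `n R` sites around `B` reduces both to short intervals `A`
and `C`: there the inverses have an explicit bound, exponential in `n`, and clustering makes
`ρ_{AC} - ρ_A ρ_C` small at the cost of another factor exponential in `n`. Invertibility follows for
one fixed large `n` because the truncation error decays faster than any exponential, and
the distance of `F` to a multiple of `F_A F_C` is controlled by taking `n` proportional to `ℓ`.
-/

noncomputable section

namespace SpinChain

open NormedSpace

section Evolution

variable {𝔐 : Type*} [NormedRing 𝔐]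

theorem norm_lie_le {D W : 𝔐} {c w : ℝ} (hD : ‖D‖ ≤ c) (hW : ‖W‖ ≤ w) :
    ‖⁅D, W⁆‖ ≤ 2 * c * w := by
  have hc : 0 ≤ c := (norm_nonneg D).trans hD
  have hw : 0 ≤ w := (norm_nonneg W).trans hW
  calc ‖⁅D, W⁆‖ ≤ ‖D‖ * ‖W‖ + ‖W‖ * ‖D‖ :=
        (norm_sub_le _ _).trans (add_le_add (norm_mul_le _ _) (norm_mul_le _ _))
    _ ≤ c * w + w * c := by gcongr
    _ = 2 * c * w := by ring

variable [NormedAlgebra ℝ 𝔐]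

/-- The imaginary-time evolution `e^{sH} V e^{-sH}` of the observable `V` under the
Hamiltonian `H`. -/
def evolve (s : ℝ) (H V : 𝔐) : 𝔐 :=
  exp (s • H) * V * exp ((-s) • H)

theorem evolve_zero (H V : 𝔐) : evolve 0 H V = V := by
  simp [evolve]

theorem commute_evolve {D H V : 𝔐} (s : ℝ) (hH : Commute D H) (hV : Commute D V) :
    Commute D (evolve s H V) :=
  (((hH.smul_right s).exp_right).mul_right hV).mul_right ((hH.smul_right (-s)).exp_right)

section NormOne

variable [NormOneClass 𝔐]

theorem norm_exp_le (x : 𝔐) : ‖exp x‖ ≤ Real.exp ‖x‖ := by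
  rw [exp_eq_tsum ℝ, Real.exp_eq_exp_ℝ, exp_eq_tsum ℝ]
  refine tsum_of_norm_bounded (expSeries_summable' (𝕂 := ℝ) ‖x‖).hasSum fun n => ?_
  rw [norm_smul, smul_eq_mul, norm_inv, Real.norm_natCast]
  gcongr
  exact norm_pow_le x n

theorem norm_exp_smul_le {c : ℝ} {x : 𝔐} (hx : ‖x‖ ≤ c) (s : ℝ) :
    ‖exp (s • x)‖ ≤ Real.exp (|s| * c) := by
  refine (norm_exp_le _).trans (Real.exp_le_exp.2 ?_)
  rw [norm_smul, Real.norm_eq_abs]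
  gcongr

theorem norm_evolve_le {s c : ℝ} (hs : 0 ≤ s) {H : 𝔐} (hH : ‖H‖ ≤ c) (V : 𝔐) :
    ‖evolve s H V‖ ≤ Real.exp (2 * s * c) * ‖V‖ := by
  have hpos := norm_exp_smul_le hH s
  have hneg := norm_exp_smul_le hH (-s)
  rw [abs_neg] at hneg
  rw [abs_of_nonneg hs] at hpos hneg
  calc ‖evolve s H V‖ ≤ ‖exp (s • H)‖ * ‖V‖ * ‖exp ((-s) • H)‖ := norm_mul₃_le
    _ ≤ Real.exp (s * c) * ‖V‖ * Real.exp (s * c) := by gcongr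
    _ = Real.exp (2 * s * c) * ‖V‖ := by
        rw [show 2 * s * c = s * c + s * c by ring, Real.exp_add]; ring

theorem norm_evolve_lie_le {s C c w : ℝ} (hs : 0 ≤ s) {H D W : 𝔐} (hH : ‖H‖ ≤ C) (hD : ‖D‖ ≤ c)
    (hW : ‖W‖ ≤ w) : ‖evolve s H ⁅D, W⁆‖ ≤ Real.exp (2 * s * C) * (2 * c * w) :=
  (norm_evolve_le hs hH _).trans (by gcongr; exact norm_lie_le hD hW)

end NormOne

section Complete

variable [CompleteSpace 𝔐]

theorem exp_smul_mul_exp_neg_smul (s : ℝ) (H : 𝔐) : exp (s • H) * exp ((-s) • H) = 1 := by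
  let := NormedAlgebra.restrictScalars ℚ ℝ 𝔐
  rw [← exp_add_of_commute (((Commute.refl H).smul_left s).smul_right (-s)), ← add_smul,
    add_neg_cancel, zero_smul, exp_zero]

theorem exp_neg_smul_mul_exp_smul (s : ℝ) (H : 𝔐) : exp ((-s) • H) * exp (s • H) = 1 := by
  simpa using exp_smul_mul_exp_neg_smul (-s) H

theorem hasDerivAt_exp_neg_smul (H : 𝔐) (u : ℝ) :
    HasDerivAt (fun u : ℝ => exp ((-u) • H)) (-(H * exp ((-u) • H))) u := by
  simpa [neg_smul, Function.comp_def] using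
    (hasDerivAt_exp_smul_const' (𝕂 := ℝ) H (-u)).scomp u (hasDerivAt_neg u)

theorem hasDerivAt_exp_neg_smul' (H : 𝔐) (u : ℝ) :
    HasDerivAt (fun u : ℝ => exp ((-u) • H)) (-(exp ((-u) • H) * H)) u := by
  simpa [neg_smul, Function.comp_def] using
    (hasDerivAt_exp_smul_const (𝕂 := ℝ) H (-u)).scomp u (hasDerivAt_neg u)

theorem hasDerivAt_evolve (H V : 𝔐) (u : ℝ) :
    HasDerivAt (fun u => evolve u H V) ⁅H, evolve u H V⁆ u := by
  refine (((hasDerivAt_exp_smul_const' (𝕂 := ℝ) H u).mul_const V).mul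
    (hasDerivAt_exp_neg_smul' H u)).congr_deriv ?_
  simp only [evolve, Ring.lie_def]
  noncomm_ring

theorem hasDerivAt_evolve_evolve (H H' V : 𝔐) (s u : ℝ) :
    HasDerivAt (fun u => evolve (s - u) H' (evolve u H V))
      (-evolve (s - u) H' ⁅H' - H, evolve u H V⁆) u := by
  have hsub : HasDerivAt (fun u : ℝ => s - u) (-1) u := by
    simpa using (hasDerivAt_id u).const_sub s
  have hleft := (hasDerivAt_exp_smul_const (𝕂 := ℝ) H' (s - u)).scomp u hsub
  have hright := (hasDerivAt_exp_neg_smul H' (s - u)).scomp u hsub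
  refine ((hleft.mul (hasDerivAt_evolve H V u)).mul hright).congr_deriv ?_
  simp only [evolve, Ring.lie_def, Function.comp_apply, Pi.mul_apply, neg_smul, one_smul, neg_neg]
  noncomm_ring

theorem norm_evolve_sub_evolve_le {H H' V : 𝔐} {s : ℝ} (hs : 0 ≤ s) {B B' : ℝ → ℝ}
    (hB0 : 0 ≤ B 0) (hB : ∀ u, HasDerivAt B (B' u) u)
    (hbd : ∀ u ∈ Set.Ico 0 s, ‖evolve (s - u) H' ⁅H' - H, evolve u H V⁆‖ ≤ B' u) :
    ‖evolve s H' V - evolve s H V‖ ≤ B s := by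
  let f : ℝ → 𝔐 := fun u => evolve s H' V - evolve (s - u) H' (evolve u H V)
  have hf : ∀ u, HasDerivAt f (evolve (s - u) H' ⁅H' - H, evolve u H V⁆) u := fun u => by
    simpa [f] using (hasDerivAt_evolve_evolve H H' V s u).const_sub (evolve s H' V)
  have := image_norm_le_of_norm_deriv_right_le_deriv_boundary (f := f) (a := 0) (b := s)
    (fun u _ => (hf u).continuousAt.continuousWithinAt) (fun u _ => (hf u).hasDerivWithinAt)
    (by simpa [f, evolve_zero] using hB0) hB hbd (Set.right_mem_Icc.2 hs)
  simpa [f, evolve_zero] using this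

end Complete

end Evolution

section Araki

theorem hasDerivAt_const_mul_pow_div_factorial (M c : ℝ) (m : ℕ) (u : ℝ) :
    HasDerivAt (fun u : ℝ => M * ((c * u) ^ (m + 1) / (m + 1).factorial))
      (M * (c * ((c * u) ^ m / m.factorial))) u := by
  refine (((((hasDerivAt_id u).const_mul c).pow (m + 1)).div_const
    ((m + 1).factorial : ℝ)).const_mul M).congr_deriv ?_
  have : (m.factorial : ℝ) ≠ 0 := by positivity
  rw [Nat.factorial_succ]
  push_cast
  simp only [id, mul_one]
  field_simp

theorem sum_Ico_pow_succ_div_factorial_le {q t : ℝ} (hq : 0 ≤ q) (ht : 1 ≤ t) (n m : ℕ) :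
    ∑ k ∈ Finset.Ico n m, q ^ (k + 1) / (k + 1).factorial ≤ Real.exp (q * t) / t ^ n := by
  rw [le_div_iff₀ (by positivity), Finset.sum_mul]
  calc ∑ k ∈ Finset.Ico n m, q ^ (k + 1) / (k + 1).factorial * t ^ n
      ≤ ∑ k ∈ Finset.Ico n m, (q * t) ^ (k + 1) / (k + 1).factorial := by
        refine Finset.sum_le_sum fun k hk => ?_
        have hnk : n ≤ k + 1 := (Finset.mem_Ico.1 hk).1.trans k.le_succ
        rw [mul_pow, div_mul_eq_mul_div]
        gcongr
    _ ≤ ∑ k ∈ Finset.range (m + 1), (q * t) ^ k / k.factorial := by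
        rw [Finset.sum_range_succ' _ m, Finset.range_eq_Ico]
        refine le_add_of_le_of_nonneg (Finset.sum_le_sum_of_subset_of_nonneg
          (Finset.Ico_subset_Ico_left n.zero_le) fun _ _ _ => ?_) ?_ <;> positivity
    _ ≤ Real.exp (q * t) := Real.sum_le_exp_of_nonneg (by positivity) (m + 1)

variable {𝔐 : Type*} [NormedRing 𝔐]

/-- A sequence of Hamiltonians of linearly growing norm that converges to a Hamiltonian of a chain
by adding the interactions with sites further and further away from the support of `V`: each
increment commutes with `V` and with everything two steps before. -/
structure IsLocalExhaustion (H : ℕ → 𝔐) (V : 𝔐) (c : ℝ) : Prop where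
  norm_le : ∀ k, ‖H k‖ ≤ c * (k + 1)
  norm_succ_sub_le : ∀ k, ‖H (k + 1) - H k‖ ≤ c
  commute_sub : ∀ k, Commute (H (k + 2) - H (k + 1)) (H k)
  commute_sub_observable : ∀ k, Commute (H (k + 2) - H (k + 1)) V

namespace IsLocalExhaustion

variable {H : ℕ → 𝔐} {V : 𝔐} {c : ℝ}

theorem nonneg (hH : IsLocalExhaustion H V c) : 0 ≤ c := by
  simpa using (norm_nonneg _).trans (hH.norm_succ_sub_le 0)

variable [NormedAlgebra ℝ 𝔐] [CompleteSpace 𝔐] [NormOneClass 𝔐]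

theorem norm_evolve_one_sub_le (hH : IsLocalExhaustion H V c) {s : ℝ} (hs : 0 ≤ s) :
    ‖evolve s (H 1) V - evolve s (H 0) V‖ ≤ ‖V‖ * Real.exp (2 * c * 2 * s) * (2 * c * s) := by
  have hc := hH.nonneg
  have hder := hasDerivAt_const_mul_pow_div_factorial
    (‖V‖ * Real.exp (2 * c * 2 * s)) (2 * c) 0
  simp only [zero_add, pow_one, pow_zero, Nat.factorial_zero, Nat.factorial_one, Nat.cast_one,
    div_one, mul_one] at hder
  refine norm_evolve_sub_evolve_le hs (by simp) hder fun u hu => ?_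
  have hu0 : 0 ≤ u := hu.1
  have hevolve : ‖evolve u (H 0) V‖ ≤ Real.exp (2 * u * c) * ‖V‖ :=
    norm_evolve_le hu0 (by simpa using hH.norm_le 0) V
  calc ‖evolve (s - u) (H 1) ⁅H 1 - H 0, evolve u (H 0) V⁆‖
      ≤ Real.exp (2 * (s - u) * (c * ((1 : ℕ) + 1))) * (2 * c * (Real.exp (2 * u * c) * ‖V‖)) :=
        norm_evolve_lie_le (sub_nonneg.2 hu.2.le) (hH.norm_le 1) (hH.norm_succ_sub_le 0) hevolve
    _ = 2 * c * ‖V‖ * Real.exp (2 * (s - u) * (c * ((1 : ℕ) + 1)) + 2 * u * c) := by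
        rw [Real.exp_add]; ring
    _ ≤ 2 * c * ‖V‖ * Real.exp (2 * c * 2 * s) := by
        gcongr
        push_cast
        nlinarith [mul_nonneg hc hu0]
    _ = ‖V‖ * Real.exp (2 * c * 2 * s) * (2 * c) := by ring

/-- Araki's estimate: Duhamel's formula trades one commutator for one factor `2 c s / (k + 1)`. -/
theorem norm_evolve_succ_sub_le (hH : IsLocalExhaustion H V c) (k : ℕ) {s : ℝ} (hs : 0 ≤ s) :
    ‖evolve s (H (k + 1)) V - evolve s (H k) V‖ ≤
      ‖V‖ * Real.exp (2 * c * (k + 2) * s) * ((2 * c * s) ^ (k + 1) / (k + 1).factorial) := by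
  have hc := hH.nonneg
  induction k generalizing s with
  | zero => simpa using hH.norm_evolve_one_sub_le hs
  | succ k ih =>
    refine norm_evolve_sub_evolve_le hs (by simp)
      (hasDerivAt_const_mul_pow_div_factorial _ (2 * c) (k + 1)) fun u hu => ?_
    have hu0 : 0 ≤ u := hu.1
    have hcomm : ⁅H (k + 2) - H (k + 1), evolve u (H (k + 1)) V⁆ =
        ⁅H (k + 2) - H (k + 1), evolve u (H (k + 1)) V - evolve u (H k) V⁆ := by
      have := (commute_evolve u (hH.commute_sub k) (hH.commute_sub_observable k)).eq
      simp only [Ring.lie_def]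
      linear_combination (norm := noncomm_ring) this
    calc ‖evolve (s - u) (H (k + 2)) ⁅H (k + 2) - H (k + 1), evolve u (H (k + 1)) V⁆‖
        ≤ Real.exp (2 * (s - u) * (c * ((k + 2 : ℕ) + 1))) * (2 * c * (‖V‖ *
            Real.exp (2 * c * (k + 2) * u) * ((2 * c * u) ^ (k + 1) / (k + 1).factorial))) := by
          rw [hcomm]
          exact norm_evolve_lie_le (sub_nonneg.2 hu.2.le) (hH.norm_le (k + 2))
            (hH.norm_succ_sub_le (k + 1)) (ih hu0)
      _ = ‖V‖ * Real.exp (2 * (s - u) * (c * ((k + 2 : ℕ) + 1)) + 2 * c * (k + 2) * u) *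
            (2 * c * ((2 * c * u) ^ (k + 1) / (k + 1).factorial)) := by
          rw [Real.exp_add]; ring
      _ ≤ ‖V‖ * Real.exp (2 * c * ((k + 1 : ℕ) + 2) * s) *
            (2 * c * ((2 * c * u) ^ (k + 1) / (k + 1).factorial)) := by
          gcongr
          push_cast
          nlinarith [mul_nonneg hc hu0]

theorem norm_evolve_sub_evolve_le_div_pow (hH : IsLocalExhaustion H V c) {t : ℝ} (ht : 1 ≤ t)
    {s : ℝ} (hs : s ∈ Set.Icc (0 : ℝ) 1) {n m : ℕ} (hnm : n ≤ m) :
    ‖evolve s (H m) V - evolve s (H n) V‖ ≤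
      ‖V‖ * Real.exp (2 * c) * (Real.exp (2 * c * Real.exp (2 * c) * t) / t ^ n) := by
  have hc := hH.nonneg
  have hs0 := hs.1
  set q := 2 * c * Real.exp (2 * c)
  have hstep (k : ℕ) : ‖evolve s (H (k + 1)) V - evolve s (H k) V‖ ≤
      ‖V‖ * Real.exp (2 * c) * (q ^ (k + 1) / (k + 1).factorial) := by
    have hexp : Real.exp (2 * c * (k + 2) * 1) = Real.exp (2 * c) * Real.exp (2 * c) ^ (k + 1) := by
      rw [← Real.exp_nat_mul, ← Real.exp_add]
      congr 1
      push_cast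
      ring
    calc ‖evolve s (H (k + 1)) V - evolve s (H k) V‖
        ≤ ‖V‖ * Real.exp (2 * c * (k + 2) * s) * ((2 * c * s) ^ (k + 1) / (k + 1).factorial) :=
          hH.norm_evolve_succ_sub_le k hs0
      _ ≤ ‖V‖ * Real.exp (2 * c * (k + 2) * 1) * ((2 * c * 1) ^ (k + 1) / (k + 1).factorial) := by
          gcongr <;> exact hs.2
      _ = ‖V‖ * Real.exp (2 * c) * (q ^ (k + 1) / (k + 1).factorial) := by
          rw [hexp, mul_pow]
          ring
  calc ‖evolve s (H m) V - evolve s (H n) V‖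
      ≤ ∑ k ∈ Finset.Ico n m, ‖evolve s (H (k + 1)) V - evolve s (H k) V‖ := by
        rw [← Finset.sum_Ico_sub (fun k => evolve s (H k) V) hnm]
        exact norm_sum_le _ _
    _ ≤ ‖V‖ * Real.exp (2 * c) * ∑ k ∈ Finset.Ico n m, q ^ (k + 1) / (k + 1).factorial := by
        rw [Finset.mul_sum]
        exact Finset.sum_le_sum fun k _ => hstep k
    _ ≤ ‖V‖ * Real.exp (2 * c) * (Real.exp (q * t) / t ^ n) := by
        gcongr
        exact sum_Ico_pow_succ_div_factorial_le (by positivity) ht n m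

theorem norm_evolve_le (hH : IsLocalExhaustion H V c) {s : ℝ} (hs : s ∈ Set.Icc (0 : ℝ) 1) (m : ℕ) :
    ‖evolve s (H m) V‖ ≤ ‖V‖ * Real.exp (2 * c) * (1 + Real.exp (2 * c * Real.exp (2 * c))) := by
  have hc := hH.nonneg
  have hdiff := hH.norm_evolve_sub_evolve_le_div_pow le_rfl hs m.zero_le
  simp only [mul_one, pow_zero, div_one] at hdiff
  have hzero : ‖evolve s (H 0) V‖ ≤ Real.exp (2 * c) * ‖V‖ :=
    (SpinChain.norm_evolve_le hs.1 (by simpa using hH.norm_le 0) V).trans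
      (by gcongr; nlinarith [hs.2])
  linarith [norm_le_norm_add_norm_sub' (evolve s (H m) V) (evolve s (H 0) V)]

end IsLocalExhaustion

end Araki

section Expansional

variable {𝔐 : Type*} [NormedRing 𝔐] [NormedAlgebra ℝ 𝔐]

/-- Araki's expansional `e^{sH} e^{-s(H + V)}`, which turns the Gibbs weight of `H` into that of the
perturbed Hamiltonian `H + V`. -/
def expansional (s : ℝ) (H V : 𝔐) : 𝔐 :=
  exp (s • H) * exp ((-s) • (H + V))

/-- The inverse `e^{s(H + V)} e^{-sH}` of the expansional. -/
def expansionalInv (s : ℝ) (H V : 𝔐) : 𝔐 :=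
  exp (s • (H + V)) * exp ((-s) • H)

theorem expansional_zero (H V : 𝔐) : expansional 0 H V = 1 := by
  simp [expansional]

theorem expansionalInv_zero (H V : 𝔐) : expansionalInv 0 H V = 1 := by
  simp [expansionalInv]

theorem norm_le_exp_of_norm_deriv_le [NormOneClass 𝔐] {f f' : ℝ → 𝔐} {g : ℝ}
    (hf : ∀ s, HasDerivAt f (f' s) s) (h0 : f 0 = 1)
    (hf' : ∀ s ∈ Set.Icc (0 : ℝ) 1, ‖f' s‖ ≤ g * ‖f s‖) {s : ℝ} (hs : s ∈ Set.Icc (0 : ℝ) 1) :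
    ‖f s‖ ≤ Real.exp g := by
  have hg : 0 ≤ g := by
    simpa [h0] using (norm_nonneg _).trans (hf' 0 (Set.left_mem_Icc.2 zero_le_one))
  have := norm_le_gronwallBound_of_norm_deriv_right_le (f := f) (f' := f') (δ := 1) (K := g)
    (ε := 0) (a := 0) (b := 1) (fun u _ => (hf u).continuousAt.continuousWithinAt)
    (fun u _ => (hf u).hasDerivWithinAt) (by simp [h0])
    (fun u hu => by simpa using hf' u (Set.Ico_subset_Icc_self hu)) s hs
  rw [gronwallBound_ε0, one_mul, sub_zero] at this
  exact this.trans (Real.exp_le_exp.2 (mul_le_of_le_one_right hg hs.2))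

variable [CompleteSpace 𝔐]

theorem expansional_mul_expansionalInv (s : ℝ) (H V : 𝔐) :
    expansional s H V * expansionalInv s H V = 1 := by
  rw [expansional, expansionalInv, mul_assoc, ← mul_assoc (exp ((-s) • (H + V))),
    exp_neg_smul_mul_exp_smul, one_mul, exp_smul_mul_exp_neg_smul]

theorem hasDerivAt_expansional (H V : 𝔐) (s : ℝ) :
    HasDerivAt (fun s => expansional s H V) (-(evolve s H V * expansional s H V)) s := by
  refine ((hasDerivAt_exp_smul_const (𝕂 := ℝ) H s).mul
    (hasDerivAt_exp_neg_smul (H + V) s)).congr_deriv ?_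
  rw [evolve, expansional, mul_assoc (exp (s • H) * V), ← mul_assoc (exp ((-s) • H)),
    exp_neg_smul_mul_exp_smul, one_mul]
  noncomm_ring

theorem hasDerivAt_expansionalInv (H V : 𝔐) (s : ℝ) :
    HasDerivAt (fun s => expansionalInv s H V) (expansionalInv s H V * evolve s H V) s := by
  refine ((hasDerivAt_exp_smul_const (𝕂 := ℝ) (H + V) s).mul
    (hasDerivAt_exp_neg_smul H s)).congr_deriv ?_
  rw [evolve, expansionalInv, mul_assoc _ (exp ((-s) • H)), ← mul_assoc (exp ((-s) • H)),
    ← mul_assoc (exp ((-s) • H)), exp_neg_smul_mul_exp_smul, one_mul]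
  noncomm_ring

variable [NormOneClass 𝔐] {H V H' V' : 𝔐} {g δ : ℝ}

theorem norm_expansional_le (h : ∀ s ∈ Set.Icc (0 : ℝ) 1, ‖evolve s H V‖ ≤ g) {s : ℝ}
    (hs : s ∈ Set.Icc (0 : ℝ) 1) : ‖expansional s H V‖ ≤ Real.exp g := by
  refine norm_le_exp_of_norm_deriv_le (hasDerivAt_expansional H V) (expansional_zero H V)
    (fun u hu => ?_) hs
  rw [norm_neg]
  exact norm_mul_le_of_le (h u hu) le_rfl

theorem norm_expansionalInv_le (h : ∀ s ∈ Set.Icc (0 : ℝ) 1, ‖evolve s H V‖ ≤ g) {s : ℝ}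
    (hs : s ∈ Set.Icc (0 : ℝ) 1) : ‖expansionalInv s H V‖ ≤ Real.exp g := by
  refine norm_le_exp_of_norm_deriv_le (hasDerivAt_expansionalInv H V) (expansionalInv_zero H V)
    (fun u hu => ?_) hs
  rw [mul_comm g]
  exact norm_mul_le_of_le le_rfl (h u hu)

theorem norm_expansionalInv_mul_expansional_sub_one_le
    (h : ∀ s ∈ Set.Icc (0 : ℝ) 1, ‖evolve s H V‖ ≤ g)
    (h' : ∀ s ∈ Set.Icc (0 : ℝ) 1, ‖evolve s H' V'‖ ≤ g)
    (hd : ∀ s ∈ Set.Icc (0 : ℝ) 1, ‖evolve s H V - evolve s H' V'‖ ≤ δ) :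
    ‖expansionalInv 1 H' V' * expansional 1 H V - 1‖ ≤ Real.exp (2 * g) * δ := by
  let K : ℝ → 𝔐 := fun s => expansionalInv s H' V' * expansional s H V - 1
  let K' : ℝ → 𝔐 := fun s =>
    expansionalInv s H' V' * (evolve s H' V' - evolve s H V) * expansional s H V
  have hK (s : ℝ) : HasDerivAt K (K' s) s := by
    refine (((hasDerivAt_expansionalInv H' V' s).mul
      (hasDerivAt_expansional H V s)).sub_const 1).congr_deriv ?_
    simp only [K']
    noncomm_ring
  have hK' : ∀ u ∈ Set.Ico (0 : ℝ) 1, ‖K' u‖ ≤ Real.exp (2 * g) * δ := fun u hu => by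
    have hu := Set.Ico_subset_Icc_self hu
    calc ‖K' u‖ ≤ Real.exp g * δ * Real.exp g :=
          norm_mul_le_of_le (norm_mul_le_of_le (norm_expansionalInv_le h' hu)
            (norm_sub_rev (evolve u H V) _ ▸ hd u hu)) (norm_expansional_le h hu)
      _ = Real.exp (2 * g) * δ := by rw [two_mul, Real.exp_add]; ring
  simpa using image_norm_le_of_norm_deriv_right_le_deriv_boundary (f := K) (a := 0) (b := 1)
    (B := fun u => Real.exp (2 * g) * δ * u) (B' := fun _ => Real.exp (2 * g) * δ)
    (fun u _ => (hK u).continuousAt.continuousWithinAt) (fun u _ => (hK u).hasDerivWithinAt)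
    (by simp [K, expansional_zero, expansionalInv_zero])
    (fun u => by simpa using (hasDerivAt_id u).const_mul (Real.exp (2 * g) * δ))
    hK' (Set.right_mem_Icc.2 zero_le_one)

theorem norm_expansional_sub_le (h : ∀ s ∈ Set.Icc (0 : ℝ) 1, ‖evolve s H V‖ ≤ g)
    (h' : ∀ s ∈ Set.Icc (0 : ℝ) 1, ‖evolve s H' V'‖ ≤ g)
    (hd : ∀ s ∈ Set.Icc (0 : ℝ) 1, ‖evolve s H V - evolve s H' V'‖ ≤ δ) :
    ‖expansional 1 H V - expansional 1 H' V'‖ ≤ Real.exp (3 * g) * δ := by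
  have hfactor : expansional 1 H V - expansional 1 H' V' =
      expansional 1 H' V' * (expansionalInv 1 H' V' * expansional 1 H V - 1) := by
    rw [mul_sub, ← mul_assoc, expansional_mul_expansionalInv, one_mul, mul_one]
  calc ‖expansional 1 H V - expansional 1 H' V'‖ ≤ Real.exp g * (Real.exp (2 * g) * δ) := by
        rw [hfactor]
        exact norm_mul_le_of_le (norm_expansional_le h' (Set.right_mem_Icc.2 zero_le_one))
          (norm_expansionalInv_mul_expansional_sub_one_le h h' hd)
    _ = Real.exp (3 * g) * δ := by rw [show 3 * g = g + 2 * g by ring, Real.exp_add]; ring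

end Expansional

/-- A nonempty set of sites of diameter at most `R`: the support of an interaction term of range
`R`. -/
def IsShort (R : ℕ) (X : Finset ℤ) : Prop :=
  X.Nonempty ∧ ∀ x ∈ X, ∀ y ∈ X, |x - y| ≤ (R : ℤ)

instance (R : ℕ) : DecidablePred (IsShort R) := fun X =>
  inferInstanceAs (Decidable (X.Nonempty ∧ ∀ x ∈ X, ∀ y ∈ X, |x - y| ≤ (R : ℤ)))

/-- A family of supports of interaction terms of range `R`. -/
def IsShortFamily (R : ℕ) (𝒯 : Finset (Finset ℤ)) : Prop := ∀ X ∈ 𝒯, IsShort R X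

/-- The supports of the interaction terms of range `R` in `Λ`. -/
def shortSets (R : ℕ) (Λ : Finset ℤ) : Finset (Finset ℤ) := Λ.powerset.filter (IsShort R)

section Windows

variable {R : ℕ} {b c : ℤ} {k : ℕ} {X Λ Λ' S : Finset ℤ} {𝒯 𝒯' : Finset (Finset ℤ)}

theorem mem_shortSets : X ∈ shortSets R Λ ↔ X ⊆ Λ ∧ IsShort R X := by
  simp [shortSets]

theorem isShortFamily_shortSets (R : ℕ) (Λ : Finset ℤ) : IsShortFamily R (shortSets R Λ) :=
  fun _ hX => (mem_shortSets.1 hX).2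

theorem IsShortFamily.mono (h𝒯 : IsShortFamily R 𝒯) (h : 𝒯' ⊆ 𝒯) : IsShortFamily R 𝒯' :=
  fun X hX => h𝒯 X (h hX)

theorem disjoint_shortSets (h : Disjoint Λ Λ') : Disjoint (shortSets R Λ) (shortSets R Λ') :=
  Finset.disjoint_left.2 fun _ hX hX' =>
    have ⟨hXΛ, ⟨_, hx⟩, _⟩ := mem_shortSets.1 hX
    Finset.disjoint_left.1 h (hXΛ hx) ((mem_shortSets.1 hX').1 hx)

theorem IsShortFamily.card_le (h𝒯 : IsShortFamily R 𝒯) (hS : ∀ X ∈ 𝒯, ∃ x ∈ X, x ∈ S) :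
    𝒯.card ≤ S.card * 2 ^ (2 * R + 1) := by
  have hcover : 𝒯 ⊆ S.biUnion fun x => (Finset.Icc (x - R) (x + R)).powerset := fun X hX => by
    obtain ⟨x, hx, hxS⟩ := hS X hX
    refine Finset.mem_biUnion.2 ⟨x, hxS, Finset.mem_powerset.2 fun y hy => ?_⟩
    have hxy := abs_le.1 ((h𝒯 X hX).2 x hx y hy)
    rw [Finset.mem_Icc]
    constructor <;> linarith [hxy.1, hxy.2]
  refine (Finset.card_le_card hcover).trans (Finset.card_biUnion_le_card_mul _ _ _ fun x _ => ?_)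
  rw [Finset.card_powerset, Int.card_Icc,
    show x + (R : ℤ) + 1 - (x - R) = ((2 * R + 1 : ℕ) : ℤ) by push_cast; ring, Int.toNat_natCast]

/-- The sites at distance at most `(k + 1) * R` from `b` or `c`. -/
def window (R : ℕ) (b c : ℤ) (k : ℕ) : Finset ℤ :=
  Finset.Icc (b - (k + 1) * R) (b + (k + 1) * R) ∪ Finset.Icc (c - (k + 1) * R) (c + (k + 1) * R)

theorem mem_window {x : ℤ} :
    x ∈ window R b c k ↔ |x - b| ≤ (k + 1) * R ∨ |x - c| ≤ (k + 1) * R := by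
  simp only [window, Finset.mem_union, Finset.mem_Icc, abs_le]
  generalize ((k : ℤ) + 1) * R = p
  omega

theorem window_mono (R : ℕ) (b c : ℤ) : Monotone (window R b c) := fun k l hkl x hx => by
  rw [mem_window] at hx ⊢
  have hradius : ((k : ℤ) + 1) * R ≤ (l + 1) * R := by gcongr
  exact hx.imp hradius.trans' hradius.trans'

theorem card_window_le (R : ℕ) (b c : ℤ) (k : ℕ) :
    (window R b c k).card ≤ (4 * R + 2) * (k + 1) := by
  have hcard (x : ℤ) :
      (Finset.Icc (x - (k + 1) * R) (x + (k + 1) * R)).card = 2 * ((k + 1) * R) + 1 := by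
    rw [Int.card_Icc,
      show x + ((k : ℤ) + 1) * R + 1 - (x - (k + 1) * R) = ((2 * ((k + 1) * R) + 1 : ℕ) : ℤ) by
        push_cast; ring, Int.toNat_natCast]
  refine (Finset.card_union_le _ _).trans ?_
  rw [hcard, hcard]
  nlinarith

theorem card_window_succ_sdiff_le (R : ℕ) (b c : ℤ) (k : ℕ) :
    (window R b c (k + 1) \ window R b c k).card ≤ 4 * R + 2 := by
  let shell (x : ℤ) : Finset ℤ :=
    Finset.Ico (x - (k + 2) * R) (x - (k + 1) * R) ∪ Finset.Ioc (x + (k + 1) * R) (x + (k + 2) * R)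
  have hcard (x : ℤ) : (shell x).card ≤ 2 * R := by
    refine (Finset.card_union_le _ _).trans ?_
    rw [Int.card_Ico, Int.card_Ioc,
      show x - ((k : ℤ) + 1) * R - (x - (k + 2) * R) = R by ring,
      show x + ((k : ℤ) + 2) * R - (x + (k + 1) * R) = R by ring, Int.toNat_natCast, two_mul]
  have hcover : window R b c (k + 1) \ window R b c k ⊆ shell b ∪ shell c := by
    intro x
    simp only [shell, window, Finset.mem_sdiff, Finset.mem_union, Finset.mem_Icc, Finset.mem_Ico,
      Finset.mem_Ioc]
    push_cast
    rw [show (k : ℤ) + 1 + 1 = k + 2 by ring]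
    generalize ((k : ℤ) + 1) * R = p
    generalize ((k : ℤ) + 2) * R = q
    omega
  have hunion := (Finset.card_le_card hcover).trans (Finset.card_union_le _ _)
  linarith [hcard b, hcard c]

theorem disjoint_window (hX : IsShort R X) (h : ¬ X ⊆ window R b c (k + 1)) :
    Disjoint X (window R b c k) := by
  obtain ⟨x, hx, hxw⟩ := Finset.not_subset.1 h
  refine Finset.disjoint_left.2 fun y hy hyw => hxw ?_
  have hxy := hX.2 x hx y hy
  rw [mem_window] at hyw ⊢
  push_cast
  rw [add_one_mul ((k : ℤ) + 1)]
  exact hyw.imp (fun h => by linarith [abs_sub_le x y b]) fun h => by linarith [abs_sub_le x y c]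

theorem exists_subset_window (hR : 0 < R) (b c : ℤ) (S : Finset ℤ) (n : ℕ) :
    ∃ m, n ≤ m ∧ S ⊆ window R b c m := by
  let m := n + ∑ x ∈ S, (x - b).natAbs
  refine ⟨m, Nat.le_add_right _ _, fun x hx => mem_window.2 (Or.inl ?_)⟩
  have hsingle : (x - b).natAbs ≤ ∑ x ∈ S, (x - b).natAbs :=
    Finset.single_le_sum (f := fun x : ℤ => (x - b).natAbs) (fun _ _ => Nat.zero_le _) hx
  have hradius : (x - b).natAbs ≤ (m + 1) * R :=
    (by omega : (x - b).natAbs ≤ m + 1).trans (Nat.le_mul_of_pos_right _ hR)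
  rw [Int.abs_eq_natAbs]
  exact_mod_cast hradius

end Windows

section WindowSum

variable {E : Type*} [SeminormedAddCommGroup E] {φ : Finset ℤ → E} {J : ℝ} {R : ℕ} {b c : ℤ}
  {𝒯 𝒯' 𝒱 : Finset (Finset ℤ)}

theorem norm_sum_le_of_isShortFamily (hJ : ∀ X, ‖φ X‖ ≤ J) (h𝒯 : IsShortFamily R 𝒯) {S : Finset ℤ}
    (hS : ∀ X ∈ 𝒯, ∃ x ∈ X, x ∈ S) : ‖∑ X ∈ 𝒯, φ X‖ ≤ J * 2 ^ (2 * R + 1) * S.card := by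
  have hJ0 : 0 ≤ J := (norm_nonneg _).trans (hJ ∅)
  have hcard : (𝒯.card : ℝ) ≤ S.card * 2 ^ (2 * R + 1) := by exact_mod_cast h𝒯.card_le hS
  calc ‖∑ X ∈ 𝒯, φ X‖ ≤ ∑ _X ∈ 𝒯, J := norm_sum_le_of_le _ fun X _ => hJ X
    _ = 𝒯.card * J := by rw [Finset.sum_const, nsmul_eq_mul]
    _ ≤ S.card * 2 ^ (2 * R + 1) * J := by gcongr
    _ = J * 2 ^ (2 * R + 1) * S.card := by ring

/-- The Hamiltonian on `Λ` of the terms of `φ` of range `R`. -/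
def localSum (φ : Finset ℤ → E) (R : ℕ) (Λ : Finset ℤ) : E := ∑ X ∈ shortSets R Λ, φ X

theorem norm_localSum_le (hJ : ∀ X, ‖φ X‖ ≤ J) (Λ : Finset ℤ) :
    ‖localSum φ R Λ‖ ≤ J * 2 ^ (2 * R + 1) * Λ.card :=
  norm_sum_le_of_isShortFamily hJ (isShortFamily_shortSets R Λ) fun _ hX =>
    have ⟨hXΛ, ⟨x, hx⟩, _⟩ := mem_shortSets.1 hX
    ⟨x, hx, hXΛ hx⟩

/-- A bound for the terms of range `R` and strength `J` in a window, per unit of the radius. -/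
def energyRate (J : ℝ) (R : ℕ) : ℝ := J * 2 ^ (2 * R + 1) * (4 * R + 2)

theorem energyRate_nonneg (hJ : 0 ≤ J) (R : ℕ) : 0 ≤ energyRate J R := by
  unfold energyRate; positivity

/-- The Hamiltonian of the terms with supports in the family `𝒯` and in a window. -/
def windowSum (φ : Finset ℤ → E) (𝒯 : Finset (Finset ℤ)) (R : ℕ) (b c : ℤ) (k : ℕ) : E :=
  ∑ X ∈ 𝒯 with X ⊆ window R b c k, φ X

theorem windowSum_congr {n : ℕ} (h : ∀ X, X ⊆ window R b c n → (X ∈ 𝒯 ↔ X ∈ 𝒯')) :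
    windowSum φ 𝒯 R b c n = windowSum φ 𝒯' R b c n := by
  refine Finset.sum_congr (Finset.ext fun X => ?_) fun _ _ => rfl
  simp only [Finset.mem_filter]
  exact and_congr_left (h X)

theorem windowSum_eq_sum {k : ℕ} (h : ∀ X ∈ 𝒯, X ⊆ window R b c k) :
    windowSum φ 𝒯 R b c k = ∑ X ∈ 𝒯, φ X := by
  rw [windowSum, Finset.filter_true_of_mem h]

theorem exists_windowSum_eq (φ : Finset ℤ → E) (𝒯 : Finset (Finset ℤ)) (hR : 0 < R) (b c : ℤ)
    (n : ℕ) : ∃ m, n ≤ m ∧ windowSum φ 𝒯 R b c m = ∑ X ∈ 𝒯, φ X := by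
  obtain ⟨m, hnm, hm⟩ := exists_subset_window hR b c (𝒯.sup id) n
  exact ⟨m, hnm, windowSum_eq_sum fun X hX => (Finset.le_sup (f := id) hX).trans hm⟩

theorem windowSum_succ_sub (k : ℕ) :
    windowSum φ 𝒯 R b c (k + 1) - windowSum φ 𝒯 R b c k =
      ∑ X ∈ 𝒯 with X ⊆ window R b c (k + 1) ∧ ¬ X ⊆ window R b c k, φ X := by
  have hfilter : (𝒯.filter (· ⊆ window R b c (k + 1))).filter (· ⊆ window R b c k) =
      𝒯.filter (· ⊆ window R b c k) := by
    rw [Finset.filter_filter]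
    refine Finset.filter_congr fun X _ => and_iff_right_of_imp fun hX => ?_
    exact hX.trans (window_mono R b c k.le_succ)
  rw [windowSum, windowSum, ← Finset.sum_filter_add_sum_filter_not
    (𝒯.filter (· ⊆ window R b c (k + 1))) (· ⊆ window R b c k), hfilter, add_sub_cancel_left,
    Finset.filter_filter]

theorem norm_windowSum_le (hJ : ∀ X, ‖φ X‖ ≤ J) (h𝒯 : IsShortFamily R 𝒯) (k : ℕ) :
    ‖windowSum φ 𝒯 R b c k‖ ≤ energyRate J R * (k + 1) := by
  have hJ0 : 0 ≤ J := (norm_nonneg _).trans (hJ ∅)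
  refine (norm_sum_le_of_isShortFamily hJ (h𝒯.mono (Finset.filter_subset _ _))
    (S := window R b c k) fun X hX => ?_).trans ?_
  · obtain ⟨hX, hXw⟩ := Finset.mem_filter.1 hX
    obtain ⟨x, hx⟩ := (h𝒯 X hX).1
    exact ⟨x, hx, hXw hx⟩
  · rw [energyRate, mul_assoc _ (4 * (R : ℝ) + 2)]
    gcongr
    exact_mod_cast card_window_le R b c k

theorem norm_sum_le_energyRate (hJ : ∀ X, ‖φ X‖ ≤ J) (h𝒱 : IsShortFamily R 𝒱)
    (hw : ∀ X ∈ 𝒱, X ⊆ window R b c 0) : ‖∑ X ∈ 𝒱, φ X‖ ≤ energyRate J R := by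
  simpa [windowSum_eq_sum hw] using norm_windowSum_le (b := b) (c := c) hJ h𝒱 0

theorem norm_windowSum_succ_sub_le (hJ : ∀ X, ‖φ X‖ ≤ J) (h𝒯 : IsShortFamily R 𝒯) (k : ℕ) :
    ‖windowSum φ 𝒯 R b c (k + 1) - windowSum φ 𝒯 R b c k‖ ≤ energyRate J R := by
  have hJ0 : 0 ≤ J := (norm_nonneg _).trans (hJ ∅)
  rw [windowSum_succ_sub]
  refine (norm_sum_le_of_isShortFamily hJ (h𝒯.mono (Finset.filter_subset _ _))
    (S := window R b c (k + 1) \ window R b c k) fun X hX => ?_).trans ?_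
  · obtain ⟨-, hXsucc, hXw⟩ := Finset.mem_filter.1 hX
    obtain ⟨x, hx, hxw⟩ := Finset.not_subset.1 hXw
    exact ⟨x, hx, Finset.mem_sdiff.2 ⟨hXsucc hx, hxw⟩⟩
  · rw [energyRate]
    gcongr
    exact_mod_cast card_window_succ_sdiff_le R b c k

end WindowSum

/-- The terms of a family of operators, indexed by their supports, have norm at most `J`, and those
with disjoint supports commute. -/
structure IsLocalFamily {𝔐 : Type*} [NormedRing 𝔐] (φ : Finset ℤ → 𝔐) (J : ℝ) : Prop where
  norm_le : ∀ X, ‖φ X‖ ≤ J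
  commute : ∀ X Y, Disjoint X Y → Commute (φ X) (φ Y)

/-- A bound for the imaginary time evolution of the terms near two sites. -/
def evolveBound (J : ℝ) (R : ℕ) : ℝ :=
  energyRate J R * Real.exp (2 * energyRate J R) *
    (1 + Real.exp (2 * energyRate J R * Real.exp (2 * energyRate J R)))

/-- `evolveTail J R t / t ^ n` bounds the dependence of the imaginary time evolution of the terms
near two sites on the terms at distance at least `n * R` from them. -/
def evolveTail (J : ℝ) (R : ℕ) (t : ℝ) : ℝ :=
  2 * (energyRate J R * Real.exp (2 * energyRate J R) *
    Real.exp (2 * energyRate J R * Real.exp (2 * energyRate J R) * t))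

theorem evolveTail_nonneg {J : ℝ} (hJ : 0 ≤ J) (R : ℕ) (t : ℝ) : 0 ≤ evolveTail J R t := by
  have := energyRate_nonneg hJ R
  unfold evolveTail
  positivity

namespace IsLocalFamily

variable {𝔐 : Type*} [NormedRing 𝔐] {φ : Finset ℤ → 𝔐} {J : ℝ} {R : ℕ} {b c : ℤ}
  {𝒯 𝒯' 𝒱 : Finset (Finset ℤ)}

theorem commute_windowSum_sub_sum (hφ : IsLocalFamily φ J) (h𝒯 : IsShortFamily R 𝒯) {k : ℕ}
    (h𝒱 : ∀ X ∈ 𝒱, X ⊆ window R b c k) :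
    Commute (windowSum φ 𝒯 R b c (k + 2) - windowSum φ 𝒯 R b c (k + 1)) (∑ X ∈ 𝒱, φ X) := by
  rw [windowSum_succ_sub]
  refine Commute.sum_left _ _ _ fun X hX => Commute.sum_right _ _ _ fun Y hY => hφ.commute _ _ ?_
  obtain ⟨hX, _, hXw⟩ := Finset.mem_filter.1 hX
  exact (disjoint_window (h𝒯 X hX) hXw).mono_right (h𝒱 Y hY)

theorem isLocalExhaustion_windowSum (hφ : IsLocalFamily φ J) (h𝒯 : IsShortFamily R 𝒯)
    (hw : ∀ X ∈ 𝒱, X ⊆ window R b c 0) :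
    IsLocalExhaustion (windowSum φ 𝒯 R b c) (∑ X ∈ 𝒱, φ X) (energyRate J R) where
  norm_le := norm_windowSum_le hφ.norm_le h𝒯
  norm_succ_sub_le := norm_windowSum_succ_sub_le hφ.norm_le h𝒯
  commute_sub _ := hφ.commute_windowSum_sub_sum h𝒯 fun _ hX => (Finset.mem_filter.1 hX).2
  commute_sub_observable k := hφ.commute_windowSum_sub_sum h𝒯 fun X hX =>
    (hw X hX).trans (window_mono R b c k.zero_le)

variable [NormedAlgebra ℝ 𝔐] [CompleteSpace 𝔐] [NormOneClass 𝔐]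

theorem norm_evolve_le (hφ : IsLocalFamily φ J) (hR : 0 < R) (h𝒯 : IsShortFamily R 𝒯)
    (h𝒱 : IsShortFamily R 𝒱) (hw : ∀ X ∈ 𝒱, X ⊆ window R b c 0) {s : ℝ}
    (hs : s ∈ Set.Icc (0 : ℝ) 1) :
    ‖evolve s (∑ X ∈ 𝒯, φ X) (∑ X ∈ 𝒱, φ X)‖ ≤ evolveBound J R := by
  obtain ⟨m, -, hm⟩ := exists_windowSum_eq φ 𝒯 hR b c 0
  rw [← hm]
  refine ((hφ.isLocalExhaustion_windowSum h𝒯 hw).norm_evolve_le hs m).trans ?_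
  rw [evolveBound]
  gcongr
  exact norm_sum_le_energyRate hφ.norm_le h𝒱 hw

theorem norm_evolve_sub_evolve_windowSum_le (hφ : IsLocalFamily φ J) (hR : 0 < R)
    (h𝒯 : IsShortFamily R 𝒯) (h𝒱 : IsShortFamily R 𝒱) (hw : ∀ X ∈ 𝒱, X ⊆ window R b c 0) (n : ℕ)
    {t : ℝ} (ht : 1 ≤ t) {s : ℝ} (hs : s ∈ Set.Icc (0 : ℝ) 1) :
    ‖evolve s (∑ X ∈ 𝒯, φ X) (∑ X ∈ 𝒱, φ X) -
      evolve s (windowSum φ 𝒯 R b c n) (∑ X ∈ 𝒱, φ X)‖ ≤ evolveTail J R t / t ^ n / 2 := by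
  obtain ⟨m, hnm, hm⟩ := exists_windowSum_eq φ 𝒯 hR b c n
  rw [← hm]
  refine ((hφ.isLocalExhaustion_windowSum h𝒯 hw).norm_evolve_sub_evolve_le_div_pow ht hs
    hnm).trans ?_
  rw [evolveTail, div_right_comm, mul_div_cancel_left₀ _ two_ne_zero, mul_div_assoc]
  gcongr
  exact norm_sum_le_energyRate hφ.norm_le h𝒱 hw

theorem norm_evolve_sub_le (hφ : IsLocalFamily φ J) (hR : 0 < R) (h𝒯 : IsShortFamily R 𝒯)
    (h𝒯' : IsShortFamily R 𝒯') (h𝒱 : IsShortFamily R 𝒱) (hw : ∀ X ∈ 𝒱, X ⊆ window R b c 0) {n : ℕ}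
    (hn : ∀ X, X ⊆ window R b c n → (X ∈ 𝒯 ↔ X ∈ 𝒯')) {t : ℝ} (ht : 1 ≤ t) {s : ℝ}
    (hs : s ∈ Set.Icc (0 : ℝ) 1) :
    ‖evolve s (∑ X ∈ 𝒯, φ X) (∑ X ∈ 𝒱, φ X) - evolve s (∑ X ∈ 𝒯', φ X) (∑ X ∈ 𝒱, φ X)‖ ≤
      evolveTail J R t / t ^ n := by
  have htail := hφ.norm_evolve_sub_evolve_windowSum_le hR h𝒯 h𝒱 hw n ht hs
  have htail' := hφ.norm_evolve_sub_evolve_windowSum_le hR h𝒯' h𝒱 hw n ht hs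
  rw [← windowSum_congr hn, norm_sub_rev] at htail'
  linarith [norm_sub_le_norm_sub_add_norm_sub (evolve s (∑ X ∈ 𝒯, φ X) (∑ X ∈ 𝒱, φ X))
    (evolve s (windowSum φ 𝒯 R b c n) (∑ X ∈ 𝒱, φ X)) (evolve s (∑ X ∈ 𝒯', φ X) (∑ X ∈ 𝒱, φ X))]

end IsLocalFamily

section Cuts

variable {R n : ℕ} {a b c e a' e' : ℤ} {X : Finset ℤ}

/-- The supports of the terms inside one of the intervals `[a, b)`, `[b, c)`, `[c, e)`. -/
def splitSets (R : ℕ) (a b c e : ℤ) : Finset (Finset ℤ) :=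
  shortSets R (Finset.Ico a b) ∪ shortSets R (Finset.Ico b c) ∪ shortSets R (Finset.Ico c e)

theorem isShortFamily_splitSets (R : ℕ) (a b c e : ℤ) : IsShortFamily R (splitSets R a b c e) := by
  intro X hX
  simp only [splitSets, Finset.mem_union] at hX
  rcases hX with (hX | hX) | hX <;> exact (mem_shortSets.1 hX).2

/-- The supports of the terms in `[a, e)` that cross one of the cuts at `b` and `c`. -/
def crossingSets (R : ℕ) (a b c e : ℤ) : Finset (Finset ℤ) :=
  shortSets R (Finset.Ico a e) \ splitSets R a b c e

theorem isShortFamily_crossingSets (R : ℕ) (a b c e : ℤ) :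
    IsShortFamily R (crossingSets R a b c e) :=
  (isShortFamily_shortSets R _).mono Finset.sdiff_subset

theorem splitSets_subset (hab : a ≤ b) (hbc : b ≤ c) (hce : c ≤ e) :
    splitSets R a b c e ⊆ shortSets R (Finset.Ico a e) := by
  intro X hX
  refine mem_shortSets.2 ⟨?_, isShortFamily_splitSets R a b c e X hX⟩
  simp only [splitSets, Finset.mem_union, mem_shortSets] at hX
  rcases hX with (⟨hX, -⟩ | ⟨hX, -⟩) | ⟨hX, -⟩
  · exact hX.trans (Finset.Ico_subset_Ico_right (hbc.trans hce))
  · exact hX.trans (Finset.Ico_subset_Ico hab hce)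
  · exact hX.trans (Finset.Ico_subset_Ico_left (hab.trans hbc))

theorem subset_window_of_mem_crossingSets (hX : X ∈ crossingSets R a b c e) :
    X ⊆ window R b c 0 := by
  obtain ⟨hXI, hsplit⟩ := Finset.mem_sdiff.1 hX
  obtain ⟨hXI, hshort⟩ := mem_shortSets.1 hXI
  intro x hx
  by_contra hxw
  simp only [mem_window, Nat.cast_zero, zero_add, one_mul, abs_le] at hxw
  have hnear (y) (hy : y ∈ X) : y - x ≤ R ∧ x - y ≤ R ∧ a ≤ y ∧ y < e := by
    have hxy := abs_le.1 (hshort.2 x hx y hy)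
    have hyI := Finset.mem_Ico.1 (hXI hy)
    omega
  simp only [splitSets, Finset.mem_union, mem_shortSets, hshort, and_true] at hsplit
  refine hsplit ?_
  by_cases hxb : x < b
  · refine Or.inl (Or.inl fun y hy => Finset.mem_Ico.2 ?_)
    have := hnear y hy
    omega
  by_cases hxc : x < c
  · refine Or.inl (Or.inr fun y hy => Finset.mem_Ico.2 ?_)
    have := hnear y hy
    omega
  · refine Or.inr fun y hy => Finset.mem_Ico.2 ?_
    have := hnear y hy
    omega

/-- `[a', e')` contains all sites of `[a, e)` at distance at most `(n + 1) * R` from `b` or `c`. -/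
structure IsTruncation (R n : ℕ) (a b c e a' e' : ℤ) : Prop where
  le_left : a ≤ a'
  left_le : a' ≤ b
  le_right : c ≤ e'
  right_le : e' ≤ e
  left : a' = a ∨ a' ≤ b - (n + 1) * R
  right : e' = e ∨ c + (n + 1) * R < e'

namespace IsTruncation

theorem left_le_iff (h : IsTruncation R n a b c e a' e') (hbc : b ≤ c) {x : ℤ}
    (hx : x ∈ window R b c n) : a' ≤ x ↔ a ≤ x := by
  obtain ⟨hle_left, hleft_le, hle_right, hright_le, hleft, hright⟩ := h
  rw [mem_window, abs_le, abs_le] at hx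
  generalize ((n : ℤ) + 1) * R = p at *
  omega

theorem lt_right_iff (h : IsTruncation R n a b c e a' e') (hbc : b ≤ c) {x : ℤ}
    (hx : x ∈ window R b c n) : x < e' ↔ x < e := by
  obtain ⟨hle_left, hleft_le, hle_right, hright_le, hleft, hright⟩ := h
  rw [mem_window, abs_le, abs_le] at hx
  generalize ((n : ℤ) + 1) * R = p at *
  omega

theorem mem_splitSets_iff (h : IsTruncation R n a b c e a' e') (hbc : b ≤ c)
    (hX : X ⊆ window R b c n) : X ∈ splitSets R a b c e ↔ X ∈ splitSets R a' b c e' := by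
  have hleft : X ⊆ Finset.Ico a b ↔ X ⊆ Finset.Ico a' b := by
    simp only [Finset.subset_iff, Finset.mem_Ico]
    exact forall₂_congr fun x hx => by rw [h.left_le_iff hbc (hX hx)]
  have hright : X ⊆ Finset.Ico c e ↔ X ⊆ Finset.Ico c e' := by
    simp only [Finset.subset_iff, Finset.mem_Ico]
    exact forall₂_congr fun x hx => by rw [h.lt_right_iff hbc (hX hx)]
  simp only [splitSets, Finset.mem_union, mem_shortSets, hleft, hright]

theorem crossingSets_eq (h : IsTruncation R n a b c e a' e') (hbc : b ≤ c) :
    crossingSets R a' b c e' = crossingSets R a b c e := by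
  ext X
  by_cases hX : X ⊆ window R b c n
  · have hinterval : X ⊆ Finset.Ico a e ↔ X ⊆ Finset.Ico a' e' := by
      simp only [Finset.subset_iff, Finset.mem_Ico]
      exact forall₂_congr fun x hx => by
        rw [h.left_le_iff hbc (hX hx), h.lt_right_iff hbc (hX hx)]
    simp only [crossingSets, Finset.mem_sdiff, h.mem_splitSets_iff hbc hX, mem_shortSets,
      hinterval]
  · have hwindow := window_mono R b c n.zero_le
    exact iff_of_false (fun h => hX ((subset_window_of_mem_crossingSets h).trans hwindow))
      fun h => hX ((subset_window_of_mem_crossingSets h).trans hwindow)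

end IsTruncation

variable {E : Type*} [SeminormedAddCommGroup E] {φ : Finset ℤ → E}

/-- The Hamiltonian of `[a, b)`, `[b, c)` and `[c, e)` without interaction between them. -/
def splitSum (φ : Finset ℤ → E) (R : ℕ) (a b c e : ℤ) : E := ∑ X ∈ splitSets R a b c e, φ X

/-- The interaction between `[a, b)`, `[b, c)` and `[c, e)`. -/
def crossingSum (φ : Finset ℤ → E) (R : ℕ) (a b c e : ℤ) : E := ∑ X ∈ crossingSets R a b c e, φ X

theorem splitSum_eq (φ : Finset ℤ → E) (R : ℕ) (hbc : b ≤ c) (a e : ℤ) :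
    splitSum φ R a b c e = localSum φ R (Finset.Ico a b) + localSum φ R (Finset.Ico b c) +
      localSum φ R (Finset.Ico c e) := by
  have hac : Disjoint (Finset.Ico a b) (Finset.Ico c e) :=
    Finset.disjoint_left.2 fun x => by simp only [Finset.mem_Ico]; omega
  rw [splitSum, splitSets, Finset.sum_union, Finset.sum_union]
  · rfl
  · exact disjoint_shortSets (Finset.Ico_disjoint_Ico_consecutive a b c)
  · exact Finset.disjoint_union_left.2 ⟨disjoint_shortSets hac,
      disjoint_shortSets (Finset.Ico_disjoint_Ico_consecutive b c e)⟩

theorem crossingSum_eq (φ : Finset ℤ → E) (R : ℕ) (hab : a ≤ b) (hbc : b ≤ c) (hce : c ≤ e) :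
    crossingSum φ R a b c e = localSum φ R (Finset.Ico a e) - splitSum φ R a b c e := by
  rw [localSum, ← Finset.sum_sdiff (splitSets_subset hab hbc hce), splitSum, add_sub_cancel_right]
  rfl

end Cuts

namespace IsLocalFamily

variable {𝔐 : Type*} [NormedRing 𝔐] [NormedAlgebra ℝ 𝔐] [CompleteSpace 𝔐] [NormOneClass 𝔐]
  {φ : Finset ℤ → 𝔐} {J : ℝ} {R : ℕ}

theorem norm_evolve_crossingSum_le (hφ : IsLocalFamily φ J) (hR : 0 < R) (a b c e : ℤ) {s : ℝ}
    (hs : s ∈ Set.Icc (0 : ℝ) 1) :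
    ‖evolve s (splitSum φ R a b c e) (crossingSum φ R a b c e)‖ ≤ evolveBound J R :=
  hφ.norm_evolve_le hR (isShortFamily_splitSets R a b c e) (isShortFamily_crossingSets R a b c e)
    (fun _ => subset_window_of_mem_crossingSets) hs

theorem norm_expansional_le (hφ : IsLocalFamily φ J) (hR : 0 < R) (a b c e : ℤ) :
    ‖expansional 1 (splitSum φ R a b c e) (crossingSum φ R a b c e)‖ ≤
      Real.exp (evolveBound J R) :=
  SpinChain.norm_expansional_le (fun _ => hφ.norm_evolve_crossingSum_le hR a b c e) (by simp)

theorem norm_expansionalInv_le (hφ : IsLocalFamily φ J) (hR : 0 < R) (a b c e : ℤ) {s : ℝ}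
    (hs : s ∈ Set.Icc (0 : ℝ) 1) :
    ‖expansionalInv s (splitSum φ R a b c e) (crossingSum φ R a b c e)‖ ≤
      Real.exp (evolveBound J R) :=
  SpinChain.norm_expansionalInv_le (fun _ => hφ.norm_evolve_crossingSum_le hR a b c e) hs

theorem norm_expansional_sub_truncation_le (hφ : IsLocalFamily φ J) (hR : 0 < R)
    {a b c e a' e' : ℤ} (hbc : b ≤ c) {n : ℕ} (h : IsTruncation R n a b c e a' e') {t : ℝ}
    (ht : 1 ≤ t) :
    ‖expansional 1 (splitSum φ R a b c e) (crossingSum φ R a b c e) -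
      expansional 1 (splitSum φ R a' b c e') (crossingSum φ R a' b c e')‖ ≤
      Real.exp (3 * evolveBound J R) * (evolveTail J R t / t ^ n) := by
  refine norm_expansional_sub_le (fun _ => hφ.norm_evolve_crossingSum_le hR a b c e)
    (fun _ => hφ.norm_evolve_crossingSum_le hR a' b c e') fun s hs => ?_
  rw [crossingSum, crossingSum, h.crossingSets_eq hbc]
  exact hφ.norm_evolve_sub_le hR (isShortFamily_splitSets R a b c e)
    (isShortFamily_splitSets R a' b c e') (isShortFamily_crossingSets R a b c e)
    (fun _ => subset_window_of_mem_crossingSets) (fun _ => h.mem_splitSets_iff hbc) ht hs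

end IsLocalFamily

section Matrix

open scoped Kronecker

variable {m n κ : Type*} [Fintype m] [Fintype n] [Fintype κ]

theorem trace_mul_submatrix {R : Type*} [NonUnitalNonAssocSemiring R] (e : n ≃ κ)
    (Q : Matrix n n R) (P : Matrix κ κ R) :
    (Q * P.submatrix e e).trace = (Q.submatrix e.symm e.symm * P).trace := by
  simp only [Matrix.trace, Matrix.diag, Matrix.mul_apply, Matrix.submatrix_apply]
  rw [← e.symm.sum_comp]
  refine Finset.sum_congr rfl fun p _ => ?_
  rw [← e.symm.sum_comp]
  simp

variable [DecidableEq n]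

/-- The homomorphism `Q ↦ Q ⊗ 𝟙` of star algebras. -/
def kroneckerOneHom (n κ : Type*) [Fintype n] [DecidableEq n] [Fintype κ] [DecidableEq κ] :
    Matrix n n ℂ →⋆ₐ[ℂ] Matrix (n × κ) (n × κ) ℂ where
  toFun Q := Q ⊗ₖ (1 : Matrix κ κ ℂ)
  map_one' := Matrix.one_kronecker_one
  map_mul' P Q := by rw [← Matrix.mul_kronecker_mul, one_mul]
  map_zero' := Matrix.zero_kronecker _
  map_add' P Q := Matrix.add_kronecker _ _ _
  commutes' c := by
    rw [Algebra.algebraMap_eq_smul_one, Algebra.algebraMap_eq_smul_one, Matrix.smul_kronecker,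
      Matrix.one_kronecker_one]
  map_star' Q := by
    rw [Matrix.star_eq_conjTranspose, Matrix.star_eq_conjTranspose, Matrix.conjTranspose_kronecker,
      Matrix.conjTranspose_one]

variable [DecidableEq κ] in
theorem norm_kronecker_one_le (Q : Matrix n n ℂ) : ‖Q ⊗ₖ (1 : Matrix κ κ ℂ)‖ ≤ ‖Q‖ :=
  NonUnitalStarAlgHom.norm_apply_le (kroneckerOneHom n κ) Q

theorem isUnit_conjTranspose_mul_self {N : Matrix m n ℂ} {L : Matrix n m ℂ} (h : L * N = 1) :
    IsUnit (N.conjTranspose * N) := by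
  open scoped ComplexOrder in
  refine (Matrix.PosDef.conjTranspose_mul_self N fun u v huv => ?_).isUnit
  simpa [Matrix.mulVec_mulVec, h] using congrArg L.mulVec huv

variable [DecidableEq m] in
theorem norm_inv_conjTranspose_mul_self_le {N : Matrix m n ℂ} {L : Matrix n m ℂ} (h : L * N = 1) :
    ‖(N.conjTranspose * N)⁻¹‖ ≤ ‖L‖ ^ 2 := by
  set Q := N.conjTranspose * N with hQ
  have hdet : IsUnit Q.det :=
    (Matrix.isUnit_iff_isUnit_det _).1 (isUnit_conjTranspose_mul_self h)
  -- the orthogonal projection onto the range of `N`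
  set p := N * Q⁻¹ * N.conjTranspose with hp
  have hproj : IsStarProjection p := by
    refine ⟨?_, ?_⟩
    · calc p * p = N * Q⁻¹ * Q * Q⁻¹ * N.conjTranspose := by simp only [hp, hQ, Matrix.mul_assoc]
        _ = p := by rw [Matrix.mul_assoc N, Matrix.nonsing_inv_mul _ hdet, Matrix.mul_one]
    · rw [IsSelfAdjoint, Matrix.star_eq_conjTranspose, hp, Matrix.conjTranspose_mul,
        Matrix.conjTranspose_mul, Matrix.conjTranspose_conjTranspose,
        Matrix.conjTranspose_nonsing_inv, (Matrix.isHermitian_conjTranspose_mul_self N).eq,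
        Matrix.mul_assoc]
  have hadj : N.conjTranspose * L.conjTranspose = 1 := by
    rw [← Matrix.conjTranspose_mul, h, Matrix.conjTranspose_one]
  have hinv : Q⁻¹ = L * p * L.conjTranspose :=
    calc Q⁻¹ = (L * N) * Q⁻¹ * (N.conjTranspose * L.conjTranspose) := by
          rw [h, hadj, Matrix.one_mul, Matrix.mul_one]
      _ = L * p * L.conjTranspose := by simp only [hp, Matrix.mul_assoc]
  calc ‖Q⁻¹‖ ≤ ‖L‖ * ‖p‖ * ‖L.conjTranspose‖ := by
        rw [hinv]
        exact (Matrix.l2_opNorm_mul _ _).trans (by gcongr; exact Matrix.l2_opNorm_mul _ _)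
    _ ≤ ‖L‖ * 1 * ‖L‖ := by
        rw [Matrix.l2_opNorm_conjTranspose]
        gcongr
        exact hproj.norm_le
    _ = ‖L‖ ^ 2 := by ring

end Matrix

section Tensor

open scoped Kronecker

variable {d : ℕ} {X Y Λ I : Finset ℤ}

/-- Configurations on `Λ` are pairs of configurations on `X` and on `Λ \ X`. -/
def splitEquiv (h : X ⊆ Λ) : (Λ → Fin d) ≃ (X → Fin d) × ((Λ \ X : Finset ℤ) → Fin d) where
  toFun σ := (Finset.restrict₂ (π := fun _ => Fin d) h σ,
    Finset.restrict₂ (π := fun _ => Fin d) Finset.sdiff_subset σ)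
  invFun p := glue p.1 p.2
  left_inv σ := by
    funext x
    simp only [glue, Finset.restrict₂]
    split_ifs <;> rfl
  right_inv p := by
    ext x
    · simp [glue, Finset.restrict₂]
    · simp [glue, Finset.restrict₂, (Finset.mem_sdiff.1 x.2).2]

theorem forall_notMem_iff (σ τ : Λ → Fin d) :
    (∀ x : Λ, x.1 ∉ X → σ x = τ x) ↔
      Finset.restrict₂ (π := fun _ => Fin d) Finset.sdiff_subset σ =
        Finset.restrict₂ (π := fun _ => Fin d) (Finset.sdiff_subset : Λ \ X ⊆ Λ) τ := by
  constructor
  · exact fun h => funext fun x => h ⟨x.1, _⟩ (Finset.mem_sdiff.1 x.2).2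
  · exact fun h x hx => congrFun h ⟨x.1, Finset.mem_sdiff.2 ⟨x.2, hx⟩⟩

theorem embed_eq_submatrix (h : X ⊆ Λ) (Q : Observable d X) :
    embed h Q = (Q ⊗ₖ (1 : Matrix _ _ ℂ)).submatrix (splitEquiv h) (splitEquiv h) := by
  ext σ τ
  simp only [embed, Matrix.of_apply, Matrix.submatrix_apply, Matrix.kroneckerMap_apply, splitEquiv,
    Equiv.coe_fn_mk, Matrix.one_apply, mul_ite, mul_one, mul_zero]
  exact if_congr (forall_notMem_iff σ τ) rfl rfl

theorem embed_sdiff_eq_submatrix (h : X ⊆ Λ) (Q : Observable d (Λ \ X)) :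
    embed Finset.sdiff_subset Q =
      ((1 : Matrix _ _ ℂ) ⊗ₖ Q).submatrix (splitEquiv h) (splitEquiv h) := by
  ext σ τ
  simp only [embed, Matrix.of_apply, Matrix.submatrix_apply, Matrix.kroneckerMap_apply, splitEquiv,
    Equiv.coe_fn_mk, Matrix.one_apply, ite_mul, one_mul, zero_mul]
  refine if_congr ⟨fun hστ => funext fun x => ?_, fun hστ x hx => ?_⟩ rfl rfl
  · exact hστ ⟨x.1, h x.2⟩ fun hx => (Finset.mem_sdiff.1 hx).2 x.2
  · exact congrFun hστ ⟨x.1, by_contra fun hxX => hx (Finset.mem_sdiff.2 ⟨x.2, hxX⟩)⟩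

/-- The canonical embedding `𝔄_X → 𝔄_Λ` as a homomorphism of star algebras. -/
def embedHom (d : ℕ) (h : X ⊆ Λ) : Observable d X →⋆ₐ[ℂ] Observable d Λ where
  toFun := embed h
  map_one' := by rw [embed_eq_submatrix, Matrix.one_kronecker_one, Matrix.submatrix_one_equiv]
  map_mul' P Q := by
    rw [embed_eq_submatrix, embed_eq_submatrix, embed_eq_submatrix, Matrix.submatrix_mul_equiv,
      ← Matrix.mul_kronecker_mul, one_mul]
  map_zero' := (embedLin h).map_zero
  map_add' := (embedLin h).map_add
  commutes' c := by
    rw [Algebra.algebraMap_eq_smul_one, Algebra.algebraMap_eq_smul_one, embed_eq_submatrix,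
      Matrix.smul_kronecker, Matrix.one_kronecker_one, ← Matrix.submatrix_one_equiv (splitEquiv h)]
    rfl
  map_star' Q := by
    rw [Matrix.star_eq_conjTranspose, Matrix.star_eq_conjTranspose, embed_eq_submatrix,
      embed_eq_submatrix, Matrix.conjTranspose_submatrix, Matrix.conjTranspose_kronecker,
      Matrix.conjTranspose_one]

theorem embedHom_apply (h : X ⊆ Λ) (Q : Observable d X) : embedHom d h Q = embed h Q := rfl

theorem embed_one (h : X ⊆ Λ) : embed h (1 : Observable d X) = 1 := map_one (embedHom d h)

theorem embed_mul (h : X ⊆ Λ) (P Q : Observable d X) : embed h (P * Q) = embed h P * embed h Q :=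
  map_mul (embedHom d h) P Q

theorem embed_neg (h : X ⊆ Λ) (Q : Observable d X) : embed h (-Q) = -embed h Q :=
  (embedLin h).map_neg Q

theorem embed_smul (h : X ⊆ Λ) (c : ℂ) (Q : Observable d X) : embed h (c • Q) = c • embed h Q :=
  map_smul (embedHom d h) c Q

theorem norm_embed_le (h : X ⊆ Λ) (Q : Observable d X) : ‖embed h Q‖ ≤ ‖Q‖ :=
  NonUnitalStarAlgHom.norm_apply_le (embedHom d h) Q

theorem embed_exp (h : X ⊆ Λ) (Q : Observable d X) : embed h (exp Q) = exp (embed h Q) := by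
  let := NormedAlgebra.restrictScalars ℚ ℂ (Observable d X)
  exact map_exp (embedHom d h) (LinearMap.continuous_of_finiteDimensional (embedLin h)) Q

theorem embed_embed (h : X ⊆ Y) (h' : Y ⊆ Λ) (Q : Observable d X) :
    embed h' (embed h Q) = embed (h.trans h') Q := by
  ext σ τ
  simp only [embed, Matrix.of_apply]
  rw [← ite_and]
  refine if_congr ⟨fun hστ x hx => ?_, fun hστ =>
    ⟨fun x hx => hστ x fun hxX => hx (h hxX), fun x hx => hστ ⟨x.1, h' x.2⟩ hx⟩⟩ rfl rfl
  by_cases hxY : x.1 ∈ Y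
  · exact hστ.2 ⟨x.1, hxY⟩ hx
  · exact hστ.1 x hxY

theorem commute_embed (hX : X ⊆ Λ) (hY : Y ⊆ Λ) (hXY : Disjoint X Y) (P : Observable d X)
    (Q : Observable d Y) : Commute (embed hX P) (embed hY Q) := by
  have hY' : Y ⊆ Λ \ X := Finset.subset_sdiff.2 ⟨hY, hXY.symm⟩
  rw [← embed_embed hY' Finset.sdiff_subset, embed_sdiff_eq_submatrix hX, embed_eq_submatrix hX,
    Commute, SemiconjBy, Matrix.submatrix_mul_equiv, Matrix.submatrix_mul_equiv,
    ← Matrix.mul_kronecker_mul, ← Matrix.mul_kronecker_mul, one_mul, mul_one, one_mul, mul_one]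

theorem embed_eq_trace_smul_one (h : X ⊆ Λ) (hX : X = ∅) (Q : Observable d X) :
    embed h Q = Q.trace • 1 := by
  subst hX
  have hQ : Q = Q.trace • 1 := by
    ext σ τ
    rw [Subsingleton.elim σ default, Subsingleton.elim τ default]
    simp [Matrix.trace]
  conv_lhs => rw [hQ]
  rw [embed_smul, embed_one]

theorem trace_reduce_mul (h : X ⊆ Λ) (Q : Observable d Λ) (P : Observable d X) :
    (reduce X Q * P).trace = (Q * embed h P).trace := by
  rw [embed_eq_submatrix, trace_mul_submatrix]
  simp only [Matrix.trace, Matrix.diag, Matrix.mul_apply, Fintype.sum_prod_type, reduce,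
    Matrix.of_apply, Matrix.submatrix_apply, Matrix.kroneckerMap_apply, Matrix.one_apply, mul_ite,
    mul_one, mul_zero, Finset.sum_mul]
  refine Finset.sum_congr rfl fun σ _ => ?_
  rw [Finset.sum_comm]
  refine Finset.sum_congr rfl fun η _ => Finset.sum_congr rfl fun τ _ => ?_
  simp [splitEquiv]

theorem reduce_add (P Q : Observable d Λ) : reduce X (P + Q) = reduce X P + reduce X Q := by
  ext σ τ
  simp [reduce, Finset.sum_add_distrib]

theorem reduce_smul (c : ℂ) (Q : Observable d Λ) : reduce X (c • Q) = c • reduce X Q := by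
  ext σ τ
  simp [reduce, Finset.mul_sum]

theorem reduce_embed_mul (h : X ⊆ Λ) (P : Observable d X) (Q : Observable d Λ) :
    reduce X (embed h P * Q) = P * reduce X Q :=
  Matrix.ext_iff_trace_mul_right.2 fun R => by
    rw [trace_reduce_mul h, mul_assoc, Matrix.trace_mul_comm, mul_assoc, ← embed_mul,
      ← trace_reduce_mul h, mul_assoc P, Matrix.trace_mul_comm P, mul_assoc]

theorem reduce_embed_mul_comm (hX : X ⊆ Λ) (hY : Y ⊆ Λ) (hXY : Disjoint X Y) (P : Observable d Y)
    (Q : Observable d Λ) : reduce X (embed hY P * Q) = reduce X (Q * embed hY P) :=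
  Matrix.ext_iff_trace_mul_right.2 fun R => by
    rw [trace_reduce_mul hX, trace_reduce_mul hX, mul_assoc, Matrix.trace_mul_comm, mul_assoc,
      mul_assoc, (commute_embed hX hY hXY R P).eq]

theorem trace_reduce (h : X ⊆ Λ) (Q : Observable d Λ) : (reduce X Q).trace = Q.trace := by
  simpa [embed_one] using trace_reduce_mul h Q 1

theorem reduce_reduce (h : X ⊆ Y) (h' : Y ⊆ Λ) (Q : Observable d Λ) :
    reduce X (reduce Y Q) = reduce X Q :=
  Matrix.ext_iff_trace_mul_right.2 fun R => by
    rw [trace_reduce_mul h, trace_reduce_mul h', embed_embed, ← trace_reduce_mul]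

theorem forall_notMem_glue_eq_iff (hX : X ⊆ I) (hI : I ⊆ X ∪ Λ) (σ τ : X → Fin d)
    (η : (I \ X : Finset ℤ) → Fin d) :
    (∀ x : I, x.1 ∉ Λ → (glue σ η : I → Fin d) x = glue τ η x) ↔
      ∀ x : X, x.1 ∉ X ∩ Λ → σ x = τ x := by
  refine ⟨fun h x hx => ?_, fun h x hx => ?_⟩
  · simpa [glue] using h ⟨x.1, hX x.2⟩ fun hxΛ => hx (Finset.mem_inter.2 ⟨x.2, hxΛ⟩)
  · have hxX : x.1 ∈ X := (Finset.mem_union.1 (hI x.2)).resolve_right hx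
    simpa [glue, hxX] using h ⟨x.1, hxX⟩ fun hx' => hx (Finset.mem_inter.1 hx').2

theorem sdiff_eq_sdiff_inter (hΛ : Λ ⊆ I) (hI : I ⊆ X ∪ Λ) : I \ X = Λ \ (X ∩ Λ) := by
  ext x
  have hx := @hI x
  have hx' := @hΛ x
  simp only [Finset.mem_sdiff, Finset.mem_inter, Finset.mem_union] at hx ⊢
  tauto

theorem reduce_embed (hX : X ⊆ I) (hΛ : Λ ⊆ I) (hI : I ⊆ X ∪ Λ) (Q : Observable d Λ) :
    reduce X (embed hΛ Q) = embed Finset.inter_subset_left (reduce (X ∩ Λ) Q) := by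
  let E : ((I \ X : Finset ℤ) → Fin d) ≃ ((Λ \ (X ∩ Λ) : Finset ℤ) → Fin d) :=
    (Equiv.subtypeEquivRight fun x => by rw [sdiff_eq_sdiff_inter hΛ hI]).arrowCongr (Equiv.refl _)
  have hglue (σ : X → Fin d) (η : (I \ X : Finset ℤ) → Fin d) :
      Finset.restrict₂ (π := fun _ => Fin d) hΛ (glue σ η) =
        glue (Finset.restrict₂ (π := fun _ => Fin d) (Finset.inter_subset_left : X ∩ Λ ⊆ X) σ)
          (E η) := by
    funext x
    by_cases hx : x.1 ∈ X
    · simp [glue, Finset.restrict₂, hx]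
    · simp [glue, Finset.restrict₂, hx, E, Equiv.arrowCongr, Equiv.subtypeEquivRight]
      rfl
  ext σ τ
  simp only [reduce, embed, Matrix.of_apply, forall_notMem_glue_eq_iff hX hI, hglue]
  split_ifs
  · rw [← E.sum_comp]
  · exact Finset.sum_const_zero

theorem reduce_embed_of_disjoint (hX : X ⊆ I) (hΛ : Λ ⊆ I) (hI : I ⊆ X ∪ Λ) (hd : Disjoint X Λ)
    (Q : Observable d Λ) : reduce X (embed hΛ Q) = Q.trace • 1 := by
  rw [reduce_embed hX hΛ hI, embed_eq_trace_smul_one _ (Finset.disjoint_iff_inter_eq_empty.1 hd),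
    trace_reduce Finset.inter_subset_right]

theorem reduced_congr {X' : Finset ℤ} (hXX' : X = X') (h : X ⊆ Λ) (h' : X' ⊆ Λ)
    (Q : Observable d Λ) : reduced h Q = reduced h' Q := by
  subst hXX'
  rfl

theorem reduced_reduced (hX : X ⊆ I) (hΛ : Λ ⊆ I) (hI : I ⊆ X ∪ Λ) (Q : Observable d I) :
    reduced hX (reduced hΛ Q) = reduced (Finset.inter_subset_left.trans hX : X ∩ Λ ⊆ I) Q := by
  rw [reduced, reduced, reduce_embed hX hΛ hI, embed_embed,
    reduce_reduce Finset.inter_subset_right hΛ]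
  rfl

theorem reduced_smul (hX : X ⊆ I) (c : ℂ) (Q : Observable d I) :
    reduced hX (c • Q) = c • reduced hX Q := by
  rw [reduced, reduce_smul, embed_smul, reduced]

theorem reduced_add (hX : X ⊆ I) (P Q : Observable d I) :
    reduced hX (P + Q) = reduced hX P + reduced hX Q := by
  rw [reduced, reduce_add]
  exact map_add (embedHom d hX) _ _

theorem trace_embed_mul_embed (hX : X ⊆ I) (hY : Y ⊆ I) (hI : I ⊆ X ∪ Y) (hd : Disjoint X Y)
    (P : Observable d X) (Q : Observable d Y) :
    (embed hX P * embed hY Q).trace = P.trace * Q.trace := by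
  rw [← trace_reduce_mul, reduce_embed_of_disjoint hY hX (by rwa [Finset.union_comm]) hd.symm,
    Matrix.smul_mul, Matrix.one_mul, Matrix.trace_smul, smul_eq_mul]

/-- The matrix `T` with `T† T = tr_{Λ \ X}(S† S)`: the columns of `S` that differ only in their
configuration on `Λ \ X` are stacked above each other. -/
def restack (X : Finset ℤ) (S : Observable d Λ) :
    Matrix ((Λ → Fin d) × ((Λ \ X : Finset ℤ) → Fin d)) (X → Fin d) ℂ :=
  Matrix.of fun p σ => S p.1 (glue σ p.2)

theorem restack_mul (X : Finset ℤ) (W S : Observable d Λ) :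
    restack X (W * S) = (W ⊗ₖ (1 : Observable d (Λ \ X))) * restack X S := by
  ext ⟨x, η⟩ σ
  simp only [restack, Matrix.of_apply, Matrix.mul_apply, Fintype.sum_prod_type,
    Matrix.kroneckerMap_apply, Matrix.one_apply, mul_ite, mul_one, mul_zero, ite_mul, zero_mul]
  simp

theorem reduce_conjTranspose_mul (S T : Observable d Λ) :
    reduce X (S.conjTranspose * T) = (restack X S).conjTranspose * restack X T := by
  ext σ τ
  simp only [reduce, restack, Matrix.of_apply, Matrix.mul_apply, Matrix.conjTranspose_apply,
    Fintype.sum_prod_type]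
  rw [Finset.sum_comm]

theorem norm_reduce_conj_le (S Q : Observable d Λ) :
    ‖reduce X (S.conjTranspose * Q * S)‖ ≤ ‖reduce X (S.conjTranspose * S)‖ * ‖Q‖ := by
  rw [mul_assoc, reduce_conjTranspose_mul, reduce_conjTranspose_mul,
    Matrix.l2_opNorm_conjTranspose_mul_self, restack_mul]
  calc _ ≤ ‖(restack X S).conjTranspose‖ * (‖Q ⊗ₖ (1 : Observable d (Λ \ X))‖ * ‖restack X S‖) :=
        (Matrix.l2_opNorm_mul _ _).trans (by gcongr; exact Matrix.l2_opNorm_mul _ _)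
    _ ≤ ‖restack X S‖ * (‖Q‖ * ‖restack X S‖) := by
        rw [Matrix.l2_opNorm_conjTranspose]
        gcongr
        exact norm_kronecker_one_le Q
    _ = ‖restack X S‖ * ‖restack X S‖ * ‖Q‖ := by ring

theorem isUnit_reduce_and_norm_inv_le [NeZero d] {S W V : Observable d Λ} (hVW : V * W = 1) {z : ℂ}
    (hz : z ≠ 0) (hS : reduce X (S.conjTranspose * S) = z • 1) :
    IsUnit (reduce X ((W * S).conjTranspose * (W * S))) ∧
      ‖(reduce X ((W * S).conjTranspose * (W * S)))⁻¹‖ ≤ ‖V‖ ^ 2 / ‖z‖ := by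
  set T := restack X S
  have hT : T.conjTranspose * T = z • 1 := by rw [← hS, reduce_conjTranspose_mul]
  have hT_norm : ‖T‖ * ‖T‖ = ‖z‖ := by
    rw [← Matrix.l2_opNorm_conjTranspose_mul_self, hT, norm_smul, norm_one, mul_one]
  set L := z⁻¹ • (T.conjTranspose * (V ⊗ₖ (1 : Observable d (Λ \ X)))) with hL
  have hLN : L * restack X (W * S) = 1 := by
    rw [restack_mul, hL, Matrix.smul_mul, Matrix.mul_assoc, ← Matrix.mul_assoc (V ⊗ₖ _),
      ← Matrix.mul_kronecker_mul, hVW, Matrix.one_mul, Matrix.one_kronecker_one, Matrix.one_mul, hT,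
      smul_smul, inv_mul_cancel₀ hz, one_smul]
  have hL_norm : ‖L‖ ≤ ‖z‖⁻¹ * (‖T‖ * ‖V‖) := by
    rw [hL, norm_smul, norm_inv]
    gcongr
    refine (Matrix.l2_opNorm_mul _ _).trans ?_
    rw [Matrix.l2_opNorm_conjTranspose]
    gcongr
    exact norm_kronecker_one_le V
  rw [reduce_conjTranspose_mul]
  refine ⟨isUnit_conjTranspose_mul_self hLN, (norm_inv_conjTranspose_mul_self_le hLN).trans ?_⟩
  calc ‖L‖ ^ 2 ≤ (‖z‖⁻¹ * (‖T‖ * ‖V‖)) ^ 2 := by gcongr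
    _ = ‖z‖⁻¹ ^ 2 * (‖T‖ * ‖T‖) * ‖V‖ ^ 2 := by ring
    _ = ‖V‖ ^ 2 / ‖z‖ := by
        have := norm_ne_zero_iff.2 hz
        rw [hT_norm]
        field_simp

end Tensor

section Thermal

variable {d : ℕ} {X Y Λ I A B C : Finset ℤ}

theorem exp_half_smul_mul_self (K : Observable d Y) :
    exp ((1 / 2 : ℝ) • K) * exp ((1 / 2 : ℝ) • K) = exp K := by
  let := NormedAlgebra.restrictScalars ℚ ℂ (Observable d Y)
  rw [← exp_add_of_commute (Commute.refl _), ← add_smul]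
  norm_num

theorem exp_mul_exp_neg (K : Observable d Y) : exp K * exp (-K) = 1 := by
  simpa using exp_smul_mul_exp_neg_smul 1 K

theorem exp_neg_mul_exp (K : Observable d Y) : exp (-K) * exp K = 1 := by
  simpa using exp_mul_exp_neg (-K)

theorem isHermitian_exp_smul {K : Observable d Y} (hK : K.IsHermitian) (s : ℝ) :
    (exp (s • K)).IsHermitian :=
  Matrix.IsHermitian.exp <| by
    rw [Matrix.IsHermitian, Matrix.conjTranspose_smul, hK.eq, star_trivial]

theorem isHermitian_embed (hX : X ⊆ I) {P : Observable d X} (hP : P.IsHermitian) :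
    (embed hX P).IsHermitian :=
  (map_star (embedHom d hX) P).symm.trans (congrArg (embedHom d hX) hP)

theorem trace_exp_ne_zero [NeZero d] {K : Observable d Y} (hK : K.IsHermitian) :
    (exp K).trace ≠ 0 := by
  intro htrace
  rw [← exp_half_smul_mul_self K] at htrace
  nth_rw 1 [← (isHermitian_exp_smul hK (1 / 2)).eq] at htrace
  open scoped ComplexOrder in
  rw [Matrix.trace_conjTranspose_mul_self_eq_zero_iff] at htrace
  have hinv := exp_smul_mul_exp_neg_smul (1 / 2) K
  rw [htrace, zero_mul] at hinv
  exact zero_ne_one hinv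

/-- The expectation `Tr(e^K P) / Tr(e^K)` of `P ∈ 𝔄_Y` in the thermal state of `K ∈ 𝔄_Y`. -/
def thermalMean (K P : Observable d Y) : ℂ :=
  (exp K).trace⁻¹ * (exp K * P).trace

/-- The conditional expectation `Q ↦ tr_Y(e^K Q) / Tr(e^K)` in the thermal state of `K ∈ 𝔄_Y`. -/
def thermal (h : Y ⊆ I) (K : Observable d Y) (Q : Observable d I) : Observable d I :=
  (exp K).trace⁻¹ • reduced (Finset.sdiff_subset : I \ Y ⊆ I) (embed h (exp K) * Q)

theorem thermal_smul (h : Y ⊆ I) (K : Observable d Y) (c : ℂ) (Q : Observable d I) :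
    thermal h K (c • Q) = c • thermal h K Q := by
  rw [thermal, Matrix.mul_smul, reduced_smul, smul_comm, thermal]

theorem thermal_sub (h : Y ⊆ I) (K : Observable d Y) (P Q : Observable d I) :
    thermal h K (P - Q) = thermal h K P - thermal h K Q := by
  have hadd (P Q : Observable d I) : thermal h K (P + Q) = thermal h K P + thermal h K Q := by
    simp only [thermal, mul_add, reduced_add, smul_add]
  rw [sub_eq_add_neg, ← neg_one_smul ℂ Q, hadd, thermal_smul, neg_one_smul, ← sub_eq_add_neg]

theorem thermal_embed_mul (hX : X ⊆ I) (hY : Y ⊆ I) (hd : Disjoint X Y) (K : Observable d Y)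
    (P : Observable d X) (Q : Observable d I) :
    thermal hY K (embed hX P * Q) = embed hX P * thermal hY K Q := by
  have hXY : X ⊆ I \ Y := Finset.subset_sdiff.2 ⟨hX, hd⟩
  rw [thermal, ← mul_assoc, ← (commute_embed hX hY hd P _).eq, mul_assoc,
    ← embed_embed hXY Finset.sdiff_subset, reduced, reduce_embed_mul, embed_mul, thermal, reduced,
    Matrix.mul_smul]

theorem thermal_embed (hY : Y ⊆ I) (K P : Observable d Y) :
    thermal hY K (embed hY P) = thermalMean K P • 1 := by
  rw [thermal, thermalMean, ← embed_mul, reduced,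
    reduce_embed_of_disjoint Finset.sdiff_subset hY (by rw [Finset.sdiff_union_of_subset hY])
      Finset.sdiff_disjoint, embed_smul, embed_one, smul_smul]

theorem thermal_embed_of_subset (hY : Y ⊆ Λ) (hΛ : Λ ⊆ I) (K : Observable d Y)
    (Q : Observable d Λ) : thermal (hY.trans hΛ) K (embed hΛ Q) = embed hΛ (thermal hY K Q) := by
  have hreduce (X : Finset ℤ) (hX : X ⊆ Λ) (hXY : X = Λ \ Y) (P : Observable d Λ) :
      embed (hX.trans hΛ) (reduce X P) =
        embed hΛ (embed Finset.sdiff_subset (reduce (Λ \ Y) P)) := by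
    subst hXY
    rw [embed_embed]
  have hinter : I \ Y ∩ Λ = Λ \ Y := by
    rw [Finset.inter_comm, ← Finset.inter_sdiff_assoc, Finset.inter_eq_left.2 hΛ]
  have hunion : I ⊆ I \ Y ∪ Λ := by
    rw [Finset.union_comm]
    exact sdiff_le_iff.1 (Finset.sdiff_subset_sdiff Finset.Subset.rfl hY)
  rw [thermal, ← embed_embed hY hΛ, ← embed_mul, reduced,
    reduce_embed Finset.sdiff_subset hΛ hunion, embed_embed, thermal, embed_smul, reduced,
    hreduce _ Finset.inter_subset_right hinter]

section NeZero

variable [NeZero d]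

theorem reduced_exp_mul (h : Y ⊆ I) {K : Observable d Y} (hK : K.IsHermitian)
    (Q : Observable d I) :
    reduced (Finset.sdiff_subset : I \ Y ⊆ I) (embed h (exp K) * Q) =
      (exp K).trace • thermal h K Q := by
  rw [thermal, smul_smul, mul_inv_cancel₀ (trace_exp_ne_zero hK), one_smul]

theorem norm_thermal_le (h : Y ⊆ I) {K : Observable d Y} (hK : K.IsHermitian)
    (Q : Observable d I) : ‖thermal h K Q‖ ≤ ‖Q‖ := by
  set S := embed h (exp ((1 / 2 : ℝ) • K)) with hS
  have hS_herm : S.conjTranspose = S := isHermitian_embed h (isHermitian_exp_smul hK _)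
  have hSS : S * S = embed h (exp K) := by rw [hS, ← embed_mul, exp_half_smul_mul_self]
  have hconj : reduce (I \ Y) (embed h (exp K) * Q) =
      reduce (I \ Y) (S.conjTranspose * Q * S) := by
    rw [← hSS, mul_assoc, hS, reduce_embed_mul_comm Finset.sdiff_subset h Finset.sdiff_disjoint,
      ← hS, hS_herm]
  have htrace : reduce (I \ Y) (S.conjTranspose * S) = (exp K).trace • 1 := by
    rw [hS_herm, hSS, reduce_embed_of_disjoint Finset.sdiff_subset h
      (by rw [Finset.sdiff_union_of_subset h]) Finset.sdiff_disjoint]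
  have hle := norm_reduce_conj_le (X := I \ Y) S Q
  rw [htrace, norm_smul, norm_one, mul_one] at hle
  rw [thermal, norm_smul, norm_inv, reduced, hconj,
    inv_mul_le_iff₀ (norm_pos_iff.2 (trace_exp_ne_zero hK))]
  exact (norm_embed_le _ _).trans hle

theorem norm_thermalMean_le (h : Y ⊆ I) {K : Observable d Y} (hK : K.IsHermitian)
    (P : Observable d Y) : ‖thermalMean K P‖ ≤ ‖embed h P‖ := by
  have hle := norm_thermal_le h hK (embed h P)
  rwa [thermal_embed, norm_smul, norm_one, mul_one] at hle

theorem norm_trace_exp_mul_le {K : Observable d I} (hK : K.IsHermitian) (Q : Observable d I) :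
    ‖(exp K * Q).trace‖ ≤ ‖(exp K).trace‖ * ‖Q‖ := by
  have hle := (norm_thermalMean_le Finset.Subset.rfl hK Q).trans (norm_embed_le _ Q)
  rwa [thermalMean, norm_mul, norm_inv,
    inv_mul_le_iff₀ (norm_pos_iff.2 (trace_exp_ne_zero hK))] at hle

theorem isUnit_reduce_exp_and_norm_inv_le {K L : Observable d I} (hK : K.IsHermitian)
    (hL : L.IsHermitian) {z : ℂ} (hz : z ≠ 0) (hLz : reduce X (exp L) = z • 1) :
    IsUnit (reduce X (exp K)) ∧ ‖(reduce X (exp K))⁻¹‖ ≤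
      ‖exp ((1 / 2 : ℝ) • L) * exp ((-(1 / 2) : ℝ) • K)‖ ^ 2 / ‖z‖ := by
  set S := exp ((1 / 2 : ℝ) • L) with hS
  set W := exp ((1 / 2 : ℝ) • K) * exp ((-(1 / 2) : ℝ) • L) with hW
  set V := S * exp ((-(1 / 2) : ℝ) • K) with hV
  have hVW : V * W = 1 := by
    rw [hV, hW, mul_assoc, ← mul_assoc (exp ((-(1 / 2) : ℝ) • K)),
      exp_neg_smul_mul_exp_smul, one_mul, hS, exp_smul_mul_exp_neg_smul]
  have hWS : (W * S).conjTranspose * (W * S) = exp K := by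
    rw [hW, hS, mul_assoc, exp_neg_smul_mul_exp_smul, mul_one, (isHermitian_exp_smul hK _).eq,
      exp_half_smul_mul_self]
  have hSS : reduce X (S.conjTranspose * S) = z • 1 := by
    rw [hS, (isHermitian_exp_smul hL _).eq, exp_half_smul_mul_self, hLz]
  rw [← hWS]
  exact isUnit_reduce_and_norm_inv_le hVW hz hSS

end NeZero

end Thermal

section Tripartite

variable {d : ℕ} {I A B C : Finset ℤ}

/-- `I` is the disjoint union of the left part `A`, the middle part `B` and the right part `C`. -/
structure IsPartition (A B C I : Finset ℤ) : Prop where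
  left : A ⊆ I
  mid : B ⊆ I
  right : C ⊆ I
  subset : I ⊆ A ∪ B ∪ C
  left_mid : Disjoint A B
  left_right : Disjoint A C
  mid_right : Disjoint B C

namespace IsPartition

theorem symm (h : IsPartition A B C I) : IsPartition C B A I where
  left := h.right
  mid := h.mid
  right := h.left
  subset := by
    rw [Finset.union_comm, ← Finset.union_assoc, Finset.union_right_comm]
    exact h.subset
  left_mid := h.mid_right.symm
  left_right := h.left_right.symm
  mid_right := h.left_mid.symm

theorem sdiff_mid (h : IsPartition A B C I) : I \ B = A ∪ C := by
  ext x
  have hx := @h.subset x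
  have hA := @h.left x
  have hC := @h.right x
  have hAB : x ∈ A → x ∉ B := fun hxA => Finset.disjoint_left.1 h.left_mid hxA
  have hBC : x ∈ B → x ∉ C := fun hxB => Finset.disjoint_left.1 h.mid_right hxB
  simp only [Finset.mem_union, Finset.mem_sdiff] at *
  tauto

theorem sdiff_right_inter (h : IsPartition A B C I) : I \ C ∩ (I \ B) = A := by
  rw [h.sdiff_mid, Finset.inter_union_distrib_left, Finset.sdiff_inter_self, Finset.union_empty,
    Finset.inter_eq_right]
  exact Finset.subset_sdiff.2 ⟨h.left, h.left_right⟩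

theorem trace_embed_mul (h : IsPartition A B C I) (P : Observable d A) (Q : Observable d B)
    (R : Observable d C) :
    (embed h.left P * embed h.mid Q * embed h.right R).trace = P.trace * Q.trace * R.trace := by
  have hAB : A ∪ B ⊆ I := Finset.union_subset h.left h.mid
  rw [← embed_embed (Finset.subset_union_left : A ⊆ A ∪ B) hAB,
    ← embed_embed (Finset.subset_union_right : B ⊆ A ∪ B) hAB, ← embed_mul,
    trace_embed_mul_embed _ _ h.subset (Finset.disjoint_union_left.2 ⟨h.left_right, h.mid_right⟩),
    trace_embed_mul_embed _ _ Finset.Subset.rfl h.left_mid]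

section Weights

variable {KA : Observable d A} {KB : Observable d B} {KC : Observable d C}

/-- The unnormalized product state `e^{K_A} e^{K_C} e^{K_B}` of three mutually commuting weights. -/
def prod (h : IsPartition A B C I) (KA : Observable d A) (KB : Observable d B)
    (KC : Observable d C) : Observable d I :=
  embed h.left (exp KA) * embed h.right (exp KC) * embed h.mid (exp KB)

theorem prod_eq_exp (h : IsPartition A B C I) :
    h.prod KA KB KC = exp (embed h.left KA + embed h.mid KB + embed h.right KC) := by
  let := NormedAlgebra.restrictScalars ℚ ℂ (Observable d I)
  have hAC := commute_embed h.left h.right h.left_right KA KC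
  have hAB := commute_embed h.left h.mid h.left_mid KA KB
  have hCB := commute_embed h.right h.mid h.mid_right.symm KC KB
  rw [prod, embed_exp, embed_exp, embed_exp, ← exp_add_of_commute hAC,
    ← exp_add_of_commute (hAB.add_left hCB), add_right_comm]

theorem trace_prod (h : IsPartition A B C I) :
    (h.prod KA KB KC).trace = (exp KA).trace * (exp KB).trace * (exp KC).trace := by
  rw [prod, mul_assoc, (commute_embed h.right h.mid h.mid_right.symm _ _).eq, ← mul_assoc,
    h.trace_embed_mul]

theorem reduce_left_exp_add (h : IsPartition A B C I) :
    reduce A (exp (embed h.mid KB + embed h.right KC)) =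
      ((exp KB).trace * (exp KC).trace) • 1 := by
  let := NormedAlgebra.restrictScalars ℚ ℂ (Observable d I)
  rw [exp_add_of_commute (commute_embed h.mid h.right h.mid_right KB KC), ← embed_exp, ← embed_exp]
  refine Matrix.ext_iff_trace_mul_right.2 fun R => ?_
  rw [trace_reduce_mul h.left, Matrix.trace_mul_comm, ← mul_assoc, h.trace_embed_mul,
    Matrix.smul_mul, Matrix.one_mul, Matrix.trace_smul, smul_eq_mul]
  ring

variable [NeZero d]

theorem reduced_left_right (h : IsPartition A B C I) (hB : KB.IsHermitian) (hAC : A ∪ C ⊆ I)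
    (Q : Observable d I) :
    reduced hAC (h.prod KA KB KC * Q) = (exp KB).trace •
      (embed h.left (exp KA) * embed h.right (exp KC) * thermal h.mid KB Q) := by
  have hcomm : Commute (embed h.left (exp KA) * embed h.right (exp KC)) (embed h.mid (exp KB)) :=
    (commute_embed h.left h.mid h.left_mid _ _).mul_left
      (commute_embed h.right h.mid h.mid_right.symm _ _)
  rw [reduced_congr h.sdiff_mid.symm hAC Finset.sdiff_subset, prod, hcomm.eq, mul_assoc,
    reduced_exp_mul h.mid hB, mul_assoc, thermal_embed_mul h.left h.mid h.left_mid,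
    thermal_embed_mul h.right h.mid h.mid_right.symm, mul_assoc]

theorem reduced_left (h : IsPartition A B C I) (hB : KB.IsHermitian) (hC : KC.IsHermitian)
    (Q : Observable d I) :
    reduced h.left (h.prod KA KB KC * Q) = ((exp KB).trace * (exp KC).trace) •
      (embed h.left (exp KA) * thermal h.right KC (thermal h.mid KB Q)) := by
  have hI : I ⊆ I \ C ∪ I \ B := by
    rw [← Finset.sdiff_inter_distrib_right, Finset.disjoint_iff_inter_eq_empty.1 h.mid_right.symm,
      Finset.sdiff_empty]
  rw [reduced_congr h.sdiff_right_inter.symm h.left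
      (Finset.inter_subset_left.trans Finset.sdiff_subset),
    ← reduced_reduced Finset.sdiff_subset Finset.sdiff_subset hI,
    reduced_congr h.sdiff_mid Finset.sdiff_subset (Finset.union_subset h.left h.right),
    h.reduced_left_right hB, (commute_embed h.left h.right h.left_right _ _).eq, mul_assoc,
    reduced_smul, reduced_exp_mul _ hC, thermal_embed_mul h.left h.right h.left_right, mul_smul]

theorem trace_prod_mul (h : IsPartition A B C I) (hA : KA.IsHermitian) (hB : KB.IsHermitian)
    (hC : KC.IsHermitian) (Q : Observable d I) :
    (h.prod KA KB KC * Q).trace • (1 : Observable d I) =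
      ((exp KA).trace * (exp KB).trace * (exp KC).trace) •
        thermal h.left KA (thermal h.right KC (thermal h.mid KB Q)) := by
  have htrace : reduced (Finset.sdiff_subset : I \ A ⊆ I) (reduced h.left (h.prod KA KB KC * Q)) =
      (h.prod KA KB KC * Q).trace • 1 := by
    rw [reduced, reduced, reduce_embed_of_disjoint Finset.sdiff_subset h.left
      (by rw [Finset.sdiff_union_of_subset h.left]) Finset.sdiff_disjoint, trace_reduce h.left,
      embed_smul, embed_one]
  rw [← htrace, h.reduced_left hB hC, reduced_smul, reduced_exp_mul _ hA, smul_smul]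
  congr 1
  ring

theorem norm_trace_prod_le (h : IsPartition A B C I) {K : Observable d I} (hK : K.IsHermitian)
    {V : Observable d I} (hV : exp K * V = h.prod KA KB KC) :
    ‖(exp KA).trace * (exp KB).trace * (exp KC).trace‖ ≤ ‖(exp K).trace‖ * ‖V‖ := by
  rw [← h.trace_prod, ← hV]
  exact norm_trace_exp_mul_le hK V

theorem norm_trace_prod_mul_le (h : IsPartition A B C I) (hA : KA.IsHermitian)
    (hB : KB.IsHermitian) (hC : KC.IsHermitian) (Q : Observable d I) :
    ‖(h.prod KA KB KC * Q).trace‖ ≤ ‖(exp KA).trace * (exp KB).trace * (exp KC).trace‖ * ‖Q‖ := by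
  have hnorm := congrArg norm (h.trace_prod_mul hA hB hC Q)
  rw [norm_smul, norm_one, mul_one, norm_smul] at hnorm
  rw [hnorm]
  gcongr
  exact (norm_thermal_le _ hA _).trans ((norm_thermal_le _ hC _).trans (norm_thermal_le _ hB _))

theorem exists_inv_thermal (h : IsPartition A B C I) {K Q : Observable d I} (hK : K.IsHermitian)
    (hB : KB.IsHermitian) (hC : KC.IsHermitian) (hQ : h.prod KA KB KC * Q = exp K) :
    ∃ N : Observable d I, N * thermal h.right KC (thermal h.mid KB Q) = 1 ∧
      ‖N‖ ≤ ‖exp ((1 / 2 : ℝ) • (embed h.mid KB + embed h.right KC)) *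
        exp ((-(1 / 2) : ℝ) • K)‖ ^ 2 * ‖exp KA‖ := by
  set z := (exp KB).trace * (exp KC).trace with hz_def
  have hz : z ≠ 0 := mul_ne_zero (trace_exp_ne_zero hB) (trace_exp_ne_zero hC)
  obtain ⟨hunit, hinv⟩ := isUnit_reduce_exp_and_norm_inv_le hK
    ((isHermitian_embed h.mid hB).add (isHermitian_embed h.right hC)) hz h.reduce_left_exp_add
  set M := reduce A (exp K)
  set g := ‖exp ((1 / 2 : ℝ) • (embed h.mid KB + embed h.right KC)) * exp ((-(1 / 2) : ℝ) • K)‖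
  have hM : M⁻¹ * M = 1 := Matrix.nonsing_inv_mul _ ((Matrix.isUnit_iff_isUnit_det _).1 hunit)
  have hMp : embed h.left M =
      z • (embed h.left (exp KA) * thermal h.right KC (thermal h.mid KB Q)) := by
    rw [hz_def, ← h.reduced_left hB hC, hQ, reduced]
  refine ⟨z • (embed h.left (M⁻¹ * exp KA)), ?_, ?_⟩
  · rw [Matrix.smul_mul, embed_mul, mul_assoc, ← Matrix.mul_smul, ← hMp, ← embed_mul, hM, embed_one]
  · calc ‖z • embed h.left (M⁻¹ * exp KA)‖ ≤ ‖z‖ * (g ^ 2 / ‖z‖ * ‖exp KA‖) := by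
          rw [norm_smul]
          gcongr
          exact (norm_embed_le _ _).trans ((norm_mul_le _ _).trans (by gcongr))
      _ = g ^ 2 * ‖exp KA‖ := by
          rw [← mul_assoc, mul_div_cancel₀ _ (norm_ne_zero_iff.2 hz)]

end Weights

end IsPartition

end Tripartite

section Correlations

variable {d : ℕ} {X Λ A C : Finset ℤ}

theorem norm_single_one {n : Type*} [Fintype n] [DecidableEq n] (i j : n) :
    ‖(Matrix.single i j 1 : Matrix n n ℂ)‖ = 1 := by
  have hsq := Matrix.l2_opNorm_conjTranspose_mul_self (Matrix.single i j 1 : Matrix n n ℂ)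
  rw [Matrix.conjTranspose_single, Matrix.single_mul_single_same, star_one, one_mul,
    ← Matrix.diagonal_single, Matrix.l2_opNorm_diagonal, Pi.norm_single, norm_one] at hsq
  exact (mul_self_eq_one_iff.1 hsq.symm).resolve_right
    fun h => by linarith [norm_nonneg (Matrix.single i j 1 : Matrix n n ℂ)]

theorem norm_le_of_forall_entry {n : Type*} [Fintype n] [DecidableEq n] (D : Matrix n n ℂ) {c : ℝ}
    (h : ∀ i j, ‖D i j‖ ≤ c) : ‖D‖ ≤ (Fintype.card n : ℝ) ^ 2 * c := by
  have hsingle (i j : n) : ‖Matrix.single i j (D i j)‖ ≤ c := by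
    rw [← mul_one (D i j), ← smul_eq_mul, ← Matrix.smul_single, norm_smul, norm_single_one, mul_one]
    exact h i j
  calc ‖D‖ = ‖∑ i, ∑ j, Matrix.single i j (D i j)‖ := by rw [← Matrix.matrix_eq_sum_single]
    _ ≤ ∑ _i : n, ∑ _j : n, c :=
        norm_sum_le_of_le _ fun i _ => norm_sum_le_of_le _ fun j _ => hsingle i j
    _ = (Fintype.card n : ℝ) ^ 2 * c := by
        simp only [Finset.sum_const, Finset.card_univ, nsmul_eq_mul]
        ring

theorem restrict₂_union_inj {σ τ : (A ∪ C : Finset ℤ) → Fin d} :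
    (Finset.restrict₂ (π := fun _ => Fin d) (Finset.subset_union_left : A ⊆ A ∪ C) σ =
        Finset.restrict₂ (π := fun _ => Fin d) Finset.subset_union_left τ ∧
      Finset.restrict₂ (π := fun _ => Fin d) (Finset.subset_union_right : C ⊆ A ∪ C) σ =
        Finset.restrict₂ (π := fun _ => Fin d) Finset.subset_union_right τ) ↔ σ = τ := by
  refine ⟨fun ⟨hA, hC⟩ => funext fun x => ?_, by rintro rfl; exact ⟨rfl, rfl⟩⟩
  exact (Finset.mem_union.1 x.2).elim (fun hx => congrFun hA ⟨x, hx⟩) fun hx => congrFun hC ⟨x, hx⟩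

theorem embed_mul_embed_apply (hAC : Disjoint A C) (P : Observable d A) (Q : Observable d C)
    (σ τ : (A ∪ C : Finset ℤ) → Fin d) :
    (embed (Finset.subset_union_left (s₂ := C)) P *
        embed (Finset.subset_union_right (s₁ := A)) Q) σ τ =
      P (Finset.restrict₂ (π := fun _ => Fin d) Finset.subset_union_left σ)
          (Finset.restrict₂ (π := fun _ => Fin d) Finset.subset_union_left τ) *
        Q (Finset.restrict₂ (π := fun _ => Fin d) Finset.subset_union_right σ)
          (Finset.restrict₂ (π := fun _ => Fin d) Finset.subset_union_right τ) := by
  have hC_notMem (x : (A ∪ C : Finset ℤ)) (hx : x.1 ∈ C) : x.1 ∉ A :=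
    Finset.disjoint_right.1 hAC hx
  set γ : (A ∪ C : Finset ℤ) → Fin d := fun x => if x.1 ∈ A then τ x else σ x
  have hσγ (x : (A ∪ C : Finset ℤ)) (hx : x.1 ∉ A) : σ x = γ x := (if_neg hx).symm
  have hγτ (x : (A ∪ C : Finset ℤ)) (hx : x.1 ∉ C) : γ x = τ x :=
    if_pos ((Finset.mem_union.1 x.2).resolve_right hx)
  have hγA : Finset.restrict₂ (π := fun _ => Fin d) (Finset.subset_union_left : A ⊆ A ∪ C) γ =
      Finset.restrict₂ (π := fun _ => Fin d) Finset.subset_union_left τ :=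
    funext fun x => if_pos x.2
  have hγC : Finset.restrict₂ (π := fun _ => Fin d) (Finset.subset_union_right : C ⊆ A ∪ C) γ =
      Finset.restrict₂ (π := fun _ => Fin d) Finset.subset_union_right σ :=
    funext fun x => if_neg (hC_notMem ⟨x, _⟩ x.2)
  rw [Matrix.mul_apply, Finset.sum_eq_single γ]
  · simp only [embed, Matrix.of_apply]
    rw [if_pos hσγ, if_pos hγτ, hγA, hγC]
  · intro γ' _ hne
    simp only [embed, Matrix.of_apply]
    by_contra hzero
    rw [mul_eq_zero, not_or, ite_eq_right_iff, ite_eq_right_iff] at hzero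
    push Not at hzero
    obtain ⟨⟨hσγ', -⟩, hγ'τ, -⟩ := hzero
    refine hne (funext fun x => ?_)
    by_cases hx : x.1 ∈ A
    · rw [hγ'τ x (Finset.disjoint_left.1 hAC hx), hγτ x (Finset.disjoint_left.1 hAC hx)]
    · rw [← hσγ' x hx, hσγ x hx]
  · exact fun h => absurd (Finset.mem_univ γ) h

theorem single_eq_embed_mul_embed (hAC : Disjoint A C) (σ τ : (A ∪ C : Finset ℤ) → Fin d) :
    (Matrix.single σ τ 1 : Observable d (A ∪ C)) =
      embed Finset.subset_union_left (Matrix.single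
        (Finset.restrict₂ (π := fun _ => Fin d) Finset.subset_union_left σ)
        (Finset.restrict₂ (π := fun _ => Fin d) Finset.subset_union_left τ) 1 : Observable d A) *
      embed Finset.subset_union_right (Matrix.single
        (Finset.restrict₂ (π := fun _ => Fin d) Finset.subset_union_right σ)
        (Finset.restrict₂ (π := fun _ => Fin d) Finset.subset_union_right τ) 1 :
          Observable d C) := by
  ext α β
  rw [embed_mul_embed_apply hAC]
  have hiff := (restrict₂_union_inj (σ := σ) (τ := α)).and (restrict₂_union_inj (σ := τ) (τ := β))
  rw [and_and_and_comm] at hiff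
  simp only [Matrix.single_apply, ← hiff, ite_and, mul_ite, mul_one, mul_zero]
  split_ifs <;> rfl

theorem norm_reduced_sub_le (hA : A ⊆ Λ) (hC : C ⊆ Λ) (hAC : Disjoint A C) (ρ : Observable d Λ) :
    ‖reduced (Finset.union_subset hA hC) ρ - reduced hA ρ * reduced hC ρ‖ ≤
      ((d : ℝ) ^ (A ∪ C).card) ^ 2 * corr ρ A C := by
  set D := reduce (A ∪ C) ρ - embed (Finset.subset_union_left (s₁ := A) (s₂ := C)) (reduce A ρ) *
    embed (Finset.subset_union_right (s₁ := A) (s₂ := C)) (reduce C ρ) with hD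
  have hembed : reduced (Finset.union_subset hA hC) ρ - reduced hA ρ * reduced hC ρ =
      embed (Finset.union_subset hA hC) D := by
    rw [← embedHom_apply, hD, map_sub, map_mul]
    simp only [embedHom_apply, embed_embed]
    rfl
  have hentry (σ τ : (A ∪ C : Finset ℤ) → Fin d) : ‖D σ τ‖ ≤ corr ρ A C := by
    have hle := le_corr ρ A C _ _ (norm_single_one
      (Finset.restrict₂ (π := fun _ => Fin d) Finset.subset_union_left τ)
      (Finset.restrict₂ (π := fun _ => Fin d) Finset.subset_union_left σ)) (norm_single_one
      (Finset.restrict₂ (π := fun _ => Fin d) Finset.subset_union_right τ)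
      (Finset.restrict₂ (π := fun _ => Fin d) Finset.subset_union_right σ))
    rwa [← single_eq_embed_mul_embed hAC, ← hD, Matrix.trace_single_mul, one_smul] at hle
  rw [hembed]
  refine (norm_embed_le _ _).trans ((norm_le_of_forall_entry D hentry).trans_eq ?_)
  simp only [Fintype.card_fun, Fintype.card_fin, Fintype.card_coe, Nat.cast_pow]

theorem norm_trace_le [NeZero d] (Q : Observable d X) : ‖Q.trace‖ ≤ (d : ℝ) ^ X.card * ‖Q‖ := by
  have hle := norm_trace_exp_mul_le (K := (0 : Observable d X)) Matrix.isHermitian_zero Q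
  rw [exp_zero, one_mul, Matrix.trace_one] at hle
  simpa only [Fintype.card_fun, Fintype.card_fin, Fintype.card_coe, Nat.cast_pow, norm_pow,
    Complex.norm_natCast] using hle

end Correlations

section Hamiltonian

variable {d : ℕ} {X Λ I : Finset ℤ} {Φ : LocalInteraction d} {J : ℝ} {R : ℕ}

theorem isHermitian_hamiltonian (Φ : LocalInteraction d) (Λ : Finset ℤ) :
    (Φ.hamiltonian Λ).IsHermitian := by
  rw [LocalInteraction.hamiltonian, Matrix.IsHermitian, Matrix.conjTranspose_sum]
  exact Finset.sum_congr rfl fun X _ => isHermitian_embed _ (Φ.isHermitian X.1)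

theorem embed_rfl (Q : Observable d X) : embed Finset.Subset.rfl Q = Q := by
  ext σ τ
  simp only [embed, Matrix.of_apply]
  rw [if_pos fun x hx => absurd x.2 hx]
  rfl

/-- The interaction terms supported in `I`, as elements of `𝔄_I`; the other terms are set to `0`, so
that the terms form a family indexed by all finite sets of sites. -/
def LocalInteraction.termIn (Φ : LocalInteraction d) (I X : Finset ℤ) : Observable d I :=
  if h : X ⊆ I then embed h (Φ.term X) else 0

theorem isLocalFamily_termIn (hJ : Φ.HasStrength J) (I : Finset ℤ) :
    IsLocalFamily (Φ.termIn I) J where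
  norm_le X := by
    rw [LocalInteraction.termIn]
    split_ifs with hX
    · exact (norm_embed_le _ _).trans (hJ X)
    · rw [norm_zero]
      exact (norm_nonneg _).trans (hJ ∅)
  commute X Y hXY := by
    rw [LocalInteraction.termIn, LocalInteraction.termIn]
    split_ifs with hX hY
    · exact commute_embed hX hY hXY _ _
    · exact Commute.zero_right _
    · exact Commute.zero_left _
    · exact Commute.zero_left _

theorem embed_hamiltonian_eq_sum (h : Λ ⊆ I) :
    embed h (Φ.hamiltonian Λ) = ∑ X ∈ Λ.powerset, Φ.termIn I X := by
  rw [← embedHom_apply, LocalInteraction.hamiltonian, map_sum,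
    ← Finset.sum_attach Λ.powerset (Φ.termIn I)]
  refine Finset.sum_congr rfl fun X _ => ?_
  rw [embedHom_apply, embed_embed, LocalInteraction.termIn,
    dif_pos ((Finset.mem_powerset.1 X.2).trans h)]

/-- An interaction of range at most `R ≥ 1` and strength at most `J` without constant term. -/
structure IsLocal (Φ : LocalInteraction d) (J : ℝ) (R : ℕ) : Prop where
  range : Φ.HasRange R
  strength : Φ.HasStrength J
  term_empty : Φ.term ∅ = 0
  pos : 0 < R

namespace IsLocal

theorem strength_nonneg (hΦ : IsLocal Φ J R) : 0 ≤ J :=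
  (norm_nonneg _).trans (hΦ.strength ∅)

theorem term_eq_zero (hΦ : IsLocal Φ J R) (hX : ¬IsShort R X) : Φ.term X = 0 := by
  obtain rfl | hne := X.eq_empty_or_nonempty
  · exact hΦ.term_empty
  obtain ⟨x, hx, y, hy, hxy⟩ : ∃ x ∈ X, ∃ y ∈ X, (R : ℤ) < |x - y| := by
    by_contra! hle
    exact hX ⟨hne, hle⟩
  refine hΦ.range X ?_
  calc (R : ℝ) < |(x : ℝ) - y| := by exact_mod_cast hxy
    _ = dist x y := (Int.dist_eq x y).symm
    _ ≤ Metric.diam (X : Set ℤ) := Metric.dist_le_diam_of_mem X.finite_toSet.isBounded hx hy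

theorem embed_hamiltonian (hΦ : IsLocal Φ J R) (h : Λ ⊆ I) :
    embed h (Φ.hamiltonian Λ) = localSum (Φ.termIn I) R Λ := by
  rw [embed_hamiltonian_eq_sum, localSum]
  refine (Finset.sum_subset (fun X hX => Finset.mem_powerset.2 (mem_shortSets.1 hX).1)
    fun X hX hX' => ?_).symm
  have hX_sub := Finset.mem_powerset.1 hX
  rw [LocalInteraction.termIn, dif_pos (hX_sub.trans h),
    hΦ.term_eq_zero fun hshort => hX' (mem_shortSets.2 ⟨hX_sub, hshort⟩)]
  exact (embedLin _).map_zero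

theorem norm_hamiltonian_le (hΦ : IsLocal Φ J R) {m : ℕ} (hm : Λ.card ≤ m) :
    ‖Φ.hamiltonian Λ‖ ≤ J * 2 ^ (2 * R + 1) * m := by
  have hJ := hΦ.strength_nonneg
  rw [← embed_rfl (Φ.hamiltonian Λ), hΦ.embed_hamiltonian]
  refine (norm_localSum_le (isLocalFamily_termIn hΦ.strength Λ).norm_le Λ).trans ?_
  gcongr

end IsLocal

end Hamiltonian

section ConstantTerm

variable {d : ℕ} {Λ : Finset ℤ}

/-- The interaction with its constant term `Φ_∅` removed: this changes neither the range nor the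
strength nor the Gibbs states, and makes `H_Λ` a sum over nonempty sets of sites. -/
def LocalInteraction.dropConst (Φ : LocalInteraction d) : LocalInteraction d where
  term X := if X = ∅ then 0 else Φ.term X
  isHermitian X := by
    split_ifs
    · exact Matrix.isHermitian_zero
    · exact Φ.isHermitian X

theorem isLocal_dropConst {Φ : LocalInteraction d} {r J : ℝ} (hr : Φ.HasRange r) (hr_pos : 0 < r)
    (hJ : Φ.HasStrength J) : IsLocal Φ.dropConst J ⌈r⌉₊ where
  range X hX := by
    simp only [LocalInteraction.dropConst, hr X ((Nat.le_ceil r).trans_lt hX), ite_self]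
  strength X := by
    simp only [LocalInteraction.dropConst]
    split_ifs
    · rw [norm_zero]
      exact (norm_nonneg _).trans (hJ ∅)
    · exact hJ X
  term_empty := by simp only [LocalInteraction.dropConst, if_pos]
  pos := Nat.ceil_pos.2 hr_pos

theorem hamiltonian_eq_sum_erase (Φ : LocalInteraction d) (Λ : Finset ℤ) :
    Φ.hamiltonian Λ = ∑ X ∈ Λ.powerset.erase ∅, Φ.termIn Λ X + (Φ.term ∅).trace • 1 := by
  rw [← embed_rfl (Φ.hamiltonian Λ), embed_hamiltonian_eq_sum,
    ← Finset.sum_erase_add _ _ (Finset.empty_mem_powerset Λ), LocalInteraction.termIn.eq_def Φ Λ ∅,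
    dif_pos (Finset.empty_subset Λ), embed_eq_trace_smul_one _ rfl]

theorem hamiltonian_eq_dropConst_add (Φ : LocalInteraction d) (Λ : Finset ℤ) :
    Φ.hamiltonian Λ = Φ.dropConst.hamiltonian Λ + (Φ.term ∅).trace • 1 := by
  have hempty : Φ.dropConst.term ∅ = 0 := by simp only [LocalInteraction.dropConst, if_pos]
  rw [hamiltonian_eq_sum_erase, hamiltonian_eq_sum_erase Φ.dropConst, hempty, Matrix.trace_zero,
    zero_smul, add_zero]
  congr 1
  refine Finset.sum_congr rfl fun X hX => ?_
  have hterm : Φ.dropConst.term X = Φ.term X := if_neg (Finset.ne_of_mem_erase hX)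
  rw [LocalInteraction.termIn, LocalInteraction.termIn, hterm]

theorem gibbs_dropConst (Φ : LocalInteraction d) (Λ : Finset ℤ) :
    Φ.dropConst.gibbs Λ = Φ.gibbs Λ := by
  let := NormedAlgebra.restrictScalars ℚ ℂ (Observable d Λ)
  have hexp_smul_one (c : ℂ) : exp (c • (1 : Observable d Λ)) = exp c • 1 := by
    rw [← Algebra.algebraMap_eq_smul_one, ← algebraMap_exp_comm, Algebra.algebraMap_eq_smul_one]
  have hexp : exp (-Φ.hamiltonian Λ) =
      exp (-(Φ.term ∅).trace) • exp (-Φ.dropConst.hamiltonian Λ) := by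
    rw [hamiltonian_eq_dropConst_add, neg_add, ← neg_smul,
      exp_add_of_commute ((Commute.one_right _).smul_right _), hexp_smul_one, Matrix.mul_smul,
      mul_one]
  have hne : exp (-(Φ.term ∅).trace) ≠ 0 := by
    rw [← Complex.exp_eq_exp_ℂ]
    exact Complex.exp_ne_zero _
  rw [LocalInteraction.gibbs, LocalInteraction.gibbs, hexp, Matrix.trace_smul, smul_smul,
    smul_eq_mul, mul_inv_rev, inv_mul_cancel_right₀ hne]

end ConstantTerm

section Decoupling

variable {d : ℕ} {I A B C X : Finset ℤ} {Φ : LocalInteraction d}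

/-- The partition function `Z_Λ = Tr(e^{-H_Λ})`. -/
def LocalInteraction.partitionFn (Φ : LocalInteraction d) (Λ : Finset ℤ) : ℂ :=
  (exp (-Φ.hamiltonian Λ)).trace

/-- The quotient `Z_A Z_B Z_C / Z_I` of partition functions. -/
def LocalInteraction.partitionRatio (Φ : LocalInteraction d) (A B C I : Finset ℤ) : ℂ :=
  Φ.partitionFn A * Φ.partitionFn B * Φ.partitionFn C / Φ.partitionFn I

theorem isHermitian_neg_hamiltonian (Φ : LocalInteraction d) (Λ : Finset ℤ) :
    (-Φ.hamiltonian Λ).IsHermitian :=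
  (isHermitian_hamiltonian Φ Λ).neg

theorem embed_exp_mul_embed_exp_neg (hX : X ⊆ I) (K : Observable d X) :
    embed hX (exp K) * embed hX (exp (-K)) = 1 := by
  rw [← embed_mul, exp_mul_exp_neg, embed_one]

namespace IsPartition

/-- The Hamiltonian `H_A + H_B + H_C` without the interaction across the two cuts. -/
def decoupled (h : IsPartition A B C I) (Φ : LocalInteraction d) : Observable d I :=
  embed h.left (Φ.hamiltonian A) + embed h.mid (Φ.hamiltonian B) + embed h.right (Φ.hamiltonian C)

/-- The interaction `H_I - (H_A + H_B + H_C)` across the two cuts. -/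
def coupling (h : IsPartition A B C I) (Φ : LocalInteraction d) : Observable d I :=
  Φ.hamiltonian I - h.decoupled Φ

/-- The expansional `e^{H_A + H_B + H_C} e^{-H_I}`. -/
def expansional (h : IsPartition A B C I) (Φ : LocalInteraction d) : Observable d I :=
  SpinChain.expansional 1 (h.decoupled Φ) (h.coupling Φ)

/-- The expansional, averaged over the Gibbs state of the middle part. -/
def averaged (h : IsPartition A B C I) (Φ : LocalInteraction d) : Observable d I :=
  thermal h.mid (-Φ.hamiltonian B) (h.expansional Φ)

/-- The expansional, averaged over the Gibbs states of the middle and right parts. The average over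
the middle and left parts is `h.symm.leftAveraged`. -/
def leftAveraged (h : IsPartition A B C I) (Φ : LocalInteraction d) : Observable d I :=
  thermal h.right (-Φ.hamiltonian C) (h.averaged Φ)

/-- The difference between the averaged expansional and the normalized product of its averages over
the left and right parts. -/
def factorizationDefect (h : IsPartition A B C I) (Φ : LocalInteraction d) : Observable d I :=
  h.averaged Φ - Φ.partitionRatio A B C I • (h.leftAveraged Φ * h.symm.leftAveraged Φ)

/-- The factor `(Z_B / Z_I) e^{-H_A} e^{-H_C}` that turns averaged expansionals into marginals of
the Gibbs state on `I`. -/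
def outerWeight (h : IsPartition A B C I) (Φ : LocalInteraction d) : Observable d I :=
  (Φ.partitionFn B / Φ.partitionFn I) •
    (embed h.left (exp (-Φ.hamiltonian A)) * embed h.right (exp (-Φ.hamiltonian C)))

theorem decoupled_add_coupling (h : IsPartition A B C I) :
    h.decoupled Φ + h.coupling Φ = Φ.hamiltonian I :=
  add_sub_cancel _ _

theorem isHermitian_decoupled (h : IsPartition A B C I) : (h.decoupled Φ).IsHermitian :=
  ((isHermitian_embed _ (isHermitian_hamiltonian Φ A)).add
    (isHermitian_embed _ (isHermitian_hamiltonian Φ B))).add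
    (isHermitian_embed _ (isHermitian_hamiltonian Φ C))

theorem decoupled_symm (h : IsPartition A B C I) : h.symm.decoupled Φ = h.decoupled Φ := by
  rw [decoupled, decoupled]
  abel

theorem coupling_symm (h : IsPartition A B C I) : h.symm.coupling Φ = h.coupling Φ := by
  rw [coupling, coupling, decoupled_symm]

theorem averaged_symm (h : IsPartition A B C I) : h.symm.averaged Φ = h.averaged Φ := by
  rw [averaged, averaged, expansional, expansional, decoupled_symm, coupling_symm]

theorem prod_neg_hamiltonian (h : IsPartition A B C I) :
    h.prod (-Φ.hamiltonian A) (-Φ.hamiltonian B) (-Φ.hamiltonian C) = exp (-h.decoupled Φ) := by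
  rw [prod_eq_exp, embed_neg, embed_neg, embed_neg, decoupled, neg_add, neg_add]

theorem prod_mul_expansional (h : IsPartition A B C I) :
    h.prod (-Φ.hamiltonian A) (-Φ.hamiltonian B) (-Φ.hamiltonian C) * h.expansional Φ =
      exp (-Φ.hamiltonian I) := by
  rw [prod_neg_hamiltonian, expansional, SpinChain.expansional, decoupled_add_coupling, one_smul,
    neg_one_smul, ← mul_assoc, exp_neg_mul_exp, one_mul]

theorem exp_neg_mul_expansionalInv (h : IsPartition A B C I) :
    exp (-Φ.hamiltonian I) * expansionalInv 1 (h.decoupled Φ) (h.coupling Φ) =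
      h.prod (-Φ.hamiltonian A) (-Φ.hamiltonian B) (-Φ.hamiltonian C) := by
  rw [prod_neg_hamiltonian, expansionalInv, decoupled_add_coupling, one_smul, neg_one_smul,
    ← mul_assoc, exp_neg_mul_exp, one_mul]

theorem reduced_gibbs_mul_comm (h : IsPartition A B C I) :
    reduced h.left (Φ.gibbs I) * reduced h.right (Φ.gibbs I) =
      reduced h.right (Φ.gibbs I) * reduced h.left (Φ.gibbs I) :=
  (commute_embed h.left h.right h.left_right _ _).eq

end IsPartition

end Decoupling

section Marginals

variable {d : ℕ} [NeZero d] {I A B C Λ : Finset ℤ} {Φ : LocalInteraction d}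

theorem partitionFn_ne_zero (Φ : LocalInteraction d) (Λ : Finset ℤ) : Φ.partitionFn Λ ≠ 0 :=
  trace_exp_ne_zero (isHermitian_neg_hamiltonian Φ Λ)

theorem partitionRatio_ne_zero (Φ : LocalInteraction d) (A B C I : Finset ℤ) :
    Φ.partitionRatio A B C I ≠ 0 :=
  div_ne_zero (mul_ne_zero (mul_ne_zero (partitionFn_ne_zero Φ A) (partitionFn_ne_zero Φ B))
    (partitionFn_ne_zero Φ C)) (partitionFn_ne_zero Φ I)

theorem norm_partitionFn_le {x : ℝ} {m : ℕ} (hx : ‖Φ.hamiltonian Λ‖ ≤ x) (hm : Λ.card ≤ m) :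
    ‖Φ.partitionFn Λ‖ ≤ (d : ℝ) ^ m * Real.exp x := by
  have hd : (1 : ℝ) ≤ d := by exact_mod_cast NeZero.one_le
  have hexp : ‖exp (-Φ.hamiltonian Λ)‖ ≤ Real.exp x :=
    (norm_exp_le _).trans (Real.exp_le_exp.2 (by rwa [norm_neg]))
  calc ‖Φ.partitionFn Λ‖ ≤ (d : ℝ) ^ Λ.card * ‖exp (-Φ.hamiltonian Λ)‖ := norm_trace_le _
    _ ≤ (d : ℝ) ^ m * Real.exp x := by gcongr

namespace IsPartition

theorem outerWeight_inv (h : IsPartition A B C I) : (h.outerWeight Φ)⁻¹ =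
    (Φ.partitionFn I / Φ.partitionFn B) •
      (embed h.right (exp (Φ.hamiltonian C)) * embed h.left (exp (Φ.hamiltonian A))) := by
  refine Matrix.inv_eq_left_inv ?_
  rw [outerWeight, Matrix.smul_mul, Matrix.mul_smul, smul_smul,
    div_mul_div_cancel₀ (partitionFn_ne_zero Φ B), div_self (partitionFn_ne_zero Φ I), one_smul,
    mul_assoc, ← mul_assoc (embed h.left (exp (Φ.hamiltonian A))), embed_exp_mul_embed_exp_neg,
    one_mul, embed_exp_mul_embed_exp_neg]

theorem outerWeight_inv_mul (h : IsPartition A B C I) :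
    (h.outerWeight Φ)⁻¹ * h.outerWeight Φ = 1 := by
  refine Matrix.nonsing_inv_mul _ ((Matrix.isUnit_iff_isUnit_det _).1 ?_)
  have hratio : Φ.partitionFn B / Φ.partitionFn I ≠ 0 :=
    div_ne_zero (partitionFn_ne_zero Φ B) (partitionFn_ne_zero Φ I)
  have hexp (Y : Finset ℤ) (hY : Y ⊆ I) : IsUnit (embed hY (exp (-Φ.hamiltonian Y))) :=
    IsUnit.of_mul_eq_one_right _ (embed_exp_mul_embed_exp_neg hY (Φ.hamiltonian Y))
  exact ((hexp A h.left).mul (hexp C h.right)).smul (Units.mk0 _ hratio)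

theorem reduced_gibbs_left_right (h : IsPartition A B C I) (hAC : A ∪ C ⊆ I) :
    reduced hAC (Φ.gibbs I) = h.outerWeight Φ * h.averaged Φ := by
  rw [LocalInteraction.gibbs, reduced_smul, ← h.prod_mul_expansional,
    h.reduced_left_right (isHermitian_neg_hamiltonian Φ B), prod_mul_expansional, smul_smul,
    outerWeight, Matrix.smul_mul, div_eq_inv_mul]
  rfl

theorem reduced_gibbs_left (h : IsPartition A B C I) :
    reduced h.left (Φ.gibbs I) = (Φ.partitionFn B * Φ.partitionFn C / Φ.partitionFn I) •
      (embed h.left (exp (-Φ.hamiltonian A)) * h.leftAveraged Φ) := by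
  rw [LocalInteraction.gibbs, reduced_smul, ← h.prod_mul_expansional,
    h.reduced_left (isHermitian_neg_hamiltonian Φ B) (isHermitian_neg_hamiltonian Φ C),
    prod_mul_expansional, smul_smul, div_eq_inv_mul]
  rfl

theorem exists_leftAveraged_eq_embed (h : IsPartition A B C I) :
    ∃ P : Observable d A, h.leftAveraged Φ = embed h.left P := by
  set z := Φ.partitionFn B * Φ.partitionFn C / Φ.partitionFn I with hz_def
  have hz : z ≠ 0 := div_ne_zero
    (mul_ne_zero (partitionFn_ne_zero Φ B) (partitionFn_ne_zero Φ C)) (partitionFn_ne_zero Φ I)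
  refine ⟨z⁻¹ • (exp (Φ.hamiltonian A) * reduce A (Φ.gibbs I)), ?_⟩
  rw [embed_smul, embed_mul, ← reduced.eq_1, h.reduced_gibbs_left, ← hz_def, Matrix.mul_smul,
    smul_smul, inv_mul_cancel₀ hz, one_smul, ← mul_assoc, embed_exp_mul_embed_exp_neg, one_mul]

theorem reduced_gibbs_left_mul_right (h : IsPartition A B C I) :
    reduced h.left (Φ.gibbs I) * reduced h.right (Φ.gibbs I) =
      h.outerWeight Φ *
        (Φ.partitionRatio A B C I • (h.leftAveraged Φ * h.symm.leftAveraged Φ)) := by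
  obtain ⟨P, hP⟩ := h.exists_leftAveraged_eq_embed (Φ := Φ)
  have hcomm := (commute_embed h.left h.right h.left_right P (exp (-Φ.hamiltonian C))).eq
  rw [h.reduced_gibbs_left, h.symm.reduced_gibbs_left, outerWeight, hP]
  simp only [Matrix.smul_mul, Matrix.mul_smul, smul_smul]
  rw [mul_assoc, ← mul_assoc (embed h.left P), hcomm]
  simp only [mul_assoc]
  congr 1
  rw [LocalInteraction.partitionRatio]
  ring

theorem factorizationDefect_eq (h : IsPartition A B C I) : h.factorizationDefect Φ =
    (h.outerWeight Φ)⁻¹ * (reduced (Finset.union_subset h.left h.right) (Φ.gibbs I) -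
      reduced h.left (Φ.gibbs I) * reduced h.right (Φ.gibbs I)) := by
  rw [factorizationDefect, h.reduced_gibbs_left_right, h.reduced_gibbs_left_mul_right, ← mul_sub,
    ← mul_assoc, outerWeight_inv_mul, one_mul]

theorem partitionRatio_smul_thermal (h : IsPartition A B C I) :
    Φ.partitionRatio A B C I • thermal h.left (-Φ.hamiltonian A) (h.leftAveraged Φ) = 1 := by
  have htrace := h.trace_prod_mul (isHermitian_neg_hamiltonian Φ A)
    (isHermitian_neg_hamiltonian Φ B) (isHermitian_neg_hamiltonian Φ C) (h.expansional Φ)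
  rw [prod_mul_expansional] at htrace
  rw [LocalInteraction.partitionRatio, div_eq_inv_mul, mul_smul]
  refine (congrArg (fun Q => (Φ.partitionFn I)⁻¹ • Q) htrace.symm).trans ?_
  rw [smul_smul, ← LocalInteraction.partitionFn.eq_def, inv_mul_cancel₀ (partitionFn_ne_zero Φ I),
    one_smul]

end IsPartition

end Marginals

/-- The expansional of the coupling and the interpolated inverse expansionals have norm at most
`g`. -/
structure IsPartition.IsBounded {d : ℕ} {I A B C : Finset ℤ} (h : IsPartition A B C I)
    (Φ : LocalInteraction d) (g : ℝ) : Prop where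
  norm_expansional_le : ‖h.expansional Φ‖ ≤ g
  norm_inv_le : ∀ s ∈ Set.Icc (0 : ℝ) 1, ‖expansionalInv s (h.decoupled Φ) (h.coupling Φ)‖ ≤ g

section Bounds

variable {d : ℕ} {I A B C : Finset ℤ} {h : IsPartition A B C I} {Φ : LocalInteraction d} {g x : ℝ}

namespace IsPartition

theorem IsBounded.symm (hg : h.IsBounded Φ g) : h.symm.IsBounded Φ g where
  norm_expansional_le := by
    rw [expansional, decoupled_symm, coupling_symm]
    exact hg.norm_expansional_le
  norm_inv_le := by
    rw [decoupled_symm, coupling_symm]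
    exact hg.norm_inv_le

theorem IsBounded.nonneg (hg : h.IsBounded Φ g) : 0 ≤ g :=
  (norm_nonneg _).trans hg.norm_expansional_le

theorem exp_smul_mid_add_right (h : IsPartition A B C I) (Φ : LocalInteraction d) (s : ℝ) :
    exp (s • (embed h.mid (-Φ.hamiltonian B) + embed h.right (-Φ.hamiltonian C))) =
      exp (s • embed h.left (Φ.hamiltonian A)) * exp ((-s) • h.decoupled Φ) := by
  let := NormedAlgebra.restrictScalars ℚ ℂ (Observable d I)
  have hcomm : Commute (embed h.left (Φ.hamiltonian A)) (h.decoupled Φ) :=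
    ((Commute.refl _).add_right (commute_embed h.left h.mid h.left_mid _ _)).add_right
      (commute_embed h.left h.right h.left_right _ _)
  rw [← exp_add_of_commute ((hcomm.smul_left _).smul_right _), decoupled, embed_neg, embed_neg]
  congr 1
  module

theorem conjTranspose_expansionalInv (h : IsPartition A B C I) (Φ : LocalInteraction d) (s : ℝ) :
    (expansionalInv s (h.decoupled Φ) (h.coupling Φ)).conjTranspose =
      exp ((-s) • h.decoupled Φ) * exp (s • Φ.hamiltonian I) := by
  rw [expansionalInv, Matrix.conjTranspose_mul, decoupled_add_coupling,
    (isHermitian_exp_smul h.isHermitian_decoupled _).eq,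
    (isHermitian_exp_smul (isHermitian_hamiltonian Φ I) _).eq]

variable [NeZero d]

theorem IsBounded.norm_averaged_le (hg : h.IsBounded Φ g) : ‖h.averaged Φ‖ ≤ g :=
  (norm_thermal_le _ (isHermitian_neg_hamiltonian Φ B) _).trans hg.norm_expansional_le

theorem IsBounded.norm_leftAveraged_le (hg : h.IsBounded Φ g) : ‖h.leftAveraged Φ‖ ≤ g :=
  (norm_thermal_le _ (isHermitian_neg_hamiltonian Φ C) _).trans hg.norm_averaged_le

theorem IsBounded.norm_partitionRatio_le (hg : h.IsBounded Φ g) :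
    ‖Φ.partitionRatio A B C I‖ ≤ g := by
  rw [LocalInteraction.partitionRatio, norm_div,
    div_le_iff₀ (norm_pos_iff.2 (partitionFn_ne_zero Φ I)), mul_comm g]
  refine (h.norm_trace_prod_le (isHermitian_neg_hamiltonian Φ I)
    h.exp_neg_mul_expansionalInv).trans ?_
  exact mul_le_mul_of_nonneg_left (hg.norm_inv_le 1 (by simp)) (norm_nonneg _)

theorem IsBounded.norm_partitionFn_le (hg : h.IsBounded Φ g) :
    ‖Φ.partitionFn I‖ ≤ ‖Φ.partitionFn A * Φ.partitionFn B * Φ.partitionFn C‖ * g := by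
  have hle := h.norm_trace_prod_mul_le (isHermitian_neg_hamiltonian Φ A)
    (isHermitian_neg_hamiltonian Φ B) (isHermitian_neg_hamiltonian Φ C) (h.expansional Φ)
  rw [prod_mul_expansional] at hle
  exact hle.trans (mul_le_mul_of_nonneg_left hg.norm_expansional_le (norm_nonneg _))

theorem IsBounded.norm_inv_partitionRatio_le (hg : h.IsBounded Φ g) :
    ‖(Φ.partitionRatio A B C I)⁻¹‖ ≤ g := by
  have hprod : 0 < ‖Φ.partitionFn A * Φ.partitionFn B * Φ.partitionFn C‖ := norm_pos_iff.2
    (mul_ne_zero (mul_ne_zero (partitionFn_ne_zero Φ A) (partitionFn_ne_zero Φ B))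
      (partitionFn_ne_zero Φ C))
  rw [LocalInteraction.partitionRatio, inv_div, norm_div, div_le_iff₀' hprod]
  exact hg.norm_partitionFn_le

theorem IsBounded.norm_exp_half_mul_exp_half_le (hg : h.IsBounded Φ g)
    (hx : ‖Φ.hamiltonian A‖ ≤ x) :
    ‖exp ((1 / 2 : ℝ) • (embed h.mid (-Φ.hamiltonian B) + embed h.right (-Φ.hamiltonian C))) *
      exp ((-(1 / 2) : ℝ) • (-Φ.hamiltonian I))‖ ≤ Real.exp (x / 2) * g := by
  rw [h.exp_smul_mid_add_right, neg_smul_neg, mul_assoc, ← h.conjTranspose_expansionalInv]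
  refine (norm_mul_le _ _).trans ?_
  rw [Matrix.l2_opNorm_conjTranspose]
  gcongr
  · refine (norm_exp_smul_le ((norm_embed_le _ _).trans hx) _).trans (Real.exp_le_exp.2 ?_)
    rw [abs_of_pos one_half_pos, one_div_mul_eq_div]
  · exact hg.norm_inv_le (1 / 2) (by norm_num)

theorem IsBounded.exists_inv_leftAveraged (hg : h.IsBounded Φ g) (hx : ‖Φ.hamiltonian A‖ ≤ x) :
    ∃ N : Observable d I, N * h.leftAveraged Φ = 1 ∧ ‖N‖ ≤ g ^ 2 * Real.exp (2 * x) := by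
  obtain ⟨N, hN, hN_le⟩ := h.exists_inv_thermal (isHermitian_neg_hamiltonian Φ I)
    (isHermitian_neg_hamiltonian Φ B) (isHermitian_neg_hamiltonian Φ C) h.prod_mul_expansional
  have hexp : ‖exp (-Φ.hamiltonian A)‖ ≤ Real.exp x :=
    (norm_exp_le _).trans (Real.exp_le_exp.2 (by rwa [norm_neg]))
  refine ⟨N, hN, hN_le.trans ?_⟩
  calc _ ≤ (Real.exp (x / 2) * g) ^ 2 * Real.exp x := by
        gcongr
        exact hg.norm_exp_half_mul_exp_half_le hx
    _ = g ^ 2 * Real.exp (2 * x) := by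
        rw [mul_pow, ← Real.exp_nat_mul, mul_right_comm, ← Real.exp_add, mul_comm]
        congr 2
        push_cast
        ring

theorem IsBounded.norm_outerWeight_inv_le (hg : h.IsBounded Φ g) {m : ℕ}
    (hA : ‖Φ.hamiltonian A‖ ≤ x) (hC : ‖Φ.hamiltonian C‖ ≤ x) (hAm : A.card ≤ m)
    (hCm : C.card ≤ m) :
    ‖(h.outerWeight Φ)⁻¹‖ ≤ ((d : ℝ) ^ m * Real.exp x) ^ 2 * g * (Real.exp x * Real.exp x) := by
  have hg_nonneg := hg.nonneg
  have hquot : ‖Φ.partitionFn I / Φ.partitionFn B‖ ≤ ((d : ℝ) ^ m * Real.exp x) ^ 2 * g := by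
    rw [norm_div, div_le_iff₀ (norm_pos_iff.2 (partitionFn_ne_zero Φ B))]
    calc ‖Φ.partitionFn I‖ ≤ ‖Φ.partitionFn A * Φ.partitionFn B * Φ.partitionFn C‖ * g :=
          hg.norm_partitionFn_le
      _ = ‖Φ.partitionFn A‖ * ‖Φ.partitionFn B‖ * ‖Φ.partitionFn C‖ * g := by
          rw [norm_mul, norm_mul]
      _ ≤ ((d : ℝ) ^ m * Real.exp x) * ‖Φ.partitionFn B‖ * ((d : ℝ) ^ m * Real.exp x) * g := by
          gcongr
          exacts [SpinChain.norm_partitionFn_le hA hAm, SpinChain.norm_partitionFn_le hC hCm]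
      _ = ((d : ℝ) ^ m * Real.exp x) ^ 2 * g * ‖Φ.partitionFn B‖ := by ring
  have hexp (Y : Finset ℤ) (hY : Y ⊆ I) (hx : ‖Φ.hamiltonian Y‖ ≤ x) :
      ‖embed hY (exp (Φ.hamiltonian Y))‖ ≤ Real.exp x :=
    (norm_embed_le _ _).trans ((norm_exp_le _).trans (Real.exp_le_exp.2 hx))
  rw [outerWeight_inv, norm_smul]
  gcongr
  exact (norm_mul_le _ _).trans
    (mul_le_mul (hexp C _ hC) (hexp A _ hA) (norm_nonneg _) (Real.exp_pos _).le)

theorem IsBounded.norm_factorizationDefect_le_of_corr_le (hg : h.IsBounded Φ g) {m : ℕ}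
    (hA : ‖Φ.hamiltonian A‖ ≤ x) (hC : ‖Φ.hamiltonian C‖ ≤ x) (hAm : A.card ≤ m)
    (hCm : C.card ≤ m) {c : ℝ} (hc : corr (Φ.gibbs I) A C ≤ c) (hc_nonneg : 0 ≤ c) :
    ‖h.factorizationDefect Φ‖ ≤ g * c * ((d : ℝ) ^ m) ^ 6 * Real.exp x ^ 4 := by
  have hg_nonneg := hg.nonneg
  have hd : (1 : ℝ) ≤ d := by exact_mod_cast NeZero.one_le
  have hcard : (A ∪ C).card ≤ 2 * m := (Finset.card_union_le A C).trans (by omega)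
  have hcluster : ‖reduced (Finset.union_subset h.left h.right) (Φ.gibbs I) -
      reduced h.left (Φ.gibbs I) * reduced h.right (Φ.gibbs I)‖ ≤ ((d : ℝ) ^ (2 * m)) ^ 2 * c :=
    calc _ ≤ ((d : ℝ) ^ (A ∪ C).card) ^ 2 * corr (Φ.gibbs I) A C :=
          norm_reduced_sub_le h.left h.right h.left_right (Φ.gibbs I)
      _ ≤ ((d : ℝ) ^ (A ∪ C).card) ^ 2 * c := by gcongr
      _ ≤ ((d : ℝ) ^ (2 * m)) ^ 2 * c := by gcongr
  rw [factorizationDefect_eq]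
  calc _ ≤ ((d : ℝ) ^ m * Real.exp x) ^ 2 * g * (Real.exp x * Real.exp x) *
        (((d : ℝ) ^ (2 * m)) ^ 2 * c) := by
        refine (norm_mul_le _ _).trans ?_
        gcongr
        exact hg.norm_outerWeight_inv_le hA hC hAm hCm
    _ = g * c * ((d : ℝ) ^ m) ^ 6 * Real.exp x ^ 4 := by ring

end IsPartition

end Bounds

section Factorization

theorem sub_smul_mul_eq {𝕜 𝔐 : Type*} [CommRing 𝕜] [Ring 𝔐] [Algebra 𝕜 𝔐] (w p q e f : 𝔐)
    (κ u v : 𝕜) : w - κ • (p * q) = (w - e * f) + (1 - κ * (u * v)) • (e * f) -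
      κ • ((p - u • e) * q + (u • e) * (q - v • f)) := by
  simp only [sub_mul, mul_sub, smul_mul_assoc, mul_smul_comm]
  module

variable {d : ℕ} [NeZero d] {I A B C : Finset ℤ} {h : IsPartition A B C I}
  {Φ : LocalInteraction d} {P : Observable d A} {Q : Observable d C} {g δ : ℝ}

namespace IsPartition

theorem norm_leftAveraged_sub_smul_le (h : IsPartition A B C I) (Φ : LocalInteraction d)
    (P : Observable d A) (Q : Observable d C) :
    ‖h.leftAveraged Φ - thermalMean (-Φ.hamiltonian C) Q • embed h.left P‖ ≤
      ‖h.averaged Φ - embed h.left P * embed h.right Q‖ := by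
  have hthermal : thermal h.right (-Φ.hamiltonian C) (h.averaged Φ - embed h.left P *
      embed h.right Q) =
      h.leftAveraged Φ - thermalMean (-Φ.hamiltonian C) Q • embed h.left P := by
    rw [thermal_sub, thermal_embed_mul h.left h.right h.left_right, thermal_embed, Matrix.mul_smul,
      mul_one, leftAveraged]
  rw [← hthermal]
  exact norm_thermal_le _ (isHermitian_neg_hamiltonian Φ C) _

theorem norm_symm_leftAveraged_sub_smul_le (h : IsPartition A B C I) (Φ : LocalInteraction d)
    (P : Observable d A) (Q : Observable d C) :
    ‖h.symm.leftAveraged Φ - thermalMean (-Φ.hamiltonian A) P • embed h.right Q‖ ≤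
      ‖h.averaged Φ - embed h.left P * embed h.right Q‖ := by
  rw [← h.averaged_symm, (commute_embed h.left h.right h.left_right P Q).eq]
  exact h.symm.norm_leftAveraged_sub_smul_le Φ Q P

theorem IsBounded.norm_one_sub_partitionRatio_mul_le (hg : h.IsBounded Φ g)
    (hδ : ‖h.averaged Φ - embed h.left P * embed h.right Q‖ ≤ δ) :
    ‖1 - Φ.partitionRatio A B C I *
      (thermalMean (-Φ.hamiltonian C) Q * thermalMean (-Φ.hamiltonian A) P)‖ ≤ g * δ := by
  have hthermal : Φ.partitionRatio A B C I • thermal h.left (-Φ.hamiltonian A)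
      (h.leftAveraged Φ - thermalMean (-Φ.hamiltonian C) Q • embed h.left P) =
      (1 - Φ.partitionRatio A B C I *
        (thermalMean (-Φ.hamiltonian C) Q * thermalMean (-Φ.hamiltonian A) P)) • 1 := by
    rw [thermal_sub, thermal_smul, thermal_embed, smul_sub, h.partitionRatio_smul_thermal,
      smul_smul, smul_smul, sub_smul, one_smul, mul_assoc]
  have hnorm := congrArg norm hthermal
  rw [norm_smul, norm_smul, norm_one, mul_one] at hnorm
  rw [← hnorm]
  have hle : ‖thermal h.left (-Φ.hamiltonian A)
      (h.leftAveraged Φ - thermalMean (-Φ.hamiltonian C) Q • embed h.left P)‖ ≤ δ :=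
    (norm_thermal_le _ (isHermitian_neg_hamiltonian Φ A) _).trans
      ((h.norm_leftAveraged_sub_smul_le Φ P Q).trans hδ)
  exact mul_le_mul hg.norm_partitionRatio_le hle (norm_nonneg _) hg.nonneg

theorem IsBounded.norm_factorizationDefect_le_of_norm_sub_mul_le (hg : h.IsBounded Φ g)
    (hg_one : 1 ≤ g) (hP : ‖embed h.left P‖ ≤ g ^ 2) (hQ : ‖embed h.right Q‖ ≤ g)
    (hδ : ‖h.averaged Φ - embed h.left P * embed h.right Q‖ ≤ δ) :
    ‖h.factorizationDefect Φ‖ ≤ 4 * g ^ 4 * δ := by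
  have hδ_nonneg : 0 ≤ δ := (norm_nonneg _).trans hδ
  set w := h.averaged Φ
  set p := h.leftAveraged Φ
  set q := h.symm.leftAveraged Φ
  set κ := Φ.partitionRatio A B C I
  set u := thermalMean (-Φ.hamiltonian C) Q
  set v := thermalMean (-Φ.hamiltonian A) P
  set eP := embed h.left P
  set eQ := embed h.right Q
  have hu : ‖u‖ ≤ g := (norm_thermalMean_le h.right (isHermitian_neg_hamiltonian Φ C) Q).trans hQ
  have hp : ‖p - u • eP‖ ≤ δ := (h.norm_leftAveraged_sub_smul_le Φ P Q).trans hδ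
  have hq : ‖q - v • eQ‖ ≤ δ := (h.norm_symm_leftAveraged_sub_smul_le Φ P Q).trans hδ
  have hq_le : ‖q‖ ≤ g := hg.symm.norm_leftAveraged_le
  have huv : ‖1 - κ * (u * v)‖ ≤ g * δ := hg.norm_one_sub_partitionRatio_mul_le hδ
  have hκ : ‖κ‖ ≤ g := hg.norm_partitionRatio_le
  rw [factorizationDefect, sub_smul_mul_eq w p q eP eQ κ u v]
  calc _ ≤ ‖w - eP * eQ‖ + ‖1 - κ * (u * v)‖ * (‖eP‖ * ‖eQ‖) +
        ‖κ‖ * (‖p - u • eP‖ * ‖q‖ + ‖u‖ * ‖eP‖ * ‖q - v • eQ‖) := by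
        refine norm_sub_le_of_le (norm_add_le_of_le le_rfl ?_) ?_
        · exact (norm_smul_le _ _).trans (by gcongr; exact norm_mul_le _ _)
        · refine (norm_smul_le _ _).trans ?_
          gcongr
          refine norm_add_le_of_le (norm_mul_le _ _) ((norm_mul_le _ _).trans ?_)
          rw [norm_smul]
    _ ≤ δ + g * δ * (g ^ 2 * g) + g * (δ * g + g * g ^ 2 * δ) := by gcongr
    _ = (1 + 2 * g ^ 4 + g ^ 2) * δ := by ring
    _ ≤ 4 * g ^ 4 * δ := by
        gcongr
        have hg_sq : 1 ≤ g ^ 2 := one_le_pow₀ hg_one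
        nlinarith

theorem inv_reduced_mul_inv_reduced (h : IsPartition A B C I) {N N' : Observable d I}
    (hN : N * h.leftAveraged Φ = 1) (hN' : N' * h.symm.leftAveraged Φ = 1) :
    (reduced h.left (Φ.gibbs I))⁻¹ * (reduced h.right (Φ.gibbs I))⁻¹ =
      (Φ.partitionRatio A B C I)⁻¹ • (N' * N * (h.outerWeight Φ)⁻¹) := by
  rw [← Matrix.mul_inv_rev, ← h.reduced_gibbs_mul_comm, h.reduced_gibbs_left_mul_right]
  refine Matrix.inv_eq_left_inv ?_
  calc _ = (Φ.partitionRatio A B C I * (Φ.partitionRatio A B C I)⁻¹) •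
        (N' * (N * (((h.outerWeight Φ)⁻¹ * h.outerWeight Φ) * h.leftAveraged Φ)) *
          h.symm.leftAveraged Φ) := by
        simp only [Matrix.smul_mul, Matrix.mul_smul, smul_smul, mul_assoc]
    _ = 1 := by
        rw [mul_inv_cancel₀ (partitionRatio_ne_zero Φ A B C I), one_smul, outerWeight_inv_mul,
          one_mul, hN, mul_one, hN']

theorem IsBounded.norm_inv_reduced_mul_inv_reduced_mul_sub_one_le (hg : h.IsBounded Φ g)
    {N N' : Observable d I} (hN : N * h.leftAveraged Φ = 1) (hN' : N' * h.symm.leftAveraged Φ = 1)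
    {n : ℝ} (hN_le : ‖N‖ ≤ n) (hN'_le : ‖N'‖ ≤ n) (hAC : A ∪ C ⊆ I)
    (hδ : ‖h.factorizationDefect Φ‖ ≤ δ) :
    ‖(reduced h.left (Φ.gibbs I))⁻¹ * (reduced h.right (Φ.gibbs I))⁻¹ * reduced hAC (Φ.gibbs I) -
      1‖ ≤ g * n ^ 2 * δ := by
  have hn_nonneg : 0 ≤ n := (norm_nonneg _).trans hN_le
  have hdefect : (reduced h.left (Φ.gibbs I))⁻¹ * (reduced h.right (Φ.gibbs I))⁻¹ *
      reduced hAC (Φ.gibbs I) - 1 =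
        (Φ.partitionRatio A B C I)⁻¹ • (N' * (N * h.factorizationDefect Φ)) := by
    rw [h.inv_reduced_mul_inv_reduced hN hN', h.reduced_gibbs_left_right, factorizationDefect,
      Matrix.smul_mul, mul_assoc, ← mul_assoc (h.outerWeight Φ)⁻¹, outerWeight_inv_mul, one_mul,
      mul_assoc, mul_sub, mul_sub, Matrix.mul_smul, ← mul_assoc N (h.leftAveraged Φ), hN, one_mul,
      Matrix.mul_smul, hN', smul_sub, smul_smul,
      inv_mul_cancel₀ (partitionRatio_ne_zero Φ A B C I), one_smul]
  rw [hdefect]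
  calc _ ≤ g * (n * (n * δ)) := by
        refine (norm_smul_le _ _).trans (mul_le_mul hg.norm_inv_partitionRatio_le ?_
          (norm_nonneg _) hg.nonneg)
        refine (norm_mul_le _ _).trans ?_
        gcongr
        refine (norm_mul_le _ _).trans ?_
        gcongr
    _ = g * n ^ 2 * δ := by ring

end IsPartition

end Factorization

section Intervals

variable {d : ℕ} {Φ : LocalInteraction d} {J : ℝ} {R : ℕ} {a b c e : ℤ} {I : Finset ℤ}

theorem isPartition_Ico (hab : a ≤ b) (hbc : b ≤ c) (hce : c ≤ e) :
    IsPartition (Finset.Ico a b) (Finset.Ico b c) (Finset.Ico c e) (Finset.Ico a e) where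
  left := Finset.Ico_subset_Ico_right (hbc.trans hce)
  mid := Finset.Ico_subset_Ico hab hce
  right := Finset.Ico_subset_Ico_left (hab.trans hbc)
  subset x := by simp only [Finset.mem_union, Finset.mem_Ico]; omega
  left_mid := Finset.Ico_disjoint_Ico_consecutive a b c
  left_right := Finset.disjoint_left.2 fun x => by simp only [Finset.mem_Ico]; omega
  mid_right := Finset.Ico_disjoint_Ico_consecutive b c e

namespace IsLocal

theorem embed_decoupled (hΦ : IsLocal Φ J R) (hab : a ≤ b) (hbc : b ≤ c) (hce : c ≤ e)
    (hI : Finset.Ico a e ⊆ I) : embed hI ((isPartition_Ico hab hbc hce).decoupled Φ) =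
      splitSum (Φ.termIn I) R a b c e := by
  rw [← embedHom_apply, IsPartition.decoupled, map_add, map_add, splitSum_eq _ _ hbc]
  simp only [embedHom_apply, embed_embed]
  simp only [hΦ.embed_hamiltonian]

theorem embed_coupling (hΦ : IsLocal Φ J R) (hab : a ≤ b) (hbc : b ≤ c) (hce : c ≤ e)
    (hI : Finset.Ico a e ⊆ I) : embed hI ((isPartition_Ico hab hbc hce).coupling Φ) =
      crossingSum (Φ.termIn I) R a b c e := by
  rw [← embedHom_apply, IsPartition.coupling, map_sub, embedHom_apply, embedHom_apply,
    hΦ.embed_decoupled hab hbc hce, hΦ.embed_hamiltonian, crossingSum_eq _ _ hab hbc hce]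

theorem embed_expansional (hΦ : IsLocal Φ J R) (hab : a ≤ b) (hbc : b ≤ c) (hce : c ≤ e)
    (hI : Finset.Ico a e ⊆ I) : embed hI ((isPartition_Ico hab hbc hce).expansional Φ) =
      expansional 1 (splitSum (Φ.termIn I) R a b c e) (crossingSum (Φ.termIn I) R a b c e) := by
  rw [← hΦ.embed_decoupled hab hbc hce hI, ← hΦ.embed_coupling hab hbc hce hI,
    IsPartition.expansional, expansional, expansional, ← embedHom_apply]
  simp only [embedHom_apply, embed_mul, embed_exp, one_smul, neg_one_smul, embed_neg]
  simp only [← embedHom_apply, map_add]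

variable [NeZero d]

theorem isBounded (hΦ : IsLocal Φ J R) (hab : a ≤ b) (hbc : b ≤ c) (hce : c ≤ e) :
    (isPartition_Ico hab hbc hce).IsBounded Φ (Real.exp (evolveBound J R)) where
  norm_expansional_le := by
    rw [← embed_rfl ((isPartition_Ico hab hbc hce).expansional Φ),
      hΦ.embed_expansional hab hbc hce]
    exact (isLocalFamily_termIn hΦ.strength _).norm_expansional_le hΦ.pos a b c e
  norm_inv_le s hs := by
    rw [← embed_rfl ((isPartition_Ico hab hbc hce).decoupled Φ),
      hΦ.embed_decoupled hab hbc hce,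
      ← embed_rfl ((isPartition_Ico hab hbc hce).coupling Φ), hΦ.embed_coupling hab hbc hce]
    exact (isLocalFamily_termIn hΦ.strength _).norm_expansionalInv_le hΦ.pos a b c e hs

end IsLocal

end Intervals

section Truncation

variable {d : ℕ} {Φ : LocalInteraction d} {J t : ℝ} {R n : ℕ} {a b c e a' e' : ℤ}

/-- The error of removing the interaction at distance more than `n * R` from the two cuts, for a
decay rate `t` that may be chosen freely. -/
def truncationError (J : ℝ) (R : ℕ) (t : ℝ) (n : ℕ) : ℝ :=
  Real.exp (3 * evolveBound J R) * (evolveTail J R t / t ^ n)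

/-- The number of sites on each side of the middle interval that are kept by a truncation at
distance `n * R`. -/
def truncationWidth (R n : ℕ) : ℕ := (n + 1) * R + 1

theorem IsTruncation.subset (h : IsTruncation R n a b c e a' e') :
    Finset.Ico a' e' ⊆ Finset.Ico a e :=
  Finset.Ico_subset_Ico h.le_left h.right_le

theorem isTruncation (R n : ℕ) (hab : a ≤ b) (hce : c ≤ e) :
    IsTruncation R n a b c e (max a (b - (n + 1) * R)) (min e (c + truncationWidth R n)) := by
  have width_nonneg : (0 : ℤ) ≤ (n + 1) * R := by positivity
  simp only [truncationWidth, Nat.cast_add, Nat.cast_mul, Nat.cast_one]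
  constructor <;> omega

theorem isTruncation_left (R n : ℕ) (hab : a ≤ b) (hce : c ≤ e) :
    IsTruncation R n a b c e (max a (b - (n + 1) * R)) e :=
  { isTruncation R n hab hce with le_right := hce, right_le := le_rfl, right := Or.inl rfl }

theorem isTruncation_right (R n : ℕ) (hab : a ≤ b) (hce : c ≤ e) :
    IsTruncation R n a b c e a (min e (c + truncationWidth R n)) :=
  { isTruncation R n hab hce with le_left := le_rfl, left_le := hab, left := Or.inl rfl }

theorem card_truncation_left_le (R n : ℕ) (a b : ℤ) :
    (Finset.Ico (max a (b - (n + 1) * R)) b).card ≤ truncationWidth R n := by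
  have width_eq : (truncationWidth R n : ℤ) = (n + 1) * R + 1 := by simp [truncationWidth]
  rw [Int.card_Ico]
  omega

theorem card_truncation_right_le (R n : ℕ) (c e : ℤ) :
    (Finset.Ico c (min e (c + truncationWidth R n))).card ≤ truncationWidth R n := by
  rw [Int.card_Ico]
  omega

variable [NeZero d]

theorem IsLocal.norm_averaged_sub_le (hΦ : IsLocal Φ J R) (hbc : b ≤ c)
    (h : IsTruncation R n a b c e a' e') (ht : 1 ≤ t) :
    ‖(isPartition_Ico (h.le_left.trans h.left_le) hbc (h.le_right.trans h.right_le)).averaged Φ -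
      embed h.subset ((isPartition_Ico h.left_le hbc h.le_right).averaged Φ)‖ ≤
      truncationError J R t n := by
  rw [IsPartition.averaged, IsPartition.averaged, ← thermal_embed_of_subset, ← thermal_sub]
  refine (norm_thermal_le _ (isHermitian_neg_hamiltonian Φ _) _).trans ?_
  rw [hΦ.embed_expansional h.left_le hbc h.le_right, ← embed_rfl (IsPartition.expansional _ Φ),
    hΦ.embed_expansional (h.le_left.trans h.left_le) hbc (h.le_right.trans h.right_le)]
  exact (isLocalFamily_termIn hΦ.strength _).norm_expansional_sub_truncation_le hΦ.pos hbc h ht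

namespace IsPartition

variable {A A' B C C' I Λ : Finset ℤ}

theorem norm_leftAveraged_sub_le (h : IsPartition A B C I) (h' : IsPartition A' B C Λ)
    (hΛ : Λ ⊆ I) : ‖h.leftAveraged Φ - embed hΛ (h'.leftAveraged Φ)‖ ≤
      ‖h.averaged Φ - embed hΛ (h'.averaged Φ)‖ := by
  rw [leftAveraged, leftAveraged, ← thermal_embed_of_subset, ← thermal_sub]
  exact norm_thermal_le _ (isHermitian_neg_hamiltonian Φ _) _

theorem norm_symm_leftAveraged_sub_le (h : IsPartition A B C I) (h' : IsPartition A B C' Λ)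
    (hΛ : Λ ⊆ I) : ‖h.symm.leftAveraged Φ - embed hΛ (h'.symm.leftAveraged Φ)‖ ≤
      ‖h.averaged Φ - embed hΛ (h'.averaged Φ)‖ := by
  rw [← h.averaged_symm, ← h'.averaged_symm]
  exact norm_leftAveraged_sub_le h.symm h'.symm hΛ

theorem IsBounded.exists_embed_mul_embed_eq {g : ℝ} {h' : IsPartition A' B C' Λ}
    (hg : h'.IsBounded Φ g) (h : IsPartition A B C I) (hA : A' ⊆ A) (hC : C' ⊆ C) (hΛ : Λ ⊆ I) :
    ∃ (P : Observable d A) (Q : Observable d C),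
      ‖embed h.left P‖ ≤ g ^ 2 ∧ ‖embed h.right Q‖ ≤ g ∧
        embed h.left P * embed h.right Q =
          embed hΛ (h'.averaged Φ - h'.factorizationDefect Φ) := by
  obtain ⟨P, hP⟩ := h'.exists_leftAveraged_eq_embed (Φ := Φ)
  obtain ⟨Q, hQ⟩ := h'.symm.exists_leftAveraged_eq_embed (Φ := Φ)
  have embed_P : embed h.left (embed hA (Φ.partitionRatio A' B C' Λ • P)) =
      Φ.partitionRatio A' B C' Λ • embed hΛ (h'.leftAveraged Φ) := by
    rw [hP, embed_embed, embed_embed, embed_smul]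
  have embed_Q : embed h.right (embed hC Q) = embed hΛ (h'.symm.leftAveraged Φ) := by
    rw [hQ, embed_embed, embed_embed]
  refine ⟨embed hA (Φ.partitionRatio A' B C' Λ • P), embed hC Q, ?_, ?_, ?_⟩
  · rw [embed_P, norm_smul, sq]
    exact mul_le_mul hg.norm_partitionRatio_le
      ((norm_embed_le _ _).trans hg.norm_leftAveraged_le) (norm_nonneg _) hg.nonneg
  · rw [embed_Q]
    exact (norm_embed_le _ _).trans hg.symm.norm_leftAveraged_le
  · rw [embed_P, embed_Q, factorizationDefect, sub_sub_cancel, embed_smul, embed_mul,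
      Matrix.smul_mul]

end IsPartition

end Truncation

section UniformInvertibility

variable {d : ℕ} [NeZero d] {Φ : LocalInteraction d} {J t x : ℝ} {R n : ℕ} {a b c e : ℤ}

theorem exists_left_inv_of_norm_sub_le {𝔐 : Type*} [NormedRing 𝔐] [CompleteSpace 𝔐]
    [NormOneClass 𝔐] {p q N : 𝔐} {x y : ℝ} (hN : N * q = 1) (hx : ‖N‖ ≤ x) (hy : ‖p - q‖ ≤ y)
    (hxy : x * y ≤ 1 / 2) : ∃ N' : 𝔐, N' * p = 1 ∧ ‖N'‖ ≤ 2 * x := by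
  have hx_nonneg : 0 ≤ x := (norm_nonneg _).trans hx
  set z := N * (q - p) with hz
  have norm_z_le : ‖z‖ ≤ 1 / 2 := calc
    ‖z‖ ≤ ‖N‖ * ‖q - p‖ := norm_mul_le _ _
    _ ≤ x * y := by rw [norm_sub_rev]; gcongr
    _ ≤ 1 / 2 := hxy
  have norm_z_lt : ‖z‖ < 1 := by linarith
  have mul_p : N * p = 1 - z := by rw [hz, mul_sub, hN, sub_sub_cancel]
  have norm_tsum_le : ‖∑' k : ℕ, z ^ k‖ ≤ 2 := by
    refine (tsum_geometric_le_of_norm_lt_one z norm_z_lt).trans ?_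
    rw [norm_one, sub_self, zero_add]
    exact inv_le_of_inv_le₀ two_pos (by linarith)
  refine ⟨(∑' k : ℕ, z ^ k) * N, ?_, ?_⟩
  · rw [mul_assoc, mul_p]
    exact geom_series_mul_neg z norm_z_lt
  · exact (norm_mul_le _ _).trans (mul_le_mul norm_tsum_le hx (norm_nonneg _) zero_le_two)

/-- The bound for the inverses of the left and right averages when the outer intervals have at most
`truncationWidth R n` sites. -/
def inverseBound (J : ℝ) (R n : ℕ) : ℝ :=
  Real.exp (evolveBound J R) ^ 2 * Real.exp (2 * (J * 2 ^ (2 * R + 1) * truncationWidth R n))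

theorem inverseBound_eq (J : ℝ) (R n : ℕ) : inverseBound J R n =
    inverseBound J R 0 * Real.exp (2 * (J * 2 ^ (2 * R + 1) * R)) ^ n := by
  rw [inverseBound, inverseBound, mul_assoc (_ ^ 2)]
  congr 1
  rw [← Real.exp_nat_mul, ← Real.exp_add]
  simp only [truncationWidth, Nat.cast_add, Nat.cast_mul, Nat.cast_one, Nat.cast_zero]
  ring_nf

theorem exists_inverseBound_mul_truncationError_le (hJ : 0 ≤ J) (R : ℕ) :
    ∃ (n : ℕ) (t : ℝ), 1 ≤ t ∧ inverseBound J R n * truncationError J R t n ≤ 1 / 2 := by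
  set q := Real.exp (2 * (J * 2 ^ (2 * R + 1) * R)) with hq
  have one_le_q : 1 ≤ q := Real.one_le_exp (by positivity)
  set M := inverseBound J R 0 * (Real.exp (3 * evolveBound J R) * evolveTail J R (2 * q)) with hM
  have M_nonneg : 0 ≤ M := by
    have := evolveTail_nonneg hJ R (2 * q)
    rw [hM, inverseBound]
    positivity
  have mul_eq (n : ℕ) :
      inverseBound J R n * truncationError J R (2 * q) n = M * (1 / 2) ^ n := by
    rw [inverseBound_eq, truncationError, hM, ← hq, mul_pow, one_div, inv_pow]
    field_simp
  obtain ⟨n, hn⟩ := exists_pow_lt_of_lt_one (show (0 : ℝ) < 1 / (2 * (M + 1)) by positivity)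
    (show (1 / 2 : ℝ) < 1 by norm_num)
  refine ⟨n, 2 * q, by linarith, ?_⟩
  calc inverseBound J R n * truncationError J R (2 * q) n
    _ = M * (1 / 2) ^ n := mul_eq n
    _ ≤ M * (1 / (2 * (M + 1))) := by gcongr
    _ ≤ 1 / 2 := by
      rw [mul_one_div, div_le_iff₀ (by positivity)]
      linarith

namespace IsLocal

theorem exists_inv_leftAveraged (hΦ : IsLocal Φ J R) (ht : 1 ≤ t)
    (hn : inverseBound J R n * truncationError J R t n ≤ 1 / 2)
    (hab : a ≤ b) (hbc : b ≤ c) (hce : c ≤ e) :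
    ∃ N, N * (isPartition_Ico hab hbc hce).leftAveraged Φ = 1 ∧ ‖N‖ ≤ 2 * inverseBound J R n := by
  have h := isTruncation_left R n hab hce (b := b) (c := c)
  obtain ⟨N, hN, norm_N_le⟩ := (hΦ.isBounded h.left_le hbc h.le_right).exists_inv_leftAveraged
    (hΦ.norm_hamiltonian_le (card_truncation_left_le R n a b))
  refine exists_left_inv_of_norm_sub_le (N := embed h.subset N) ?_
    ((norm_embed_le _ _).trans norm_N_le)
    ((IsPartition.norm_leftAveraged_sub_le _ _ _).trans (hΦ.norm_averaged_sub_le hbc h ht)) hn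
  rw [← embed_mul, hN, embed_one]

theorem exists_inv_symm_leftAveraged (hΦ : IsLocal Φ J R) (ht : 1 ≤ t)
    (hn : inverseBound J R n * truncationError J R t n ≤ 1 / 2)
    (hab : a ≤ b) (hbc : b ≤ c) (hce : c ≤ e) :
    ∃ N, N * (isPartition_Ico hab hbc hce).symm.leftAveraged Φ = 1 ∧
      ‖N‖ ≤ 2 * inverseBound J R n := by
  have h := isTruncation_right R n hab hce (b := b) (c := c)
  obtain ⟨N, hN, norm_N_le⟩ :=
    (hΦ.isBounded h.left_le hbc h.le_right).symm.exists_inv_leftAveraged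
      (hΦ.norm_hamiltonian_le (card_truncation_right_le R n c e))
  refine exists_left_inv_of_norm_sub_le (N := embed h.subset N) ?_
    ((norm_embed_le _ _).trans norm_N_le)
    ((IsPartition.norm_symm_leftAveraged_sub_le _ _ _).trans
      (hΦ.norm_averaged_sub_le hbc h ht)) hn
  rw [← embed_mul, hN, embed_one]

end IsLocal

end UniformInvertibility

section Rate

variable {d : ℕ} [NeZero d] {Φ : LocalInteraction d} {J t ε : ℝ} {R n : ℕ} {a b c e : ℤ}

/-- The bound for the factorization defect after a truncation at distance `n * R`, when the
correlation of the two outer intervals is at most `ε`. -/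
def clusteringError (d : ℕ) (J : ℝ) (R : ℕ) (ε t : ℝ) (n : ℕ) : ℝ :=
  truncationError J R t n + Real.exp (evolveBound J R) * ε * ((d : ℝ) ^ truncationWidth R n) ^ 6 *
    Real.exp (J * 2 ^ (2 * R + 1) * truncationWidth R n) ^ 4

theorem IsLocal.norm_factorizationDefect_le (hΦ : IsLocal Φ J R) (hab : a ≤ b) (hbc : b ≤ c)
    (hce : c ≤ e) (n : ℕ) (ht : 1 ≤ t) (hε : 0 ≤ ε)
    (hcorr : ∀ a' e', a' ≤ b → c ≤ e' →
      corr (Φ.gibbs (Finset.Ico a' e')) (Finset.Ico a' b) (Finset.Ico c e') ≤ ε) :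
    ‖(isPartition_Ico hab hbc hce).factorizationDefect Φ‖ ≤
      4 * Real.exp (evolveBound J R) ^ 4 * clusteringError d J R ε t n := by
  have one_le_g : 1 ≤ Real.exp (evolveBound J R) := Real.one_le_exp (by
    have := energyRate_nonneg hΦ.strength_nonneg R
    unfold evolveBound
    positivity)
  have h := isTruncation R n hab hce (b := b) (c := c)
  have bounded := hΦ.isBounded h.left_le hbc h.le_right
  have defect_le := bounded.norm_factorizationDefect_le_of_corr_le
    (hΦ.norm_hamiltonian_le (card_truncation_left_le R n a b))
    (hΦ.norm_hamiltonian_le (card_truncation_right_le R n c e))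
    (card_truncation_left_le R n a b) (card_truncation_right_le R n c e)
    (hcorr _ _ h.left_le h.le_right) hε
  obtain ⟨P, Q, hP, hQ, hPQ⟩ := bounded.exists_embed_mul_embed_eq (isPartition_Ico hab hbc hce)
    (Finset.Ico_subset_Ico_left h.le_left) (Finset.Ico_subset_Ico_right h.right_le) h.subset
  refine (hΦ.isBounded hab hbc hce).norm_factorizationDefect_le_of_norm_sub_mul_le one_le_g hP hQ ?_
  rw [hPQ, ← embedHom_apply, map_sub, sub_sub_eq_add_sub, add_sub_right_comm]
  exact norm_add_le_of_le (hΦ.norm_averaged_sub_le hbc h ht)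
    ((norm_embed_le _ _).trans defect_le)

theorem truncationError_exp_one (J : ℝ) (R n : ℕ) : truncationError J R (Real.exp 1) n =
    truncationError J R (Real.exp 1) 0 * Real.exp (-n) := by
  rw [truncationError, truncationError, ← Real.exp_nat_mul, mul_one, Real.exp_neg, pow_zero]
  ring

theorem pow_truncationWidth_mul_exp (d : ℕ) [NeZero d] (j : ℝ) (R n : ℕ) :
    ((d : ℝ) ^ truncationWidth R n) ^ 6 * Real.exp (j * truncationWidth R n) ^ 4 =
      Real.exp ((6 * Real.log d + 4 * j) * (R + 1)) *
        Real.exp ((6 * Real.log d + 4 * j) * R * n) := by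
  have d_pos : (0 : ℝ) < d := by exact_mod_cast NeZero.pos d
  rw [← Real.exp_log (pow_pos d_pos (truncationWidth R n)), Real.log_pow, ← Real.exp_nat_mul,
    ← Real.exp_nat_mul, ← Real.exp_add, ← Real.exp_add]
  simp only [truncationWidth, Nat.cast_add, Nat.cast_mul, Nat.cast_one]
  ring_nf

-- With `n = ⌊β ℓ⌋` for a small slope `β`, half of the rate `κ` pays for the growth `exp (lam * n)`.
theorem exists_nat_exp_neg_le {lam κ : ℝ} (hlam : 0 ≤ lam) (hκ : 0 < κ) :
    ∃ α : ℝ, 0 < α ∧ ∀ ℓ : ℝ, 0 ≤ ℓ → ∃ n : ℕ, Real.exp (-n) ≤ Real.exp 1 * Real.exp (-α * ℓ) ∧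
      Real.exp (-κ * ℓ) * Real.exp (lam * n) ≤ Real.exp (-α * ℓ) := by
  set β := κ / (2 * (lam + 1)) with hβ
  have : 0 < β := by positivity
  have lam_mul_β_le : lam * β ≤ κ / 2 := by
    rw [hβ, mul_div_assoc', div_le_iff₀ (by positivity)]
    nlinarith
  refine ⟨min β (κ / 2), by positivity, fun ℓ hℓ => ⟨⌊β * ℓ⌋₊, ?_, ?_⟩⟩
  · have rate_le : min β (κ / 2) * ℓ ≤ β * ℓ := by gcongr; exact min_le_left _ _
    rw [← Real.exp_add]
    gcongr
    linarith [Nat.lt_floor_add_one (β * ℓ)]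
  · have rate_le : min β (κ / 2) * ℓ ≤ κ / 2 * ℓ := by gcongr; exact min_le_right _ _
    have growth_le : lam * ⌊β * ℓ⌋₊ ≤ κ / 2 * ℓ := calc
      lam * ⌊β * ℓ⌋₊ ≤ lam * (β * ℓ) := by gcongr; exact Nat.floor_le (by positivity)
      _ = lam * β * ℓ := (mul_assoc _ _ _).symm
      _ ≤ κ / 2 * ℓ := by gcongr
    rw [← Real.exp_add]
    gcongr
    linarith

theorem exists_clusteringError_le {K κ : ℝ} (d : ℕ) [NeZero d] (hJ : 0 ≤ J) (R : ℕ) (hK : 0 < K)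
    (hκ : 0 < κ) :
    ∃ K' α : ℝ, 0 < K' ∧ 0 < α ∧ ∀ ℓ : ℝ, 0 ≤ ℓ → ∃ n : ℕ,
      clusteringError d J R (K * Real.exp (-κ * ℓ)) (Real.exp 1) n ≤ K' * Real.exp (-α * ℓ) := by
  set j := J * 2 ^ (2 * R + 1)
  set lam := 6 * Real.log d + 4 * j
  set T := truncationError J R (Real.exp 1) 0
  set g := Real.exp (evolveBound J R)
  have lam_nonneg : 0 ≤ lam := by
    have := Real.log_natCast_nonneg d
    positivity
  have T_nonneg : 0 ≤ T := by
    have := evolveTail_nonneg hJ R (Real.exp 1)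
    unfold T truncationError
    positivity
  obtain ⟨α, α_pos, rate⟩ := exists_nat_exp_neg_le (mul_nonneg lam_nonneg R.cast_nonneg) hκ
  refine ⟨T * Real.exp 1 + g * K * Real.exp (lam * (R + 1)), α, by positivity, α_pos,
    fun ℓ hℓ => ?_⟩
  obtain ⟨n, truncation_le, correlation_le⟩ := rate ℓ hℓ
  refine ⟨n, ?_⟩
  calc clusteringError d J R (K * Real.exp (-κ * ℓ)) (Real.exp 1) n
    _ = T * Real.exp (-n) + g * K * Real.exp (lam * (R + 1)) *
        (Real.exp (-κ * ℓ) * Real.exp (lam * R * n)) := by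
      rw [clusteringError, truncationError_exp_one, mul_assoc _ (_ ^ 6),
        pow_truncationWidth_mul_exp]
      ring
    _ ≤ T * (Real.exp 1 * Real.exp (-α * ℓ)) +
        g * K * Real.exp (lam * (R + 1)) * Real.exp (-α * ℓ) := by gcongr
    _ = (T * Real.exp 1 + g * K * Real.exp (lam * (R + 1))) * Real.exp (-α * ℓ) := by ring

end Rate

end SpinChain

end

/-- `I = [a, e)` is split into `A = [a, b)`, `B = [b, c)`, `C = [c, e)`. -/
theorem proposition8p1 (d : ℕ) (hd : 0 < d) (r J Kt αt : ℝ)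
    (hr : 0 < r) (hJ : 0 < J) (hKt : 0 < Kt) (hαt : 0 < αt) :
    ∃ K α : ℝ, 0 < K ∧ 0 < α ∧
      ∀ Φ : SpinChain.LocalInteraction d, Φ.HasRange r → Φ.HasStrength J →
        Φ.UniformClustering (fun ℓ => Kt * Real.exp (-αt * ℓ)) →
        ∀ (a b c e : ℤ) (hab : a ≤ b) (hbc : b ≤ c) (hce : c ≤ e) (ℓ : ℝ),
          0 ≤ 3 * ℓ → 3 * ℓ ≤ (Finset.Ico b c).card →
          ‖(SpinChain.reduced
                (Finset.Ico_subset_Ico_right (hbc.trans hce) : Finset.Ico a b ⊆ Finset.Ico a e)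
                (Φ.gibbs (Finset.Ico a e)))⁻¹ *
              (SpinChain.reduced
                (Finset.Ico_subset_Ico_left (hab.trans hbc) : Finset.Ico c e ⊆ Finset.Ico a e)
                (Φ.gibbs (Finset.Ico a e)))⁻¹ *
              SpinChain.reduced
                (Finset.union_subset (Finset.Ico_subset_Ico_right (hbc.trans hce))
                  (Finset.Ico_subset_Ico_left (hab.trans hbc)) :
                  Finset.Ico a b ∪ Finset.Ico c e ⊆ Finset.Ico a e)
                (Φ.gibbs (Finset.Ico a e)) - 1‖
            ≤ K * Real.exp (-α * ℓ) := by
  open SpinChain in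
  have : NeZero d := ⟨hd.ne'⟩
  obtain ⟨m, t, ht, hm⟩ := exists_inverseBound_mul_truncationError_le hJ.le ⌈r⌉₊
  obtain ⟨K, α, hK, hα, hrate⟩ := exists_clusteringError_le d hJ.le ⌈r⌉₊ hKt hαt
  set g := Real.exp (evolveBound J ⌈r⌉₊)
  set M := 2 * inverseBound J ⌈r⌉₊ m
  have hM : 0 < M := by unfold M inverseBound; positivity
  refine ⟨g * M ^ 2 * (4 * g ^ 4 * K), α, by positivity, hα, ?_⟩
  intro Φ hΦr hΦJ hΦclust a b c e hab hbc hce ℓ hℓ hℓB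
  have hΦ := isLocal_dropConst hΦr hr hΦJ
  have hℓ_nonneg : 0 ≤ ℓ := by linarith
  obtain ⟨n, hn⟩ := hrate ℓ hℓ_nonneg
  have hdefect := hΦ.norm_factorizationDefect_le hab hbc hce n (Real.one_le_exp zero_le_one)
    (by positivity : 0 ≤ Kt * Real.exp (-αt * ℓ)) fun a' e' ha' he' => by
      rw [gibbs_dropConst]
      exact hΦclust.corr_le a' b c e' ha' hbc he' ℓ hℓ_nonneg (by linarith)
  obtain ⟨N, hN, hN_le⟩ := hΦ.exists_inv_leftAveraged ht hm hab hbc hce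
  obtain ⟨N', hN', hN'_le⟩ := hΦ.exists_inv_symm_leftAveraged ht hm hab hbc hce
  rw [← gibbs_dropConst]
  calc _ ≤ g * M ^ 2 * (4 * g ^ 4 * clusteringError d J ⌈r⌉₊ _ _ n) :=
        (hΦ.isBounded hab hbc hce).norm_inv_reduced_mul_inv_reduced_mul_sub_one_le
          hN hN' hN_le hN'_le _ hdefect
    _ ≤ g * M ^ 2 * (4 * g ^ 4 * (K * Real.exp (-α * ℓ))) := by gcongr
    _ = g * M ^ 2 * (4 * g ^ 4 * K) * Real.exp (-α * ℓ) := by ring
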